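/- **Theorem 2.1 (energy conservation for classical solutions with shock fronts).** Let $N\ge 1$, $c>0$, and let $S^-\subset\mathbb R^N$ be a bounded open set whose boundary $S$ is a Lyapunov surface (of class $C^{1,\alpha}$ for some $0<\alpha\le 1$), with unit external normal $n$. Let $G$ be integrable on $S^-\times(0,T)$ for every $T>0$, and let $u$ be a classical solution of $$\Delta u-\frac1{c^2}\,\frac{\partial^2u}{\partial t^2}=G\quad\text{in } S^-\times(0,\infty),$$ $$u(x,0)=u_0(x)\ (x\in S^-\cup S),\qquad u_t(x,0)=\dot u_0(x)\ (x\in S^-),$$ $$u=u_S(x,t),\qquad \frac{\partial u}{\partial n}=p(x,t)\qquad (x\in S,\ t\ge 0).$$ Here "classical solution" means the following. There are at most countably many wave fronts $F_k\subset S^-\times(0,\infty)$ and a closed set $Z\subset\mathbb R^{N}\times\mathbb R$ of $N$-dimensional Hausdorff measure zero (containing edges of fronts and the points where fronts meet one another, the boundary, or $t=0$) such that $\Sigma=Z\cup\bigcup_kF_k$ is closed. The function $u$ is continuous on $(S^-\cup S)\times[0,\infty)$; off $\Sigma$ it is $C^1$ on this closed cylinder and $C^2$ in its interior $S^-\times(0,\infty)$,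 and there it satisfies the equation; the conditions on $u_t(\cdot,0)$ and $\partial u/\partial n$ are required off $Z$; and the first derivatives of $u$ off $\Sigma$ are bounded on $S^-\times(0,T)$ for every $T>0$. A wave front is a $C^1$ hypersurface of space-time, given near each of its points by an equation $f(x,t)=0$ with $\operatorname{grad}_xf\ne0$ and $f_t=-c\,\|\operatorname{grad}_xf\|$ at that point, so that it moves with speed $c$ in the direction of $m=\operatorname{grad}_xf/\|\operatorname{grad}_xf\|$. At every point of $F_k\setminus Z$ the function $u$ and its first derivatives have limits, taken off $\Sigma$, from each of the two sides $f>0$ (superscript $+$) and $f<0$ (superscript $-$), and Hadamard's conditions hold: $$[u]=0,\qquad \Big[u_t+c\sum_{i=1}^N m_iu_{x_i}\Big]=0,\qquad [h]=h^+-h^-.$$ Put $E=\frac12\Big(c^{-2}u_t^2+\sum_{j=1}^Nu_{x_j}^2\Big)$ and $\dot u_S=\partial u_S/\partial t$. Then for every $t\ge 0$ the functions $E(\cdot,t)$ and $E(\cdot,0)$ are integrable over $S^-$, $Gu_t$ is integrable over $S^-\times(0,t)$, $\dot u_S\,p$ is integrable over $S\times(0,t)$, and $$\int_{S^-}\big(E(x,t)-E(x,0)\big)\,dV(x)=-\int_0^t\!\int_{S^-}G(x,s)\,u_t(x,s)\,dV(x)\,ds+\int_0^t\!\int_S\dot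 u_S(x,s)\,p(x,s)\,dS(x)\,ds .$$ -/

import Mathlib

open Set Filter Topology MeasureTheory
open scoped NNReal

noncomputable section

/-- Space `ℝ^N` with the Euclidean norm. -/
abbrev Space (N : ℕ) : Type := EuclideanSpace ℝ (Fin N)

/-- Space-time: pairs `(x, t)` with `x ∈ ℝ^N` and `t ∈ ℝ`. -/
abbrev SpaceTime (N : ℕ) : Type := Space N × ℝ

/-- The gradient in the space variable of `f` at the point `q = (x, t)`. -/
def spaceGradient {N : ℕ} (f : SpaceTime N → ℝ) (q : SpaceTime N) : Space N :=
  gradient (fun y : Space N => f (y, q.2)) q.1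

/-! ### Lyapunov domains -/

/-- Near its zero `x` the function `g` is a `C^{1,α}` defining function of the open set `Ω`:
`Ω` is locally `{g < 0}`, and the gradient of `g` does not vanish at `x` and is locally
`α`-Hölder. -/
structure IsDefiningFunction {N : ℕ} (Ω : Set (Space N)) (α : ℝ≥0) (x : Space N)
    (g : Space N → ℝ) : Prop where
  contDiffAt : ContDiffAt ℝ 1 g x
  eq_zero : g x = 0
  gradient_ne_zero : gradient g x ≠ 0
  holder : ∃ C : ℝ≥0, ∃ U ∈ 𝓝 x, HolderOnWith C α (gradient g) U
  mem_iff : ∀ᶠ y in 𝓝 x, y ∈ Ω ↔ g y < 0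

/-- A bounded open set whose boundary is a Lyapunov surface, that is, a closed surface of class
`C^{1,α}` for some `0 < α ≤ 1`. -/
structure IsLyapunovDomain {N : ℕ} (Ω : Set (Space N)) : Prop where
  isOpen : IsOpen Ω
  isBounded : Bornology.IsBounded Ω
  boundary : ∃ α : ℝ≥0, 0 < α ∧ α ≤ 1 ∧ ∀ x ∈ frontier Ω, ∃ g, IsDefiningFunction Ω α x g

/-- `n` is the unit vector of the external normal to the boundary of `Ω` at `x`. -/
def IsOuterUnitNormal {N : ℕ} (Ω : Set (Space N)) (x n : Space N) : Prop :=
  ∃ α : ℝ≥0, 0 < α ∧ ∃ g, IsDefiningFunction Ω α x g ∧ n = ‖gradient g x‖⁻¹ • gradient g x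

/-! ### The space-time cylinder and first derivatives on it -/

/-- The open cylinder `Ω × (0, ∞)`. -/
def openCylinder {N : ℕ} (Ω : Set (Space N)) : Set (SpaceTime N) := Ω ×ˢ Ioi (0 : ℝ)

/-- The closed cylinder `(Ω ∪ S) × [0, ∞)`, where `S` is the boundary of `Ω`. -/
def closedCylinder {N : ℕ} (Ω : Set (Space N)) : Set (SpaceTime N) := closure Ω ×ˢ Ici (0 : ℝ)

/-- The derivative of `u` with respect to `(x, t)`, relative to the closed cylinder; at interior
points it is the usual derivative, at `t = 0` and on the boundary it is the one-sided one. -/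
def cylDeriv {N : ℕ} (Ω : Set (Space N)) (u : SpaceTime N → ℝ) (q : SpaceTime N) :
    SpaceTime N →L[ℝ] ℝ :=
  fderivWithin ℝ u (closedCylinder Ω) q

/-- The velocity `u_t` at `q = (x, t)`. -/
def velocity {N : ℕ} (Ω : Set (Space N)) (u : SpaceTime N → ℝ) (q : SpaceTime N) : ℝ :=
  cylDeriv Ω u q (0, 1)

/-- The derivative of `u` at `q = (x, t)` in the direction `v` of space;
`∂u/∂x_j` is the case `v = e_j` and `∂u/∂n` the case `v = n`. -/
def spaceDeriv {N : ℕ} (Ω : Set (Space N)) (u : SpaceTime N → ℝ) (q : SpaceTime N)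
    (v : Space N) : ℝ :=
  cylDeriv Ω u q (v, 0)

/-- The energy density `E = (u_τ ^ 2 + ∑ u_{x_j} ^ 2) / 2`, where `τ = c t`, so `u_τ = u_t / c`. -/
def energyDensity {N : ℕ} (c : ℝ) (Ω : Set (Space N)) (u : SpaceTime N → ℝ)
    (q : SpaceTime N) : ℝ :=
  1 / 2 * ((velocity Ω u q / c) ^ 2
    + ∑ j : Fin N, (spaceDeriv Ω u q (EuclideanSpace.single j 1)) ^ 2)

/-! ### Wave fronts and Hadamard's conditions -/

/-- Near its point `p` the set `F` is the `C^1` surface `f = 0`, with `grad_x f ≠ 0`, and it moves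
at `p` in the direction `n = grad_x f / ‖grad_x f‖` with speed `c = - f_t / ‖grad_x f‖`.
Equivalently, the space-time normal is characteristic with negative time component. -/
structure IsFrontEquation {N : ℕ} (c : ℝ) (F : Set (SpaceTime N)) (p : SpaceTime N)
    (f : SpaceTime N → ℝ) : Prop where
  contDiffAt : ContDiffAt ℝ 1 f p
  mem_iff : ∀ᶠ q in 𝓝 p, q ∈ F ↔ f q = 0
  gradient_ne_zero : spaceGradient f p ≠ 0
  speed : deriv (fun s : ℝ => f (p.1, s)) p.2 = -c * ‖spaceGradient f p‖

/-- A wave front: a `C^1` hypersurface of space-time that moves in its normal direction with the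
constant speed `c`, i.e. a characteristic surface. -/
def IsWaveFront {N : ℕ} (c : ℝ) (F : Set (SpaceTime N)) : Prop :=
  ∀ p ∈ F, ∃ f, IsFrontEquation c F p f

/-- Hadamard's conditions for `u` at a point `p` of the front `f = 0`. The set `Sing` is the set of
all points where `u` need not be differentiable. The function `u` and its first derivatives have
limits (marked `⁺` and `⁻`) at `p` from the side `f > 0` ahead of the front and from the side
`f < 0` behind it, and `[u] = 0`, `[u_t + c n_i u_{x_i}] = 0`, where `[h] = h⁺ - h⁻` and `n` is the
unit normal to the moving front, directed to the side of its spreading. -/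
def HadamardConditions {N : ℕ} (c : ℝ) (Ω : Set (Space N)) (Sing : Set (SpaceTime N))
    (u : SpaceTime N → ℝ) (f : SpaceTime N → ℝ) (p : SpaceTime N) : Prop :=
  ∃ (b₁ b₂ : ℝ) (a₁ a₂ : SpaceTime N →L[ℝ] ℝ),
    Tendsto u (𝓝[{q | 0 < f q} \ Sing] p) (𝓝 b₁) ∧
    Tendsto u (𝓝[{q | f q < 0} \ Sing] p) (𝓝 b₂) ∧
    Tendsto (cylDeriv Ω u) (𝓝[{q | 0 < f q} \ Sing] p) (𝓝 a₁) ∧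
    Tendsto (cylDeriv Ω u) (𝓝[{q | f q < 0} \ Sing] p) (𝓝 a₂) ∧
    b₁ - b₂ = 0 ∧
    (a₁ (0, 1) + c * a₁ (‖spaceGradient f p‖⁻¹ • spaceGradient f p, 0))
      - (a₂ (0, 1) + c * a₂ (‖spaceGradient f p‖⁻¹ • spaceGradient f p, 0)) = 0

/-! ### Classical solutions of the boundary value problem -/

/-- `u` is a classical solution, with shock fronts, of `Δu - c⁻² u_tt = G` in `Ω × (0, ∞)`, with
initial data `u₀`, `v₀` and with boundary values `uS` of `u` and `p` of `∂u/∂n`. It is continuous on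
the closed cylinder, `C^1` there and `C^2` inside, except on
* at most countably many wave fronts `F k` (finitely many if the others are empty), on which
  Hadamard's conditions hold, and
* a closed set `Z` of `N`-dimensional measure zero, where fronts meet each other, the boundary or
  `t = 0`, or have edges; nothing is required there, except that the first derivatives of `u` stay
  bounded in finite time. -/
structure IsClassicalSolution {N : ℕ} (c : ℝ) (Ω : Set (Space N)) (G : SpaceTime N → ℝ)
    (u₀ v₀ : Space N → ℝ) (uS p : Space N → ℝ → ℝ)
    (F : ℕ → Set (SpaceTime N)) (Z : Set (SpaceTime N)) (u : SpaceTime N → ℝ) : Prop where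
  isWaveFront : ∀ k, IsWaveFront c (F k)
  front_subset : ∀ k, F k ⊆ openCylinder Ω
  isClosed_exceptional : IsClosed Z
  exceptional_null : Measure.hausdorffMeasure (N : ℝ) Z = 0
  isClosed_singular : IsClosed (Z ∪ ⋃ k, F k)
  continuousOn : ContinuousOn u (closedCylinder Ω)
  contDiffOn : ContDiffOn ℝ 2 u (openCylinder Ω \ (Z ∪ ⋃ k, F k))
  differentiableWithinAt : ∀ q ∈ closedCylinder Ω \ (Z ∪ ⋃ k, F k),
    DifferentiableWithinAt ℝ u (closedCylinder Ω) q
  continuousOn_deriv : ContinuousOn (cylDeriv Ω u) (closedCylinder Ω \ (Z ∪ ⋃ k, F k))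
  bounded_deriv : ∀ T : ℝ, ∃ M : ℝ, ∀ q ∈ closedCylinder Ω \ (Z ∪ ⋃ k, F k),
    q.2 ≤ T → ‖cylDeriv Ω u q‖ ≤ M
  hadamard : ∀ k, ∀ q ∈ F k \ Z, ∀ f, IsFrontEquation c (F k) q f →
    HadamardConditions c Ω (Z ∪ ⋃ k, F k) u f q
  wave_equation : ∀ q ∈ openCylinder Ω \ (Z ∪ ⋃ k, F k),
    Laplacian.laplacian (fun y : Space N => u (y, q.2)) q.1
      - 1 / c ^ 2 * iteratedDeriv 2 (fun s : ℝ => u (q.1, s)) q.2 = G q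
  initial_value : ∀ x ∈ closure Ω, u (x, 0) = u₀ x
  initial_velocity : ∀ x ∈ Ω, (x, (0 : ℝ)) ∉ Z → velocity Ω u (x, 0) = v₀ x
  boundary_value : ∀ x ∈ frontier Ω, ∀ t : ℝ, 0 ≤ t → u (x, t) = uS x t
  boundary_normal_deriv : ∀ x ∈ frontier Ω, ∀ t : ℝ, 0 ≤ t → (x, t) ∉ Z →
    ∀ n, IsOuterUnitNormal Ω x n → spaceDeriv Ω u (x, t) n = p x t

end

/-! The energy density is the time component of the space-time field V = (-u_t ∇u, E). Where u is
C², the divergence of V is u_t (c⁻² u_tt - Δu) = -G u_t, so the theorem is the divergence theorem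
for V on Ω × (0, t): the bottom and the top give the two energies, and the lateral boundary gives
u_t ∂u/∂n, where u_t is the time derivative of the boundary values because time is tangent to that
boundary. The work lies in showing that the singular set contributes nothing, and for this the
balance is kept in weak form (`IsWeakDiv`) until the end.

Fronts: u is continuous, so its derivatives tangential to a front do not jump and du jumps by a
multiple of the conormal df (`tangential_eq`). The conormal is null for the wave operator, and
adding a multiple of a null covector to du leaves the flux of V through the surface unchanged
(`conormal_energyFlux_add`). Equal fluxes from both sides cancel (`IsWeakDiv.of_graph`). Other
fronts may accumulate near a given point; still, a timelike line meets each front in a countable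
set, so the fundamental theorem of calculus remains available along timelike segments
(`abs_sub_le_of_timelike`).

The set Z: it is null in codimension one and V is bounded, so Z is removed by cut-off functions
whose gradients are small in L¹ (`IsWeakDiv.of_diff_null`). Countably many fronts are removed
together by a Baire category argument (`IsWeakDiv.of_interfaces`).

Boundary: near a boundary point Ω lies above a graph. Testing with cut-offs of the height above the
graph produces the trace of the flux from pointwise one-sided limits alone (`integral_above_graph`),
and the area formula identifies the resulting density with Hausdorff measure
(`euclideanHausdorffMeasure_image_eq_lintegral`).

Initial and final energies: a cut-off in time tends to the indicator of (0, t). For almost every x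
the points (x, 0) and (x, t) are regular, so the boundary layers in time converge to the energies at
these instants (`energy_balance`). -/

noncomputable section

/-! ### Test functions and weak divergence -/

section WeakDiv

set_option linter.unusedSectionVars false

variable {E : Type*} [NormedAddCommGroup E] [NormedSpace ℝ E]

/-- `φ` is a compactly supported `C^1` function with support in `A`. -/
structure IsTest (A : Set E) (φ : E → ℝ) : Prop where
  contDiff : ContDiff ℝ 1 φ
  compact : HasCompactSupport φ
  subset : tsupport φ ⊆ A

/-- `h` is the distributional divergence on `A` of the vector field `V`. -/
def IsWeakDiv [MeasurableSpace E] (μ : Measure E) (V : E → E) (h : E → ℝ) (A : Set E) : Prop :=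
  ∀ φ : E → ℝ, IsTest A φ → ∫ q, (fderiv ℝ φ q (V q) + h q * φ q) ∂μ = 0

namespace IsTest

variable {A B : Set E} {φ ψ : E → ℝ}

lemma mono (h : IsTest A φ) (hAB : A ⊆ B) : IsTest B φ := ⟨h.contDiff, h.compact, h.subset.trans hAB⟩

lemma zero : IsTest A (0 : E → ℝ) := by
  refine ⟨contDiff_const, HasCompactSupport.zero, ?_⟩
  simp [tsupport]

lemma add (h : IsTest A φ) (h' : IsTest A ψ) : IsTest A (φ + ψ) :=
  ⟨h.contDiff.add h'.contDiff, h.compact.add h'.compact,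
    (tsupport_add φ ψ).trans (union_subset h.subset h'.subset)⟩

lemma mul_left (h : IsTest A φ) (hψ : ContDiff ℝ 1 ψ) : IsTest A (fun q => ψ q * φ q) :=
  ⟨hψ.mul h.contDiff, h.compact.mul_left, (tsupport_mul_subset_right).trans h.subset⟩

lemma differentiable (h : IsTest A φ) : Differentiable ℝ φ := h.contDiff.differentiable one_ne_zero

lemma continuous_fderiv (h : IsTest A φ) : Continuous (fderiv ℝ φ) :=
  h.contDiff.continuous_fderiv one_ne_zero

lemma eq_zero (h : IsTest A φ) {q : E} (hq : q ∉ A) : φ q = 0 :=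
  image_eq_zero_of_notMem_tsupport fun h' => hq (h.subset h')

lemma fderiv_eq_zero (h : IsTest A φ) {q : E} (hq : q ∉ A) : fderiv ℝ φ q = 0 :=
  image_eq_zero_of_notMem_tsupport fun h' => hq (h.subset (tsupport_fderiv_subset ℝ h'))

lemma exists_bound (h : IsTest A φ) : ∃ C, 0 ≤ C ∧ ∀ q, ‖φ q‖ ≤ C ∧ ‖fderiv ℝ φ q‖ ≤ C := by
  obtain ⟨C₁, h₁⟩ := h.compact.exists_bound_of_continuous h.contDiff.continuous
  obtain ⟨C₂, h₂⟩ := (h.compact.fderiv ℝ).exists_bound_of_continuous h.continuous_fderiv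
  exact ⟨max C₁ C₂, (norm_nonneg _).trans ((h₁ 0).trans (le_max_left _ _)),
    fun q => ⟨(h₁ q).trans (le_max_left _ _), (h₂ q).trans (le_max_right _ _)⟩⟩

variable [FiniteDimensional ℝ E]

/-- Localization by a partition of unity. -/
lemma induction_local {P : (E → ℝ) → Prop} (zero : P 0)
    (add : ∀ φ ψ, IsTest A φ → IsTest A ψ → P φ → P ψ → P (φ + ψ))
    (loc : ∀ q ∈ A, ∃ B ∈ 𝓝 q, ∀ φ, IsTest (A ∩ B) φ → P φ) (hφ : IsTest A φ) : P φ := by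
  classical
  choose! B hB hP using loc
  have hK : IsCompact (tsupport φ) := hφ.compact
  obtain ⟨t, htK, htc⟩ := hK.elim_nhds_subcover (fun q => interior (B q))
    (fun q hq => interior_mem_nhds.2 (hB q (hφ.subset hq)))
  obtain ⟨ρ, hρ⟩ := SmoothPartitionOfUnity.exists_isSubordinate (modelWithCornersSelf ℝ E)
    (isClosed_tsupport φ) (fun q : t => interior (B q)) (fun q => isOpen_interior)
    (by intro q hq; simpa using htc hq)
  have hsum : φ = ∑ q : t, fun x => ρ q x * φ x := by
    ext x
    rw [Finset.sum_apply, ← Finset.sum_mul]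
    by_cases hx : x ∈ tsupport φ
    · have := ρ.sum_eq_one hx
      rw [finsum_eq_sum_of_fintype] at this
      rw [this, one_mul]
    · rw [image_eq_zero_of_notMem_tsupport hx, mul_zero]
  have htest : ∀ q : t, IsTest (A ∩ B q) (fun x => ρ q x * φ x) := by
    intro q
    have h1 : ContDiff ℝ 1 (ρ q) := (ρ q).contMDiff.contDiff.of_le (by exact_mod_cast le_top)
    have := hφ.mul_left h1
    refine ⟨this.contDiff, this.compact, subset_inter this.subset ?_⟩
    exact (tsupport_mul_subset_left).trans ((hρ q).trans interior_subset)
  have key : ∀ s : Finset t, IsTest A (∑ q ∈ s, fun x => ρ q x * φ x) ∧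
      P (∑ q ∈ s, fun x => ρ q x * φ x) := by
    intro s
    induction s using Finset.induction_on with
    | empty => simpa using ⟨IsTest.zero, zero⟩
    | insert a s ha ih =>
      rw [Finset.sum_insert ha]
      have h1 := (htest a).mono inter_subset_left
      exact ⟨h1.add ih.1, add _ _ h1 ih.1 (hP a (hφ.subset (htK a a.2)) _ (htest a)) ih.2⟩
  rw [hsum]
  exact (key Finset.univ).2

end IsTest

variable [FiniteDimensional ℝ E] [MeasurableSpace E] [BorelSpace E] {μ : Measure E}
  {V : E → E} {h : E → ℝ} {A B : Set E} {φ : E → ℝ}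

lemma integrable_clm_apply {L : E → E →L[ℝ] ℝ} {C : ℝ} (hV : Integrable V μ)
    (hL : AEStronglyMeasurable L μ) (hC : ∀ q, ‖L q‖ ≤ C) : Integrable (fun q => L q (V q)) μ := by
  refine (hV.norm.const_mul C).mono' ?_ (Eventually.of_forall fun q => ?_)
  · exact (ContinuousLinearMap.id ℝ (E →L[ℝ] ℝ)).aestronglyMeasurable_comp₂ hL hV.1
  · exact ((L q).le_opNorm _).trans (mul_le_mul_of_nonneg_right (hC q) (norm_nonneg _))

lemma IsTest.integrableOn_flux (hφ : IsTest A φ) {K : Set E} (hV : IntegrableOn V K μ) :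
    IntegrableOn (fun q => fderiv ℝ φ q (V q)) K μ := by
  obtain ⟨C, -, hC⟩ := hφ.exists_bound
  exact integrable_clm_apply hV hφ.continuous_fderiv.aestronglyMeasurable (fun q => (hC q).2)

lemma IsTest.integrableOn_mul (hφ : IsTest A φ) {K : Set E} (hh : IntegrableOn h K μ) :
    IntegrableOn (fun q => h q * φ q) K μ := by
  obtain ⟨C, -, hC⟩ := hφ.exists_bound
  exact hh.mul_bdd hφ.contDiff.continuous.aestronglyMeasurable
    (Eventually.of_forall fun q => (hC q).1)

lemma IsTest.integrable_flux (hφ : IsTest A φ) (hV : LocallyIntegrableOn V A μ) :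
    Integrable (fun q => fderiv ℝ φ q (V q)) μ := by
  refine (integrableOn_iff_integrable_of_support_subset (s := tsupport φ) ?_).1
    (hφ.integrableOn_flux (hV.integrableOn_compact_subset hφ.subset hφ.compact))
  intro q hq
  by_contra hq'
  exact hq (by simp [image_eq_zero_of_notMem_tsupport fun h' => hq' (tsupport_fderiv_subset ℝ h')])

lemma IsTest.integrable_mul (hφ : IsTest A φ) (hh : LocallyIntegrableOn h A μ) :
    Integrable (fun q => h q * φ q) μ := by
  refine (integrableOn_iff_integrable_of_support_subset (s := tsupport φ) ?_).1
    (hφ.integrableOn_mul (hh.integrableOn_compact_subset hφ.subset hφ.compact))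
  intro q hq
  by_contra hq'
  exact hq (by simp [image_eq_zero_of_notMem_tsupport hq'])

lemma IsTest.integrable (hφ : IsTest A φ) (hV : LocallyIntegrableOn V A μ)
    (hh : LocallyIntegrableOn h A μ) : Integrable (fun q => fderiv ℝ φ q (V q) + h q * φ q) μ :=
  (hφ.integrable_flux hV).add (hφ.integrable_mul hh)

lemma IsWeakDiv.mono (H : IsWeakDiv μ V h B) (hAB : A ⊆ B) : IsWeakDiv μ V h A :=
  fun φ hφ => H φ (hφ.mono hAB)

/-- The defining identity is additive in the test function, so a partition of unity reduces it to
small supports. -/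
lemma isWeakDiv_of_local (hV : LocallyIntegrableOn V A μ) (hh : LocallyIntegrableOn h A μ)
    (loc : ∀ q ∈ A, ∃ B ∈ 𝓝 q, IsWeakDiv μ V h (A ∩ B)) : IsWeakDiv μ V h A := by
  intro φ hφ
  refine hφ.induction_local (P := fun φ => ∫ q, (fderiv ℝ φ q (V q) + h q * φ q) ∂μ = 0)
    (by simp) ?_ loc
  intro φ ψ hφ hψ h1 h2
  have : ∀ q, fderiv ℝ (φ + ψ) q (V q) + h q * (φ + ψ) q =
      (fderiv ℝ φ q (V q) + h q * φ q) + (fderiv ℝ ψ q (V q) + h q * ψ q) := by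
    intro q
    rw [fderiv_add (hφ.differentiable q) (hψ.differentiable q)]
    simp only [add_apply, Pi.add_apply]
    ring
  simp_rw [this]
  rw [integral_add (hφ.integrable hV hh) (hψ.integrable hV hh), h1, h2, add_zero]

end WeakDiv

/-! ### One-sided approximation of the identity -/

/-- A smooth step, `0` on `(-∞, 1]` and `1` on `[2, ∞)`. -/
def smoothStep (r : ℝ) : ℝ := Real.smoothTransition (r - 1)

lemma contDiff_smoothStep : ContDiff ℝ 1 smoothStep :=
  Real.smoothTransition.contDiff.comp (contDiff_id.sub contDiff_const)

lemma smoothStep_of_le {r : ℝ} (h : r ≤ 1) : smoothStep r = 0 :=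
  Real.smoothTransition.zero_of_nonpos (by linarith)

lemma smoothStep_of_ge {r : ℝ} (h : 2 ≤ r) : smoothStep r = 1 :=
  Real.smoothTransition.one_of_one_le (by linarith)

lemma abs_smoothStep_le (r : ℝ) : |smoothStep r| ≤ 1 := by
  rw [smoothStep, abs_of_nonneg (Real.smoothTransition.nonneg _)]
  exact Real.smoothTransition.le_one _

lemma continuous_deriv_smoothStep : Continuous (deriv smoothStep) :=
  contDiff_smoothStep.continuous_deriv le_rfl

lemma deriv_smoothStep_eq_zero {r : ℝ} (h : r ∉ Icc (1 : ℝ) 2) : deriv smoothStep r = 0 := by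
  rw [mem_Icc, not_and_or, not_le, not_le] at h
  rcases h with h | h
  · have : smoothStep =ᶠ[𝓝 r] fun _ => 0 := by
      filter_upwards [Iio_mem_nhds h] with s hs using smoothStep_of_le (le_of_lt hs)
    rw [this.deriv_eq, deriv_const]
  · have : smoothStep =ᶠ[𝓝 r] fun _ => 1 := by
      filter_upwards [Ioi_mem_nhds h] with s hs using smoothStep_of_ge (le_of_lt hs)
    rw [this.deriv_eq, deriv_const]

lemma hasCompactSupport_deriv_smoothStep : HasCompactSupport (deriv smoothStep) :=
  HasCompactSupport.intro isCompact_Icc fun _ h => deriv_smoothStep_eq_zero h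

lemma integral_deriv_smoothStep : ∫ r, deriv smoothStep r = 1 := by
  have h1 : ∫ r in (1 : ℝ)..2, deriv smoothStep r = 1 := by
    rw [intervalIntegral.integral_deriv_eq_sub
      (fun x _ => contDiff_smoothStep.differentiable one_ne_zero x)
      (continuous_deriv_smoothStep.intervalIntegrable _ _), smoothStep_of_le le_rfl,
      smoothStep_of_ge le_rfl, sub_zero]
  rw [intervalIntegral.integral_of_le one_le_two, ← integral_Icc_eq_integral_Ioc,
    setIntegral_eq_integral_of_forall_compl_eq_zero (fun r h => deriv_smoothStep_eq_zero h)] at h1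
  exact h1

/-- The derivative of `r ↦ smoothStep (a r)`. -/
def stepKernel (a r : ℝ) : ℝ := a * deriv smoothStep (a * r)

lemma continuous_stepKernel (a : ℝ) : Continuous (stepKernel a) :=
  continuous_const.mul (continuous_deriv_smoothStep.comp (continuous_const.mul continuous_id))

lemma stepKernel_eq_zero {a r : ℝ} (ha : 0 < a) (hr : r ∉ Icc (1 / a) (2 / a)) :
    stepKernel a r = 0 := by
  rw [stepKernel, deriv_smoothStep_eq_zero, mul_zero]
  contrapose! hr
  rw [mem_Icc] at hr ⊢
  rw [div_le_iff₀ ha, le_div_iff₀ ha, mul_comm r]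
  exact hr

lemma integral_stepKernel {a : ℝ} (ha : 0 < a) : ∫ r, stepKernel a r = 1 := by
  simp_rw [stepKernel]
  rw [integral_const_mul, Measure.integral_comp_mul_left (fun r => deriv smoothStep r),
    integral_deriv_smoothStep, abs_of_pos (inv_pos.2 ha), smul_eq_mul, mul_one,
    mul_inv_cancel₀ ha.ne']

lemma integral_abs_stepKernel {a : ℝ} (ha : 0 < a) :
    ∫ r, |stepKernel a r| = ∫ r, |deriv smoothStep r| := by
  simp_rw [stepKernel, abs_mul]
  rw [integral_const_mul, Measure.integral_comp_mul_left (fun r => |deriv smoothStep r|),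
    abs_of_pos (inv_pos.2 ha), abs_of_pos ha, smul_eq_mul, ← mul_assoc,
    mul_inv_cancel₀ ha.ne', one_mul]

lemma integrable_stepKernel {a : ℝ} (ha : 0 < a) : Integrable (stepKernel a) :=
  (continuous_stepKernel a).integrable_of_hasCompactSupport
    (HasCompactSupport.intro isCompact_Icc fun _ h => stepKernel_eq_zero ha h)

/-- The kernels have mass one, bounded L¹ norm and support in `[1 / (n + 1), 2 / (n + 1)]`, so only
values of `k` at small positive arguments matter, and a null set of these may be ignored. -/
lemma tendsto_integral_stepKernel_mul {k : ℝ → ℝ} {l b : ℝ} {N : Set ℝ}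
    (hk : AEStronglyMeasurable k volume) (hb : ∀ᵐ r, ‖k r‖ ≤ b) (hN : volume N = 0)
    (hl : Tendsto k (𝓝[{r | 0 < r ∧ r ∉ N}] 0) (𝓝 l)) :
    Tendsto (fun n : ℕ => ∫ r, stepKernel (n + 1) r * k r) atTop (𝓝 l) := by
  set C : ℝ := ∫ r, |deriv smoothStep r|
  have hC : 0 ≤ C := integral_nonneg fun _ => abs_nonneg _
  have hpos : ∀ n : ℕ, (0 : ℝ) < n + 1 := fun n => by positivity
  have hint : ∀ n : ℕ, Integrable (fun r => stepKernel (n + 1) r * k r) := fun n =>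
    (integrable_stepKernel (hpos n)).mul_bdd hk hb
  rw [Metric.tendsto_atTop]
  intro ε hε
  -- `C` is the L¹ norm of every kernel; `C + 1` makes the final estimate strict.
  have hε' : 0 < ε / (C + 1) := by positivity
  rw [Metric.tendsto_nhdsWithin_nhds] at hl
  obtain ⟨δ, hδ, hkl⟩ := hl (ε / (C + 1)) hε'
  obtain ⟨n₀, hn₀⟩ := exists_nat_gt (2 / δ)
  refine ⟨n₀, fun n hn => ?_⟩
  have hn' : 2 / ((n : ℝ) + 1) < δ := by
    rw [div_lt_iff₀ (hpos n)]
    rw [div_lt_iff₀ hδ] at hn₀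
    have : (n₀ : ℝ) ≤ n := by exact_mod_cast hn
    nlinarith
  have h1 : (∫ r, stepKernel (n + 1) r * k r) - l
      =  (∫ r, stepKernel (n + 1) r * k r) - ∫ r, stepKernel (n + 1) r * l := by
    rw [integral_mul_const, integral_stepKernel (hpos n), one_mul]
  rw [Real.dist_eq, h1, ← integral_sub (hint n) ((integrable_stepKernel (hpos n)).mul_const _),
    ← Real.norm_eq_abs]
  calc ‖∫ r, (stepKernel (n + 1) r * k r - stepKernel (n + 1) r * l)‖
      ≤ ∫ r, |stepKernel (n + 1) r| * (ε / (C + 1)) := by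
        refine norm_integral_le_of_norm_le
          ((integrable_stepKernel (hpos n)).norm.mul_const _) ?_
        filter_upwards [measure_eq_zero_iff_ae_notMem.1 hN] with r hr
        rw [← mul_sub, norm_mul, Real.norm_eq_abs]
        by_cases hmem : r ∈ Icc (1 / ((n : ℝ) + 1)) (2 / (n + 1))
        · have hr0 : 0 < r := lt_of_lt_of_le (by have := hpos n; positivity) hmem.1
          refine mul_le_mul_of_nonneg_left (le_of_lt ?_) (abs_nonneg _)
          have := hkl ⟨hr0, hr⟩ (by
            rw [Real.dist_eq, sub_zero, abs_of_pos hr0]; exact hmem.2.trans_lt hn')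
          rwa [Real.dist_eq] at this
        · rw [stepKernel_eq_zero (hpos n) hmem]
          simp
    _ = C * (ε / (C + 1)) := by rw [integral_mul_const, integral_abs_stepKernel (hpos n)]
    _ < ε := by
      rw [← mul_div_assoc, div_lt_iff₀ (by positivity)]
      nlinarith

/-- Fubini applies the one-dimensional limit on almost every fibre, where `N` leaves a null set; the
fibre integrals are dominated by `C * b y`. -/
lemma tendsto_integral_stepKernel_prod {Y : Type*} [MeasurableSpace Y] {ν : Measure Y}
    [SFinite ν] {k : Y × ℝ → ℝ} {l b : Y → ℝ} {N : Set (Y × ℝ)}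
    (hk : AEStronglyMeasurable k (ν.prod volume)) (hbi : Integrable b ν)
    (hb : ∀ᵐ p ∂ν.prod volume, ‖k p‖ ≤ b p.1) (hN : (ν.prod volume) N = 0)
    (hl : ∀ᵐ y ∂ν, Tendsto (fun r => k (y, r)) (𝓝[{r | 0 < r ∧ (y, r) ∉ N}] 0) (𝓝 (l y))) :
    Tendsto (fun n : ℕ => ∫ p, stepKernel (n + 1) p.2 * k p ∂ν.prod volume) atTop
      (𝓝 (∫ y, l y ∂ν)) := by
  set C : ℝ := ∫ r, |deriv smoothStep r|
  have hpos : ∀ n : ℕ, (0 : ℝ) < n + 1 := fun n => by positivity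
  have hm : ∀ n : ℕ, AEStronglyMeasurable (fun p : Y × ℝ => stepKernel (n + 1) p.2 * k p)
      (ν.prod volume) := fun n =>
    (((continuous_stepKernel (n + 1)).measurable.comp measurable_snd).aestronglyMeasurable).mul hk
  have hb' := Measure.ae_ae_of_ae_prod hb
  have hdom : ∀ n : ℕ, Integrable (fun p : Y × ℝ => stepKernel (n + 1) p.2 * k p)
      (ν.prod volume) := by
    intro n
    have := (hbi.mul_prod (integrable_stepKernel (hpos n)).norm)
    refine this.mono' (hm n) ?_
    filter_upwards [hb] with p hp
    rw [norm_mul, mul_comm]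
    exact mul_le_mul_of_nonneg_right hp (norm_nonneg _)
  simp_rw [fun n => integral_prod _ (hdom n)]
  refine tendsto_integral_of_dominated_convergence (fun y => C * b y)
    (fun n => (hdom n).integral_prod_left.1) (hbi.const_mul C) ?_ ?_
  · intro n
    filter_upwards [hb'] with y hy
    calc ‖∫ r, stepKernel (n + 1) r * k (y, r)‖
        ≤ ∫ r, |stepKernel (n + 1) r| * b y := by
          refine norm_integral_le_of_norm_le
            ((integrable_stepKernel (hpos n)).norm.mul_const _) ?_
          filter_upwards [hy] with r hr
          rw [norm_mul]
          exact mul_le_mul_of_nonneg_left hr (norm_nonneg _)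
      _ = C * b y := by rw [integral_mul_const, integral_abs_stepKernel (hpos n)]
  · have hN' : ∀ᵐ y ∂ν, volume (Prod.mk y ⁻¹' N) = 0 := Measure.ae_ae_of_ae_prod
      (p := fun p => p ∉ N) (measure_eq_zero_iff_ae_notMem.1 hN) |>.mono fun y hy =>
        measure_eq_zero_iff_ae_notMem.2 hy
    filter_upwards [hb', hN', hl, hk.prodMk_left] with y h1 h2 h3 h4
    exact tendsto_integral_stepKernel_mul h4 h1 h2 h3

/-! ### The divergence theorem on one side of a graph -/

section Graph

set_option linter.unusedSectionVars false

variable {E Y : Type*} [NormedAddCommGroup E] [NormedSpace ℝ E] [FiniteDimensional ℝ E]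
  [MeasurableSpace E] [BorelSpace E] [NormedAddCommGroup Y] [NormedSpace ℝ Y]
  [FiniteDimensional ℝ Y] [MeasurableSpace Y] [BorelSpace Y]

/-- The conormal `dr - dγ` of the graph `r = γ y` in the coordinates given by `Θ`. -/
def graphConormal (Θ : (Y × ℝ) ≃L[ℝ] E) (γ : Y → ℝ) (y : Y) : E →L[ℝ] ℝ :=
  (ContinuousLinearMap.snd ℝ Y ℝ - (fderiv ℝ γ y).comp (ContinuousLinearMap.fst ℝ Y ℝ)).comp
    (Θ.symm : E →L[ℝ] Y × ℝ)

lemma graphConormal_apply (Θ : (Y × ℝ) ≃L[ℝ] E) (γ : Y → ℝ) (y : Y) (v : E) :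
    graphConormal Θ γ y v = (Θ.symm v).2 - fderiv ℝ γ y (Θ.symm v).1 := rfl

/-- The weak divergence in `A` is tested with `φ` times a smooth step of the height above the graph.
The derivative of the step is a one-sided kernel in the height times the conormal component of `V`,
and it concentrates on the graph. Hence the trace `l` needs only to exist as a limit along the
fibres, off a null set. -/
theorem integral_above_graph {μ : Measure E} {ν : Measure Y} [SFinite ν]
    [IsFiniteMeasureOnCompacts ν] (Θ : (Y × ℝ) ≃L[ℝ] E)
    (hΘ : MeasurePreserving Θ (ν.prod volume) μ) {W : Set Y} (hW : IsOpen W) {γ : Y → ℝ}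
    (hγ : ContDiffOn ℝ 1 γ W) {A₀ A : Set E} (hA₀ : IsOpen A₀) (hA₀W : ∀ q ∈ A₀, (Θ.symm q).1 ∈ W)
    (hA : A = {q ∈ A₀ | γ (Θ.symm q).1 < (Θ.symm q).2}) {V : E → E} {h : E → ℝ}
    (hdiv : IsWeakDiv μ V h A) {M : ℝ} (hVM : ∀ᵐ q ∂μ, q ∈ A → ‖V q‖ ≤ M)
    (hV : IntegrableOn V A μ) (hh : IntegrableOn h A μ) {N : Set E} (hN : μ N = 0) {l : Y → ℝ}
    (hl : ∀ᵐ y ∂ν, y ∈ W → Θ (y, γ y) ∈ A₀ →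
      Tendsto (fun r => graphConormal Θ γ y (V (Θ (y, γ y + r))))
        (𝓝[{r | 0 < r ∧ Θ (y, γ y + r) ∉ N}] 0) (𝓝 (l y)))
    {φ : E → ℝ} (hφ : IsTest A₀ φ) :
    ∫ q in A, (fderiv ℝ φ q (V q) + h q * φ q) ∂μ =
      -∫ y in W, φ (Θ (y, γ y)) * l y ∂ν := by
  classical
  have hpos : ∀ n : ℕ, (0 : ℝ) < n + 1 := fun n => by positivity
  set ht : E → ℝ := fun q => (Θ.symm q).2 - γ (Θ.symm q).1 with ht_def
  have hγ1 : ∀ y ∈ W, ContDiffAt ℝ 1 γ y := fun y hy => hγ.contDiffAt (hW.mem_nhds hy)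
  have hfst : ContDiff ℝ 1 fun q : E => (Θ.symm q).1 := contDiff_fst.comp Θ.symm.contDiff
  have hsnd : ContDiff ℝ 1 fun q : E => (Θ.symm q).2 := contDiff_snd.comp Θ.symm.contDiff
  have htC : ∀ q ∈ A₀, ContDiffAt ℝ 1 ht q := fun q hq =>
    hsnd.contDiffAt.sub ((hγ1 _ (hA₀W q hq)).comp q hfst.contDiffAt)
  have htd : ∀ q ∈ A₀, HasFDerivAt ht (graphConormal Θ γ (Θ.symm q).1) q := by
    intro q hq
    have h1 := ((hγ1 _ (hA₀W q hq)).differentiableAt one_ne_zero).hasFDerivAt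
    have h2 : HasFDerivAt (fun q : E => Θ.symm q) (Θ.symm : E →L[ℝ] Y × ℝ) q :=
      Θ.symm.hasFDerivAt
    exact h2.snd.sub (h1.comp q h2.fst)
  have hAsub : A ⊆ A₀ := by rw [hA]; exact fun q hq => hq.1
  have hmemA : ∀ q, q ∈ A ↔ q ∈ A₀ ∧ 0 < ht q := by
    intro q; rw [hA]; simp only [mem_ofPred_eq, ht_def, sub_pos]
  have hAo : IsOpen A := by
    rw [isOpen_iff_mem_nhds]
    intro q hq
    have hq' := (hmemA q).1 hq
    filter_upwards [hA₀.mem_nhds hq'.1, (htC q hq'.1).continuousAt.eventually (lt_mem_nhds hq'.2)]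
      with x h1 h2 using (hmemA x).2 ⟨h1, h2⟩
  have hψ : ∀ n : ℕ, IsTest A (fun q => smoothStep ((n + 1) * ht q) * φ q) := by
    intro n
    refine ⟨?_, hφ.compact.mul_left, ?_⟩
    · rw [contDiff_iff_contDiffAt]
      intro q
      by_cases hq : q ∈ A₀
      · exact (contDiff_smoothStep.contDiffAt.comp q (contDiffAt_const.mul (htC q hq))).mul
          hφ.contDiff.contDiffAt
      · have : (fun q => smoothStep ((n + 1) * ht q) * φ q) =ᶠ[𝓝 q] fun _ => 0 := by
          filter_upwards [(notMem_tsupport_iff_eventuallyEq).1 fun h' => hq (hφ.subset h')] with x hx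
          simp [hx]
        exact contDiffAt_const.congr_of_eventuallyEq this
    · intro q hq
      have hq0 : q ∈ A₀ := hφ.subset (tsupport_mul_subset_right hq)
      refine (hmemA q).2 ⟨hq0, ?_⟩
      by_contra hle
      refine (notMem_tsupport_iff_eventuallyEq).2 ?_ hq
      -- The step vanishes up to height `1 / (n + 1)`, hence in a whole neighbourhood of every point
      -- on or below the graph.
      have h1 : ((n : ℝ) + 1) * ht q < 1 := by have := hpos n; nlinarith [not_lt.1 hle]
      filter_upwards [(ContinuousAt.mul (continuousAt_const (y := (n : ℝ) + 1))
        (htC q hq0).continuousAt).eventually (gt_mem_nhds h1)] with x hx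
      have hx' : ((n : ℝ) + 1) * ht x < 1 := hx
      rw [smoothStep_of_le hx'.le, zero_mul, Pi.zero_apply]
  -- The boundary-layer integrand, extended by zero outside `A`.
  set kE : E → ℝ := A.indicator fun q => φ q * graphConormal Θ γ (Θ.symm q).1 (V q) with kE_def
  have hψd : ∀ n : ℕ, ∀ q, fderiv ℝ (fun q => smoothStep ((n + 1) * ht q) * φ q) q (V q)
      + h q * (smoothStep ((n + 1) * ht q) * φ q) =
      A.indicator (fun q => smoothStep ((n + 1) * ht q) * (fderiv ℝ φ q (V q) + h q * φ q)) q
        + stepKernel (n + 1) (ht q) * kE q := by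
    intro n q
    by_cases hq : q ∈ A
    · rw [kE_def, indicator_of_mem hq, indicator_of_mem hq]
      have h1 : HasFDerivAt (fun q => smoothStep ((n + 1) * ht q))
          (stepKernel (n + 1) (ht q) • graphConormal Θ γ (Θ.symm q).1) q := by
        have h2 := (htd q (hAsub hq)).const_mul ((n : ℝ) + 1)
        have h3 := (contDiff_smoothStep.differentiable one_ne_zero
          ((n + 1) * ht q)).hasDerivAt.comp_hasFDerivAt q h2
        rwa [smul_smul, mul_comm (deriv smoothStep _)] at h3
      have h4 : fderiv ℝ (fun q => smoothStep ((n + 1) * ht q) * φ q) q = _ :=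
        (h1.mul (hφ.differentiable q).hasFDerivAt).fderiv
      rw [h4]
      simp only [add_apply, smul_apply, smul_eq_mul]
      ring
    · rw [kE_def, indicator_of_notMem hq, indicator_of_notMem hq, (hψ n).fderiv_eq_zero hq,
        (hψ n).eq_zero hq]
      simp
  have hLc : ContinuousOn (fun q => graphConormal Θ γ (Θ.symm q).1) A₀ := by
    have h1 : ContinuousOn (fun q : E => fderiv ℝ γ (Θ.symm q).1) A₀ :=
      (hγ.continuousOn_fderiv_of_isOpen hW le_rfl).comp hfst.continuous.continuousOn hA₀W
    have h2 : Continuous fun B : Y →L[ℝ] ℝ => (ContinuousLinearMap.snd ℝ Y ℝ -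
        B.comp (ContinuousLinearMap.fst ℝ Y ℝ)).comp (Θ.symm : E →L[ℝ] Y × ℝ) := by fun_prop
    exact h2.comp_continuousOn h1
  have hkm : AEStronglyMeasurable kE μ := by
    rw [kE_def, aestronglyMeasurable_indicator_iff hAo.measurableSet]
    exact hφ.contDiff.continuous.aestronglyMeasurable.mul
      ((ContinuousLinearMap.id ℝ (E →L[ℝ] ℝ)).aestronglyMeasurable_comp₂
        ((hLc.mono hAsub).aestronglyMeasurable hAo.measurableSet) hV.1)
  obtain ⟨C, hC0, hC⟩ := hφ.exists_bound
  obtain ⟨D, hD⟩ := hφ.compact.exists_bound_of_continuousOn (hLc.mono hφ.subset)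
  -- Extending `γ` by zero off `W` gives a measurable function on all of `Y`, so the shear `S` below
  -- preserves measure globally.
  set γ' : Y → ℝ := W.piecewise γ 0 with hγ'_def
  have hγ'W : ∀ y ∈ W, γ' y = γ y := fun y hy => piecewise_eq_of_mem _ _ _ hy
  have hγ'm : Measurable γ' :=
    hγ.continuousOn.measurable_piecewise continuousOn_const hW.measurableSet
  set S : Y × ℝ → E := fun p => Θ (p.1, γ' p.1 + p.2) with hS_def
  have hS : MeasurePreserving S (ν.prod volume) μ := by
    refine hΘ.comp ((MeasurePreserving.id ν).skew_product (g := fun y r => γ' y + r) ?_ ?_)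
    · exact (hγ'm.comp measurable_fst).add measurable_snd
    · exact Eventually.of_forall fun y => map_add_left_eq_self volume (γ' y)
  have hht : ∀ p, p.1 ∈ W → ht (S p) = p.2 := by
    intro p hp
    simp [hS_def, ht_def, hγ'W _ hp]
  have hSW : ∀ p, S p ∈ A₀ → p.1 ∈ W := by
    intro p hp
    simpa [hS_def] using hA₀W _ hp
  set P : Set Y := (fun q => (Θ.symm q).1) '' tsupport φ with hP_def
  have hP : IsCompact P := hφ.compact.image hfst.continuous
  have hlim : Tendsto (fun n : ℕ => ∫ p, stepKernel (n + 1) p.2 * kE (S p) ∂ν.prod volume) atTop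
      (𝓝 (∫ y, W.indicator (fun y => φ (Θ (y, γ y)) * l y) y ∂ν)) := by
    -- The dominating function is constant on the projection `P` of the support of `φ`, which is
    -- compact and so of finite measure.
    refine tendsto_integral_stepKernel_prod (b := P.indicator fun _ => C * (|D| * |M|))
      (N := S ⁻¹' N) (hkm.comp_measurePreserving hS) ?_ ?_ ?_ ?_
    · exact (integrable_indicator_iff hP.measurableSet).2
        (integrableOn_const hP.measure_lt_top.ne)
    · filter_upwards [hS.quasiMeasurePreserving.ae hVM] with p hp
      by_cases hpφ : S p ∈ tsupport φ
      · have hpP : p.1 ∈ P := ⟨S p, hpφ, by simp [hS_def]⟩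
        rw [indicator_of_mem hpP, kE_def]
        by_cases hpA : S p ∈ A
        · rw [indicator_of_mem hpA, norm_mul]
          have h1 := (graphConormal Θ γ (Θ.symm (S p)).1).le_opNorm (V (S p))
          have h2 := hD _ hpφ
          have h3 := hp hpA
          have h4 := norm_nonneg (V (S p))
          have h5 := norm_nonneg (graphConormal Θ γ (Θ.symm (S p)).1)
          refine mul_le_mul (hC _).1 (h1.trans ?_) (norm_nonneg _) hC0
          exact mul_le_mul (h2.trans (le_abs_self _)) (h3.trans (le_abs_self _)) h4 (abs_nonneg _)
        · rw [indicator_of_notMem hpA, norm_zero]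
          positivity
      · have : kE (S p) = 0 := by
          rw [kE_def]
          by_cases hpA : S p ∈ A
          · rw [indicator_of_mem hpA, image_eq_zero_of_notMem_tsupport hpφ, zero_mul]
          · rw [indicator_of_notMem hpA]
        rw [this, norm_zero]
        exact indicator_nonneg (fun _ _ => by positivity) _
    · exact hS.quasiMeasurePreserving.preimage_null hN
    · filter_upwards [hl] with y hy
      by_cases hyW : y ∈ W
      · rw [indicator_of_mem hyW]
        have hSy : ∀ r, S (y, r) = Θ (y, γ y + r) := fun r => by simp [hS_def, hγ'W y hyW]
        have hcont : Tendsto (fun r : ℝ => S (y, r)) (𝓝 0) (𝓝 (Θ (y, γ y))) := by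
          have : Continuous fun r : ℝ => Θ (y, γ y + r) := by fun_prop
          simp_rw [hSy]
          simpa using this.tendsto 0
        have hset : {r : ℝ | 0 < r ∧ (y, r) ∉ S ⁻¹' N} = {r | 0 < r ∧ Θ (y, γ y + r) ∉ N} := by
          ext r
          simp [hSy]
        rw [hset]
        by_cases hyA : Θ (y, γ y) ∈ A₀
        · have h1 := ((hφ.contDiff.continuous.tendsto _).comp (hcont.mono_left
            (nhdsWithin_le_nhds (s := {r | 0 < r ∧ Θ (y, γ y + r) ∉ N})))).mul (hy hyW hyA)
          refine h1.congr' ?_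
          filter_upwards [nhdsWithin_le_nhds (hcont.eventually (hA₀.mem_nhds hyA)),
            self_mem_nhdsWithin] with r hr1 hr2
          have hrA : S (y, r) ∈ A := (hmemA _).2 ⟨hr1, by rw [hht _ hyW]; exact hr2.1⟩
          rw [kE_def, indicator_of_mem hrA]
          simp [hSy]
        · have hyφ : Θ (y, γ y) ∉ tsupport φ := fun h' => hyA (hφ.subset h')
          rw [image_eq_zero_of_notMem_tsupport hyφ, zero_mul]
          refine tendsto_const_nhds.congr' ?_
          filter_upwards [nhdsWithin_le_nhds (hcont.eventually
            ((isClosed_tsupport φ).isOpen_compl.mem_nhds hyφ))] with r hr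
          rw [kE_def]
          by_cases hpA : S (y, r) ∈ A
          · rw [indicator_of_mem hpA, image_eq_zero_of_notMem_tsupport hr, zero_mul]
          · rw [indicator_of_notMem hpA]
      · rw [indicator_of_notMem hyW]
        refine tendsto_const_nhds.congr fun r => ?_
        rw [kE_def, indicator_of_notMem fun h' => hyW (hSW (y, r) (hAsub h'))]
  have hL1 : ∀ n : ℕ, Integrable (A.indicator fun q =>
      smoothStep ((n + 1) * ht q) * (fderiv ℝ φ q (V q) + h q * φ q)) μ := by
    intro n
    rw [integrable_indicator_iff hAo.measurableSet]
    refine ((hφ.integrableOn_flux hV).add (hφ.integrableOn_mul hh)).bdd_mul (c := 1) ?_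
      (Eventually.of_forall fun q => abs_smoothStep_le _)
    refine ContinuousOn.aestronglyMeasurable (fun q hq => ?_) hAo.measurableSet
    exact (contDiff_smoothStep.continuous.continuousAt.comp
      (ContinuousAt.mul continuousAt_const (htC q (hAsub hq)).continuousAt)).continuousWithinAt
  have hL2 : ∀ n : ℕ, Integrable (fun q => stepKernel (n + 1) (ht q) * kE q) μ := by
    intro n
    have h1 := ((hψ n).integrable hV.locallyIntegrableOn hh.locallyIntegrableOn).sub (hL1 n)
    refine h1.congr (Eventually.of_forall fun q => ?_)
    simp only [Pi.sub_apply, hψd n q, add_sub_cancel_left]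
  have hk2 : ∀ n : ℕ, ∫ q, stepKernel (n + 1) (ht q) * kE q ∂μ =
      ∫ p, stepKernel (n + 1) p.2 * kE (S p) ∂ν.prod volume := by
    intro n
    rw [← hS.map_eq, integral_map hS.measurable.aemeasurable (by rw [hS.map_eq]; exact (hL2 n).1)]
    refine integral_congr_ae (Eventually.of_forall fun p => ?_)
    by_cases hp : S p ∈ A
    · simp only [hht p (hSW p (hAsub hp))]
    · simp only [kE_def, indicator_of_notMem hp, mul_zero]
  have hlim1 : Tendsto (fun n : ℕ => ∫ q, (A.indicator fun q =>
      smoothStep ((n + 1) * ht q) * (fderiv ℝ φ q (V q) + h q * φ q)) q ∂μ) atTop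
      (𝓝 (∫ q, (A.indicator fun q => fderiv ℝ φ q (V q) + h q * φ q) q ∂μ)) := by
    have hI : Integrable (A.indicator fun q => fderiv ℝ φ q (V q) + h q * φ q) μ :=
      (integrable_indicator_iff hAo.measurableSet).2
        ((hφ.integrableOn_flux hV).add (hφ.integrableOn_mul hh))
    refine tendsto_integral_of_dominated_convergence _ (fun n => (hL1 n).1) hI.norm ?_ ?_
    · refine fun n => Eventually.of_forall fun q => ?_
      by_cases hq : q ∈ A
      · rw [indicator_of_mem hq, indicator_of_mem hq, norm_mul]
        exact mul_le_of_le_one_left (norm_nonneg _) (abs_smoothStep_le _)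
      · rw [indicator_of_notMem hq, indicator_of_notMem hq]
    · refine Eventually.of_forall fun q => ?_
      by_cases hq : q ∈ A
      · simp only [indicator_of_mem hq]
        refine tendsto_const_nhds.congr' ?_
        have hq0 := ((hmemA q).1 hq).2
        obtain ⟨n₀, hn₀⟩ := exists_nat_gt (2 / ht q)
        filter_upwards [eventually_ge_atTop n₀] with n hn
        rw [div_lt_iff₀ hq0] at hn₀
        have : (n₀ : ℝ) ≤ n := by exact_mod_cast hn
        rw [smoothStep_of_ge (by nlinarith), one_mul]
      · simp only [indicator_of_notMem hq]
        exact tendsto_const_nhds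
  have hzero : ∀ n : ℕ, (∫ q, (A.indicator fun q =>
      smoothStep ((n + 1) * ht q) * (fderiv ℝ φ q (V q) + h q * φ q)) q ∂μ) +
      ∫ p, stepKernel (n + 1) p.2 * kE (S p) ∂ν.prod volume = 0 := by
    intro n
    rw [← hk2 n, ← integral_add (hL1 n) (hL2 n), ← hdiv _ (hψ n)]
    exact integral_congr_ae (Eventually.of_forall fun q => (hψd n q).symm)
  have hsum := hlim1.add hlim
  simp_rw [hzero] at hsum
  have := tendsto_nhds_unique hsum tendsto_const_nhds
  rw [integral_indicator hAo.measurableSet, integral_indicator hW.measurableSet] at this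
  linarith

end Graph

/-! ### Removable singularities of the weak divergence -/

section Removable

set_option linter.unusedSectionVars false

open scoped ENNReal in
-- A countable cover by sets with small sum of powers of diameters is enlarged to open balls, and
-- compactness makes it finite.
lemma exists_ball_cover_of_hausdorffMeasure_zero {X : Type*} [MetricSpace X] [Nonempty X]
    [MeasurableSpace X] [BorelSpace X] {K : Set X} (hKc : IsCompact K) {d : ℕ} (hd : 0 < d)
    (hK : Measure.hausdorffMeasure (d : ℝ) K = 0) {ε : ℝ} (hε : 0 < ε) :
    ∃ (s : Finset ℕ) (x : ℕ → X) (r : ℕ → ℝ), (∀ i, 0 < r i) ∧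
      K ⊆ ⋃ i ∈ s, Metric.ball (x i) (r i) ∧ ∑ i ∈ s, r i ^ d < ε := by
  have hε2 : (0 : ℝ≥0∞) < ENNReal.ofReal (ε / 2) := ENNReal.ofReal_pos.2 (by positivity)
  rw [Measure.hausdorffMeasure_apply] at hK
  -- Covers at scale one suffice: the bound on the diameters serves only to make them finite.
  have h1 := (iSup_eq_bot.1 ((iSup_eq_bot.1 hK) 1)) one_pos
  have h2 : (⨅ (t : ℕ → Set X) (_ : K ⊆ ⋃ n, t n) (_ : ∀ n, Metric.ediam (t n) ≤ 1),
      ∑' n, ⨆ _ : (t n).Nonempty, Metric.ediam (t n) ^ (d : ℝ)) < ENNReal.ofReal (ε / 2) := by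
    rw [show (⨅ (t : ℕ → Set X) (_ : K ⊆ ⋃ n, t n) (_ : ∀ n, Metric.ediam (t n) ≤ 1),
      ∑' n, ⨆ _ : (t n).Nonempty, Metric.ediam (t n) ^ (d : ℝ)) = 0 from h1]
    exact hε2
  simp only [iInf_lt_iff] at h2
  obtain ⟨t, htK, htd, hts⟩ := h2
  have hfin : ∀ n, Metric.ediam (t n) ≠ ⊤ := fun n => ((htd n).trans_lt ENNReal.one_lt_top).ne
  set δ : ℕ → ℝ := fun n => Metric.diam (t n)
  have hδ0 : ∀ n, 0 ≤ δ n := fun n => Metric.diam_nonneg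
  have hle : ∀ n, ENNReal.ofReal (δ n ^ d) ≤ ⨆ _ : (t n).Nonempty, Metric.ediam (t n) ^ (d : ℝ) := by
    intro n
    rcases (t n).eq_empty_or_nonempty with h | h
    · simp [δ, h, hd.ne']
    · rw [iSup_pos h, ENNReal.ofReal_pow (hδ0 n), ENNReal.rpow_natCast]
      gcongr
      exact (ENNReal.ofReal_toReal (hfin n)).le
  -- The radius exceeds the diameter, which may be zero; the geometric excesses add up to `ε / 2`.
  have hr : ∀ n, ∃ r, δ n < r ∧ r ^ d < δ n ^ d + ε / 2 / 2 / 2 ^ n := by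
    intro n
    have hc : ContinuousAt (fun r : ℝ => r ^ d) (δ n) := (continuous_pow d).continuousAt
    have h3 : ∀ᶠ r in 𝓝 (δ n), r ^ d < δ n ^ d + ε / 2 / 2 / 2 ^ n :=
      hc.eventually (gt_mem_nhds (lt_add_of_pos_right _ (by positivity)))
    obtain ⟨r, hr1, hr2⟩ := ((h3.filter_mono nhdsWithin_le_nhds).and
      (self_mem_nhdsWithin (s := Ioi (δ n)))).exists
    exact ⟨r, hr2, hr1⟩
  choose r hr1 hr2 using hr
  have hx : ∀ n, ∃ x, t n ⊆ Metric.ball x (r n) := by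
    intro n
    rcases (t n).eq_empty_or_nonempty with h | ⟨x, h⟩
    · exact ⟨Classical.arbitrary X, by simp [h]⟩
    · refine ⟨x, fun y hy => ?_⟩
      rw [Metric.mem_ball]
      exact (Metric.dist_le_diam_of_mem (Metric.isBounded_iff_ediam_ne_top.2 (hfin n)) hy h).trans_lt
        (hr1 n)
  choose x hx using hx
  obtain ⟨s, hs⟩ := hKc.elim_finite_subcover (fun n => Metric.ball (x n) (r n))
    (fun n => Metric.isOpen_ball) (htK.trans (iUnion_mono hx))
  refine ⟨s, x, r, fun i => (hδ0 i).trans_lt (hr1 i), hs, ?_⟩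
  have hsumδ : ∑ i ∈ s, δ i ^ d < ε / 2 := by
    have h4 : ENNReal.ofReal (∑ i ∈ s, δ i ^ d) < ENNReal.ofReal (ε / 2) := by
      rw [ENNReal.ofReal_sum_of_nonneg fun i _ => pow_nonneg (hδ0 i) d]
      exact ((Finset.sum_le_sum fun i _ => hle i).trans (ENNReal.sum_le_tsum s)).trans_lt hts
    exact (ENNReal.ofReal_lt_ofReal_iff (by positivity)).1 h4
  have hgeom : ∑ i ∈ s, ε / 2 / 2 / 2 ^ i ≤ ε / 2 := by
    have := (summable_geometric_two' (ε / 2)).sum_le_tsum s fun i _ => by positivity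
    rwa [tsum_geometric_two'] at this
  calc ∑ i ∈ s, r i ^ d ≤ ∑ i ∈ s, (δ i ^ d + ε / 2 / 2 / 2 ^ i) :=
        Finset.sum_le_sum fun i _ => (hr2 i).le
    _ < ε := by rw [Finset.sum_add_distrib]; linarith

variable {E : Type*} [NormedAddCommGroup E] [NormedSpace ℝ E] [FiniteDimensional ℝ E]
  [MeasurableSpace E] [BorelSpace E] {μ : Measure E} [μ.IsAddHaarMeasure]

/-- A cut-off function around a compact set of codimension-one measure zero, with small gradient
in `L^1`. -/
lemma exists_cutoff_of_hausdorffMeasure_zero {d : ℕ} (hd : 0 < d)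
    (hdim : Module.finrank ℝ E = d + 1) :
    ∃ C : ℝ, 0 ≤ C ∧ ∀ K : Set E, IsCompact K → Measure.hausdorffMeasure (d : ℝ) K = 0 →
      ∀ ε : ℝ, 0 < ε → ε < 1 → ∃ (ψ : E → ℝ) (U : Set E), ContDiff ℝ 1 ψ ∧ MeasurableSet U ∧
        (∀ q, ‖ψ q‖ ≤ 1) ∧ (∀ q, ‖1 - ψ q‖ ≤ 1) ∧ (∀ q ∉ U, ψ q = 1) ∧
        μ U ≤ ENNReal.ofReal (C * ε) ∧
        Integrable (fun q => ‖fderiv ℝ ψ q‖) μ ∧ ∫ q, ‖fderiv ℝ ψ q‖ ∂μ ≤ C * ε ∧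
        ∃ O, IsOpen O ∧ K ⊆ O ∧ ∀ q ∈ O, ψ q = 0 := by
  let β : ContDiffBump (0 : E) := ⟨1, 2, one_pos, one_lt_two⟩
  have hβC : ContDiff ℝ 1 β := β.contDiff
  obtain ⟨B, hB⟩ := (β.hasCompactSupport.fderiv ℝ).exists_bound_of_continuous
    (hβC.continuous_fderiv one_ne_zero)
  have hB0 : 0 ≤ B := (norm_nonneg _).trans (hB 0)
  set m : ℝ := μ.real (Metric.closedBall (0 : E) 1)
  have hm0 : 0 ≤ m := measureReal_nonneg
  have hball : ∀ x : E, ∀ r : ℝ, 0 ≤ r → μ (Metric.closedBall x r) = ENNReal.ofReal (r ^ (d + 1) * m) := by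
    intro x r hr
    rw [Measure.addHaar_closedBall' μ x hr, hdim, ENNReal.ofReal_mul (by positivity),
      show ENNReal.ofReal m = _ from ENNReal.ofReal_toReal measure_closedBall_lt_top.ne]
  -- A bump at scale `r i` has gradient at most `B / r i` on a ball of volume `(2 * r i) ^ (d + 1) *
  -- m`, which leaves `r i ^ d`. With `B + 1` in place of `B` the same constant also bounds the
  -- measure of `U`.
  refine ⟨(B + 1) * 2 ^ (d + 1) * m, by positivity, fun K hKc hK ε hε hε1 => ?_⟩
  obtain ⟨s, x, r, hr, hcov, hsum⟩ := exists_ball_cover_of_hausdorffMeasure_zero hKc hd hK hε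
  set η : ℕ → E → ℝ := fun i q => β ((r i)⁻¹ • (q - x i)) with hη
  have hηC : ∀ i, ContDiff ℝ 1 (η i) := fun i =>
    hβC.comp ((contDiff_id.sub contDiff_const).const_smul _)
  have hη01 : ∀ i q, 0 ≤ η i q ∧ η i q ≤ 1 := fun i q => ⟨β.nonneg, β.le_one⟩
  have hηout : ∀ i q, q ∉ Metric.closedBall (x i) (2 * r i) → η i q = 0 := by
    intro i q hq
    refine β.zero_of_le_dist ?_
    rw [Metric.mem_closedBall, not_le, dist_eq_norm] at hq
    rw [dist_zero_right, norm_smul, norm_inv, Real.norm_of_nonneg (hr i).le, inv_mul_eq_div,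
      le_div_iff₀ (hr i)]
    exact hq.le
  have hηin : ∀ i, ∀ q ∈ Metric.ball (x i) (r i), η i q = 1 := by
    intro i q hq
    refine β.one_of_mem_closedBall ?_
    rw [Metric.mem_ball, dist_eq_norm] at hq
    rw [Metric.mem_closedBall, dist_zero_right, norm_smul, norm_inv, Real.norm_of_nonneg (hr i).le,
      inv_mul_eq_div, div_le_iff₀ (hr i), one_mul]
    exact hq.le
  have hηd : ∀ i q, ‖fderiv ℝ (η i) q‖ ≤
      (Metric.closedBall (x i) (2 * r i)).indicator (fun _ => B * (r i)⁻¹) q := by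
    intro i q
    by_cases hq : q ∈ Metric.closedBall (x i) (2 * r i)
    · rw [indicator_of_mem hq]
      have h1 : HasFDerivAt (fun q => (r i)⁻¹ • (q - x i))
          ((r i)⁻¹ • ContinuousLinearMap.id ℝ E) q :=
        ((hasFDerivAt_id q).sub_const (x i)).const_smul (r i)⁻¹
      have h2 := ((hβC.differentiable one_ne_zero _).hasFDerivAt.comp q h1).fderiv
      have h3 : fderiv ℝ (η i) q = _ := h2
      rw [h3]
      refine (ContinuousLinearMap.opNorm_comp_le _ _).trans ?_
      refine mul_le_mul (hB _) ?_ (norm_nonneg _) hB0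
      rw [norm_smul, norm_inv, Real.norm_of_nonneg (hr i).le]
      exact mul_le_of_le_one_right (inv_nonneg.2 (hr i).le) ContinuousLinearMap.norm_id_le
    · rw [indicator_of_notMem hq]
      have : η i =ᶠ[𝓝 q] fun _ => 0 := by
        filter_upwards [Metric.isClosed_closedBall.isOpen_compl.mem_nhds hq] with z hz
          using hηout i z hz
      rw [this.fderiv_eq]
      simp
  set U : Set E := ⋃ i ∈ s, Metric.closedBall (x i) (2 * r i) with hU
  -- A product of factors between 0 and 1: it vanishes as soon as one factor does, and its gradient
  -- is at most the sum of the gradients.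
  set ψ : E → ℝ := fun q => ∏ i ∈ s, (1 - η i q) with hψ
  have hψ01 : ∀ q, 0 ≤ ψ q ∧ ψ q ≤ 1 := fun q =>
    ⟨Finset.prod_nonneg fun i _ => by linarith [(hη01 i q).2],
      Finset.prod_le_one (fun i _ => by linarith [(hη01 i q).2])
        fun i _ => by linarith [(hη01 i q).1]⟩
  have hψd : ∀ q, ‖fderiv ℝ ψ q‖ ≤
      ∑ i ∈ s, (Metric.closedBall (x i) (2 * r i)).indicator (fun _ => B * (r i)⁻¹) q := by
    intro q
    have h1 : HasFDerivAt ψ _ q := HasFDerivAt.finsetProd (u := s) (x := q)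
      (g := fun i q => 1 - η i q)
      fun i _ => (((hηC i).differentiable one_ne_zero q).hasFDerivAt.const_sub 1)
    rw [h1.fderiv]
    refine (norm_sum_le _ _).trans (Finset.sum_le_sum fun i _ => ?_)
    rw [norm_smul, norm_neg]
    refine (mul_le_of_le_one_left (norm_nonneg _) ?_).trans (hηd i q)
    rw [Real.norm_of_nonneg (Finset.prod_nonneg fun i _ => by linarith [(hη01 i q).2])]
    exact Finset.prod_le_one (fun i _ => by linarith [(hη01 i q).2])
        fun i _ => by linarith [(hη01 i q).1]
  have hψC : ContDiff ℝ 1 ψ := contDiff_prod fun i _ => contDiff_const.sub (hηC i)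
  have hψout : ∀ q ∉ U, ψ q = 1 := by
    intro q hq
    refine Finset.prod_eq_one fun i hi => ?_
    rw [hηout i q fun h' => hq (mem_biUnion (t := fun i => Metric.closedBall (x i) (2 * r i)) hi h'),
      sub_zero]
  have hbi : ∀ i, Integrable ((Metric.closedBall (x i) (2 * r i)).indicator
      (fun _ => B * (r i)⁻¹)) μ := fun i =>
    (integrable_indicator_iff measurableSet_closedBall).2
      (integrableOn_const measure_closedBall_lt_top.ne)
  have hbint : Integrable (fun q => ∑ i ∈ s,
      (Metric.closedBall (x i) (2 * r i)).indicator (fun _ => B * (r i)⁻¹) q) μ :=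
    integrable_finsetSum s fun i _ => hbi i
  have hψint : Integrable (fun q => ‖fderiv ℝ ψ q‖) μ :=
    hbint.mono' (hψC.continuous_fderiv one_ne_zero).norm.aestronglyMeasurable
      (Eventually.of_forall fun q => by rw [norm_norm]; exact hψd q)
  -- From `ε < 1`; it allows `r i ^ (d + 1) ≤ r i ^ d` in the bound for the measure of `U`.
  have hr1 : ∀ i ∈ s, r i ≤ 1 := by
    intro i hi
    have h1 : r i ^ d ≤ ∑ i ∈ s, r i ^ d :=
      Finset.single_le_sum (f := fun i => r i ^ d) (fun i _ => pow_nonneg (hr i).le d) hi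
    by_contra hlt
    have h2 := one_lt_pow₀ (not_le.1 hlt) hd.ne'
    linarith
  refine ⟨ψ, U, hψC, ?_, ?_, ?_, hψout, ?_, hψint, ?_, ?_⟩
  · exact Finset.measurableSet_biUnion s fun i _ => measurableSet_closedBall
  · intro q
    rw [Real.norm_of_nonneg (hψ01 q).1]
    exact (hψ01 q).2
  · intro q
    rw [Real.norm_of_nonneg (by linarith [(hψ01 q).2])]
    linarith [(hψ01 q).1]
  · refine (measure_biUnion_finset_le s _).trans ?_
    simp_rw [fun i => hball (x i) (2 * r i) (by have := hr i; positivity)]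
    rw [← ENNReal.ofReal_sum_of_nonneg fun i _ => by have := hr i; positivity]
    refine ENNReal.ofReal_le_ofReal ?_
    calc ∑ i ∈ s, (2 * r i) ^ (d + 1) * m ≤ ∑ i ∈ s, r i ^ d * (2 ^ (d + 1) * m) := by
          refine Finset.sum_le_sum fun i hi => ?_
          rw [mul_pow, pow_succ (r i)]
          have h1 := pow_nonneg (hr i).le d
          have h2 := hr1 i hi
          have h3 : r i ^ d * r i ≤ r i ^ d := mul_le_of_le_one_right h1 h2
          have h4 : 0 ≤ 2 ^ (d + 1) * m := by positivity
          nlinarith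
      _ = (∑ i ∈ s, r i ^ d) * (2 ^ (d + 1) * m) := by rw [Finset.sum_mul]
      _ ≤ ε * ((B + 1) * (2 ^ (d + 1) * m)) := by
          have h4 : 0 ≤ 2 ^ (d + 1) * m := by positivity
          refine mul_le_mul hsum.le ?_ h4 hε.le
          nlinarith
      _ = (B + 1) * 2 ^ (d + 1) * m * ε := by ring
  · calc ∫ q, ‖fderiv ℝ ψ q‖ ∂μ ≤ ∫ q, ∑ i ∈ s,
          (Metric.closedBall (x i) (2 * r i)).indicator (fun _ => B * (r i)⁻¹) q ∂μ :=
          integral_mono hψint hbint hψd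
      _ = ∑ i ∈ s, r i ^ d * (B * 2 ^ (d + 1) * m) := by
          rw [integral_finsetSum s fun i _ => hbi i]
          refine Finset.sum_congr rfl fun i _ => ?_
          rw [integral_indicator measurableSet_closedBall, setIntegral_const, measureReal_def,
            hball _ _ (by have := hr i; positivity),
            ENNReal.toReal_ofReal (by have := hr i; positivity), smul_eq_mul]
          rw [mul_pow, pow_succ (r i)]
          have := (hr i).ne'
          field_simp
      _ = (∑ i ∈ s, r i ^ d) * (B * 2 ^ (d + 1) * m) := by rw [Finset.sum_mul]
      _ ≤ ε * ((B + 1) * 2 ^ (d + 1) * m) := by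
          have h5 : 0 ≤ B * 2 ^ (d + 1) * m := by positivity
          refine mul_le_mul hsum.le ?_ h5 hε.le
          gcongr
          linarith
      _ = (B + 1) * 2 ^ (d + 1) * m * ε := by ring
  · refine ⟨⋃ i ∈ s, Metric.ball (x i) (r i), isOpen_biUnion fun i _ => Metric.isOpen_ball, hcov, ?_⟩
    intro q hq
    obtain ⟨i, hi, hqi⟩ := mem_iUnion₂.1 hq
    exact Finset.prod_eq_zero hi (by rw [hηin i q hqi, sub_self])

/-- Multiplying the test function by a cut-off that vanishes near `K` costs a term `φ dψ(V)`,
bounded by the supremum of `V` times the L¹ norm of `dψ`. That norm can be made arbitrarily small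
when `K` is null in codimension one. -/
theorem IsWeakDiv.of_diff_null {d : ℕ} (hd : 0 < d) (hdim : Module.finrank ℝ E = d + 1)
    {V : E → E} {h : E → ℝ} {A K : Set E} {M : ℝ} (hK : IsClosed K)
    (hK0 : Measure.hausdorffMeasure (d : ℝ) K = 0) (hV : LocallyIntegrableOn V A μ)
    (hh : LocallyIntegrableOn h A μ) (hVM : ∀ᵐ q ∂μ, q ∈ A → ‖V q‖ ≤ M)
    (H : IsWeakDiv μ V h (A \ K)) : IsWeakDiv μ V h A := by
  intro φ hφ
  obtain ⟨C, hC0, hC⟩ := exists_cutoff_of_hausdorffMeasure_zero (μ := μ) hd hdim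
  have hKc : IsCompact (tsupport φ ∩ K) := hφ.compact.inter_right hK
  -- The shift by 2 keeps these numbers strictly below 1 also for `n = 0`.
  have hε : ∀ n : ℕ, (0 : ℝ) < 1 / ((n : ℝ) + 2) ∧ 1 / ((n : ℝ) + 2) < 1 := fun n =>
    ⟨by positivity, by rw [div_lt_one (by positivity)]; linarith [(n.cast_nonneg : (0 : ℝ) ≤ n)]⟩
  choose ψ U hψC hUm hψ1 hψ2 hψU hμU hψi hψI O hO hKO hψO using fun n : ℕ => hC _ hKc
    (measure_mono_null inter_subset_right hK0) _ (hε n).1 (hε n).2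
  set f : E → ℝ := fun q => fderiv ℝ φ q (V q) + h q * φ q with hf
  have hfi : Integrable f μ := hφ.integrable hV hh
  have htest : ∀ n, IsTest (A \ K) (fun q => ψ n q * φ q) := by
    intro n
    have h1 := hφ.mul_left (hψC n)
    refine ⟨h1.contDiff, h1.compact, fun q hq => ⟨h1.subset hq, fun hqK => ?_⟩⟩
    have hqφ : q ∈ tsupport φ := tsupport_mul_subset_right hq
    refine (notMem_tsupport_iff_eventuallyEq).2 ?_ hq
    filter_upwards [(hO n).mem_nhds (hKO n ⟨hqφ, hqK⟩)] with z hz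
    simp [hψO n z hz]
  obtain ⟨D, hD0, hD⟩ := hφ.exists_bound
  -- The first term lives on `U n`, whose measure tends to zero; the second is small with the
  -- gradient of the cut-off; the last has integral zero by `H`.
  have hsplit : ∀ n q, f q = (1 - ψ n q) * f q - φ q * fderiv ℝ (ψ n) q (V q) +
      (fderiv ℝ (fun q => ψ n q * φ q) q (V q) + h q * (ψ n q * φ q)) := by
    intro n q
    have h4 : fderiv ℝ (fun q => ψ n q * φ q) q = _ :=
      (((hψC n).differentiable one_ne_zero q).hasFDerivAt.mul
        (hφ.differentiable q).hasFDerivAt).fderiv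
    rw [h4, hf]
    simp only [add_apply, smul_apply, smul_eq_mul]
    ring
  have hi1 : ∀ n, Integrable (fun q => (1 - ψ n q) * f q) μ := fun n =>
    hfi.bdd_mul (continuous_const.sub (hψC n).continuous).aestronglyMeasurable
      (Eventually.of_forall (hψ2 n))
  have hi3 : ∀ n, Integrable (fun q => fderiv ℝ (fun q => ψ n q * φ q) q (V q) +
      h q * (ψ n q * φ q)) μ := fun n =>
    ((htest n).mono sdiff_subset).integrable hV hh
  have hi2 : ∀ n, Integrable (fun q => φ q * fderiv ℝ (ψ n) q (V q)) μ := by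
    intro n
    refine (((hi1 n).add (hi3 n)).sub hfi).congr (Eventually.of_forall fun q => ?_)
    have := hsplit n q
    simp only [Pi.add_apply, Pi.sub_apply]
    linarith
  have heq : ∀ n, ∫ q, f q ∂μ =
      ∫ q, (1 - ψ n q) * f q ∂μ - ∫ q, φ q * fderiv ℝ (ψ n) q (V q) ∂μ := by
    intro n
    rw [integral_congr_ae (Eventually.of_forall (hsplit n)),
      integral_add (f := fun q => (1 - ψ n q) * f q - φ q * fderiv ℝ (ψ n) q (V q))
        ((hi1 n).sub (hi2 n)) (hi3 n), H _ (htest n), add_zero,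
      integral_sub (hi1 n) (hi2 n)]
  have hεlim : Tendsto (fun n : ℕ => C * (1 / ((n : ℝ) + 2))) atTop (𝓝 0) := by
    have h1 : Tendsto (fun n : ℕ => (n : ℝ) + 2) atTop atTop :=
      tendsto_atTop_add_const_right _ _ tendsto_natCast_atTop_atTop
    simpa using (h1.inv_tendsto_atTop).const_mul C
  have hl1 : Tendsto (fun n => ∫ q, (1 - ψ n q) * f q ∂μ) atTop (𝓝 0) := by
    have hμ : Tendsto (fun n => μ (U n)) atTop (𝓝 0) := by
      refine tendsto_of_tendsto_of_tendsto_of_le_of_le tendsto_const_nhds ?_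
        (fun _ => zero_le) hμU
      simpa [Function.comp_def] using (ENNReal.continuous_ofReal.tendsto 0).comp hεlim
    have h2 := MeasureTheory.Integrable.tendsto_setIntegral_nhds_zero hfi.norm hμ
    refine squeeze_zero_norm (fun n => ?_) h2
    rw [← integral_indicator (hUm n)]
    refine norm_integral_le_of_norm_le
      ((integrable_indicator_iff (hUm n)).2 hfi.norm.integrableOn)
      (Eventually.of_forall fun q => ?_)
    by_cases hq : q ∈ U n
    · rw [indicator_of_mem hq, norm_mul]
      exact mul_le_of_le_one_left (norm_nonneg _) (hψ2 n q)
    · rw [indicator_of_notMem hq, hψU n q hq]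
      simp
  have hl2 : Tendsto (fun n => ∫ q, φ q * fderiv ℝ (ψ n) q (V q) ∂μ) atTop (𝓝 0) := by
    have h2 : Tendsto (fun n : ℕ => D * |M| * (C * (1 / ((n : ℝ) + 2)))) atTop (𝓝 0) := by
      simpa using hεlim.const_mul (D * |M|)
    refine squeeze_zero_norm (fun n => ?_) h2
    have h3 : ‖∫ q, φ q * fderiv ℝ (ψ n) q (V q) ∂μ‖ ≤ ∫ q, D * |M| * ‖fderiv ℝ (ψ n) q‖ ∂μ := by
      refine norm_integral_le_of_norm_le ((hψi n).const_mul _) ?_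
      filter_upwards [hVM] with q hq
      by_cases hqA : q ∈ A
      · rw [norm_mul, mul_assoc, mul_comm |M|]
        refine mul_le_mul (hD q).1 (((fderiv ℝ (ψ n) q).le_opNorm _).trans ?_) (norm_nonneg _) hD0
        exact mul_le_mul_of_nonneg_left ((hq hqA).trans (le_abs_self M)) (norm_nonneg _)
      · rw [hφ.eq_zero hqA, zero_mul, norm_zero]
        positivity
    rw [integral_const_mul] at h3
    exact h3.trans (mul_le_mul_of_nonneg_left (hψI n) (by positivity))
  have h5 := hl1.sub hl2
  simp_rw [← heq, sub_zero] at h5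
  exact tendsto_nhds_unique tendsto_const_nhds h5

end Removable

/-! ### Countably many interfaces -/

lemma IsLocallyClosed.exists_iUnion_isClosed {X : Type*} [MetricSpace X] {s : Set X}
    (hs : IsLocallyClosed s) : ∃ C : ℕ → Set X, (∀ n, IsClosed (C n)) ∧ ⋃ n, C n = s := by
  obtain ⟨U, C, hU, hC, rfl⟩ := hs
  obtain ⟨D, hD, -, hDU, -⟩ := hU.exists_iUnion_isClosed
  exact ⟨fun n => D n ∩ C, fun n => (hD n).inter hC, by rw [← iUnion_inter, hDU]⟩

/-- A form of Baire's theorem for locally closed sets. -/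
lemma exists_open_inter_subset_of_iUnion {X : Type*} [MetricSpace X] [LocallyCompactSpace X]
    {S : Set X} (hS : IsLocallyClosed S) (hne : S.Nonempty) {F : ℕ → Set X}
    (hF : ∀ k, IsLocallyClosed (F k)) (hSF : S ⊆ ⋃ k, F k) :
    ∃ k, ∃ B, IsOpen B ∧ (S ∩ B).Nonempty ∧ S ∩ B ⊆ F k := by
  choose C hC hCF using fun k => (hF k).exists_iUnion_isClosed
  have : LocallyCompactSpace S := hS.locallyCompactSpace
  have : Nonempty S := hne.to_subtype
  obtain ⟨⟨k, n⟩, x, hx⟩ := nonempty_interior_of_iUnion_of_closed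
    (f := fun i : ℕ × ℕ => ((↑) : S → X) ⁻¹' C i.1 i.2)
    (fun i => (hC i.1 i.2).preimage continuous_subtype_val) (by
      rw [eq_univ_iff_forall]
      intro x
      obtain ⟨k, hk⟩ := mem_iUnion.1 (hSF x.2)
      rw [← hCF k] at hk
      obtain ⟨n, hn⟩ := mem_iUnion.1 hk
      exact mem_iUnion.2 ⟨(k, n), hn⟩)
  obtain ⟨T, hT, hTo, hxT⟩ := mem_interior.1 hx
  obtain ⟨B, hB, rfl⟩ := isOpen_induced_iff.1 hTo
  refine ⟨k, B, hB, ⟨x, x.2, hxT⟩, fun y hy => ?_⟩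
  rw [← hCF k]
  exact mem_iUnion.2 ⟨n, @hT ⟨y, hy.1⟩ hy.2⟩

section Interfaces

set_option linter.unusedSectionVars false

variable {E : Type*} [NormedAddCommGroup E] [NormedSpace ℝ E] [FiniteDimensional ℝ E]
  [MeasurableSpace E] [BorelSpace E] {μ : Measure E} [μ.IsAddHaarMeasure]

/-- Interfaces may accumulate on each other, so they cannot be removed one at a time. Let `R` be the
set of points near which the divergence identity holds. If some part `S` of `O \ Z` were left over,
Baire's theorem would give an open set in which `S` is nonempty and lies in a single `F k`; there `F
k` is the only obstacle, and crossing it contradicts the choice of `S`. The null set `Z` is removed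
last. -/
theorem IsWeakDiv.of_interfaces {d : ℕ} (hd : 0 < d) (hdim : Module.finrank ℝ E = d + 1)
    {V : E → E} {h : E → ℝ} {O Z : Set E} {F : ℕ → Set E} {M : ℝ} (hO : IsOpen O)
    (hZ : IsClosed Z) (hZ0 : Measure.hausdorffMeasure (d : ℝ) Z = 0)
    (hF : ∀ k, IsLocallyClosed (F k)) (hZF : IsClosed (Z ∪ ⋃ k, F k))
    (hV : LocallyIntegrableOn V O μ) (hh : LocallyIntegrableOn h O μ)
    (hVM : ∀ᵐ q ∂μ, q ∈ O → ‖V q‖ ≤ M) (hreg : IsWeakDiv μ V h (O \ (Z ∪ ⋃ k, F k)))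
    (hfront : ∀ k, ∀ q ∈ F k, q ∈ O → q ∉ Z → ∃ B ∈ 𝓝 q, ∀ A, IsOpen A → A ⊆ B →
      IsWeakDiv μ V h (A \ F k) → IsWeakDiv μ V h A) :
    IsWeakDiv μ V h O := by
  set R : Set E := {q | ∃ B, IsOpen B ∧ q ∈ B ∧ IsWeakDiv μ V h (O ∩ B)} with hR
  have hRo : IsOpen R := by
    rw [isOpen_iff_mem_nhds]
    rintro q ⟨B, hB, hq, hw⟩
    filter_upwards [hB.mem_nhds hq] with x hx using ⟨B, hB, hx, hw⟩
  have hRw : IsWeakDiv μ V h (O ∩ R) := by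
    refine isWeakDiv_of_local (hV.mono_set inter_subset_left) (hh.mono_set inter_subset_left) ?_
    rintro q ⟨-, B, hB, hq, hw⟩
    exact ⟨B, hB.mem_nhds hq, hw.mono (inter_subset_inter_left B inter_subset_left)⟩
  have hRZ : O \ Z ⊆ R := by
    by_contra hne
    obtain ⟨p, hp, hpR⟩ := not_subset.1 hne
    set S : Set E := (O ∩ Zᶜ) ∩ Rᶜ with hS
    have hSl : IsLocallyClosed S :=
      ⟨O ∩ Zᶜ, Rᶜ, hO.inter hZ.isOpen_compl, hRo.isClosed_compl, rfl⟩
    have hSF : S ⊆ ⋃ k, F k := by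
      rintro q ⟨⟨hqO, hqZ⟩, hqR⟩
      by_contra hqF
      refine hqR ⟨(Z ∪ ⋃ k, F k)ᶜ, hZF.isOpen_compl, ?_, hreg⟩
      rw [mem_compl_iff, mem_union, not_or]
      exact ⟨hqZ, hqF⟩
    obtain ⟨k, B, hB, ⟨q, hqS, hqB⟩, hSB⟩ :=
      exists_open_inter_subset_of_iUnion hSl ⟨p, ⟨hp.1, hp.2⟩, hpR⟩ hF hSF
    obtain ⟨B', hB', hloc⟩ := hfront k q (hSB ⟨hqS, hqB⟩) hqS.1.1 hqS.1.2
    have hA : IsOpen ((O ∩ Zᶜ) ∩ (B ∩ interior B')) :=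
      (hO.inter hZ.isOpen_compl).inter (hB.inter isOpen_interior)
    -- In this open set every point off `F k` already belongs to `R`, which is the hypothesis needed
    -- to cross `F k`.
    have hAw := hloc _ hA (fun x hx => interior_subset hx.2.2) (hRw.mono (by
      rintro x ⟨⟨hx1, hx2⟩, hx3⟩
      refine ⟨hx1.1, ?_⟩
      by_contra hxR
      exact hx3 (hSB ⟨⟨hx1, hxR⟩, hx2.1⟩)))
    exact hqS.2 ⟨_, hA, ⟨hqS.1, hqB, mem_interior_iff_mem_nhds.2 hB'⟩,
      hAw.mono inter_subset_right⟩
  exact IsWeakDiv.of_diff_null hd hdim hZ hZ0 hV hh hVM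
    (hRw.mono fun q hq => ⟨hq.1, hRZ hq⟩)

end Interfaces

/-! ### Level sets as graphs -/

section ImplicitGraph

variable {Y : Type*} [NormedAddCommGroup Y] [NormedSpace ℝ Y] [CompleteSpace Y]

/-- In the box `W × (a, b)` the level set `f = 0` is the graph of the `C^1` function `γ`,
with `f > 0` below and `f < 0` above the graph. -/
structure IsGraphBox (f : Y × ℝ → ℝ) (γ : Y → ℝ) (W : Set Y) (a b : ℝ) : Prop where
  isOpen : IsOpen W
  contDiffOn : ContDiffOn ℝ 1 γ W
  mem : ∀ y ∈ W, γ y ∈ Ioo a b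
  deriv_neg : ∀ y ∈ W, ∀ r ∈ Ioo a b, fderiv ℝ f (y, r) (0, 1) < 0
  eq_zero : ∀ y ∈ W, f (y, γ y) = 0
  pos : ∀ y ∈ W, ∀ r ∈ Ioo a b, r < γ y → 0 < f (y, r)
  neg : ∀ y ∈ W, ∀ r ∈ Ioo a b, γ y < r → f (y, r) < 0
  fderiv_graph : ∀ y ∈ W, ∀ v, fderiv ℝ f (y, γ y) (v, fderiv ℝ γ y v) = 0

/-- Strict monotonicity in the last variable gives a unique zero on each fibre and the signs on both
sides; the implicit function theorem is needed only for the smoothness of `γ`. -/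
lemma exists_isGraphBox {f : Y × ℝ → ℝ} {p : Y × ℝ} (hf : ContDiffAt ℝ 1 f p) (h0 : f p = 0)
    (hd : fderiv ℝ f p (0, 1) < 0) {U : Set (Y × ℝ)} (hU : U ∈ 𝓝 p) :
    ∃ γ W a b, IsGraphBox f γ W a b ∧ p.1 ∈ W ∧ γ p.1 = p.2 ∧ a < p.2 ∧ p.2 < b ∧
      W ×ˢ Ioo a b ⊆ U := by
  have h1 : ∀ᶠ q in 𝓝 p, ContDiffAt ℝ 1 f q := hf.eventually (by simp)
  have h2 : ∀ᶠ q in 𝓝 p, fderiv ℝ f q (0, 1) < 0 :=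
    (((hf.fderiv_right (m := 0) (by simp)).continuousAt.clm_apply
      continuousAt_const).eventually (gt_mem_nhds hd))
  obtain ⟨V₁, hV₁, V₂, hV₂, hV⟩ := mem_nhds_prod_iff.1 ((h1.and h2).and hU)
  obtain ⟨a₀, b₀, ⟨ha₀, hb₀⟩, hab₀⟩ := (mem_nhds_iff_exists_Ioo_subset).1 hV₂
  -- Moving the end points halfway towards `p.2` keeps the closed interval inside the given open
  -- one.
  set a := (a₀ + p.2) / 2 with ha
  set b := (b₀ + p.2) / 2 with hb
  have haa : a₀ < a := by rw [ha]; linarith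
  have hap : a < p.2 := by rw [ha]; linarith
  have hpb : p.2 < b := by rw [hb]; linarith
  have hbb : b < b₀ := by rw [hb]; linarith
  have hbox : ∀ y ∈ V₁, ∀ r ∈ Icc a b, ContDiffAt ℝ 1 f (y, r) ∧
      fderiv ℝ f (y, r) (0, 1) < 0 ∧ (y, r) ∈ U := by
    intro y hy r hr
    have := @hV (y, r) ⟨hy, hab₀ ⟨haa.trans_le hr.1, hr.2.trans_lt hbb⟩⟩
    exact ⟨this.1.1, this.1.2, this.2⟩
  have hder : ∀ y ∈ V₁, ∀ r ∈ Icc a b,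
      HasDerivAt (fun s => f (y, s)) (fderiv ℝ f (y, r) (0, 1)) r := by
    intro y hy r hr
    have h3 := ((hbox y hy r hr).1.differentiableAt one_ne_zero).hasFDerivAt
    exact h3.comp_hasDerivAt r ((hasDerivAt_const r y).prodMk (hasDerivAt_id r))
  have hanti : ∀ y ∈ V₁, StrictAntiOn (fun s => f (y, s)) (Icc a b) := by
    intro y hy
    refine strictAntiOn_of_deriv_neg (convex_Icc a b)
      (fun r hr => (hder y hy r hr).continuousAt.continuousWithinAt) fun r hr => ?_
    have hr' := interior_subset hr
    rw [(hder y hy r hr').deriv]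
    exact (hbox y hy r hr').2.1
  have hp1 : p.1 ∈ V₁ := mem_of_mem_nhds hV₁
  have hfa : 0 < f (p.1, a) := by
    rw [← h0]
    exact hanti p.1 hp1 ⟨le_rfl, by linarith⟩ ⟨hap.le, hpb.le⟩ hap
  have hfb : f (p.1, b) < 0 := by
    rw [← h0]
    exact hanti p.1 hp1 ⟨hap.le, hpb.le⟩ ⟨by linarith, le_rfl⟩ hpb
  have hcont : ∀ r ∈ Icc a b, ContinuousAt (fun y => f (y, r)) p.1 := by
    intro r hr
    exact ContinuousAt.comp (f := fun y => (y, r)) (hbox p.1 hp1 r hr).1.continuousAt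
      (continuousAt_id.prodMk continuousAt_const)
  have hab : a < b := hap.trans hpb
  have hV₁' : ∀ᶠ y in 𝓝 p.1, y ∈ V₁ := hV₁
  obtain ⟨W, hWsub', hWo, hpW⟩ := mem_nhds_iff.1 (hV₁'.and
    (((hcont a ⟨le_rfl, hab.le⟩).eventually (lt_mem_nhds hfa)).and
      ((hcont b ⟨hab.le, le_rfl⟩).eventually (gt_mem_nhds hfb))))
  have hWsub : ∀ y ∈ W, y ∈ V₁ ∧ 0 < f (y, a) ∧ f (y, b) < 0 := fun y hy => hWsub' hy
  have hroot : ∀ y ∈ W, ∃ r ∈ Ioo a b, f (y, r) = 0 := by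
    intro y hy
    obtain ⟨hy1, hy2, hy3⟩ := hWsub y hy
    exact intermediate_value_Ioo' hab.le
      (fun r hr => (hder y hy1 r hr).continuousAt.continuousWithinAt) ⟨hy3, hy2⟩
  choose! γ hγ hγ0 using hroot
  have huniq : ∀ y ∈ W, ∀ r ∈ Ioo a b, f (y, r) = 0 → r = γ y := fun y hy r hr h =>
    (hanti y (hWsub y hy).1).injOn (Ioo_subset_Icc_self hr) (Ioo_subset_Icc_self (hγ y hy))
      (h.trans (hγ0 y hy).symm)
  have hsmooth : ∀ y ∈ W, ContDiffAt ℝ 1 γ y := by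
    intro y hy
    have hb1 := hbox y (hWsub y hy).1 (γ y) (Ioo_subset_Icc_self (hγ y hy))
    set c := fderiv ℝ f (y, γ y) (0, 1) with hc
    have hc0 : c ≠ 0 := hb1.2.1.ne
    have hinv : (fderiv ℝ f (y, γ y) ∘L .inr ℝ Y ℝ).IsInvertible := by
      refine ⟨ContinuousLinearEquiv.unitsEquivAut ℝ (Units.mk0 c hc0), ?_⟩
      ext
      simp [hc]
    -- The local implicit function takes values in `(a, b)` near `y`, so uniqueness of the zero
    -- identifies it with `γ`.
    have he1 := hb1.1.eventually_apply_implicitFunction one_ne_zero hinv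
    have he2 := hb1.1.contDiffAt_implicitFunction one_ne_zero hinv
    have he3 := hb1.1.implicitFunction_apply_self one_ne_zero hinv
    refine he2.congr_of_eventuallyEq ?_
    have he4 : ∀ᶠ z in 𝓝 y, hb1.1.implicitFunction one_ne_zero hinv z ∈ Ioo a b :=
      he2.continuousAt.eventually (by rw [he3]; exact isOpen_Ioo.mem_nhds (hγ y hy))
    filter_upwards [he1, he4, hWo.mem_nhds hy] with z hz1 hz2 hz3
    exact (huniq z hz3 _ hz2 (hz1.trans (hγ0 y hy))).symm
  refine ⟨γ, W, a, b, ⟨hWo, fun y hy => (hsmooth y hy).contDiffWithinAt, hγ, ?_, hγ0, ?_, ?_,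
    ?_⟩, hpW, ?_, hap, hpb, ?_⟩
  · exact fun y hy r hr => (hbox y (hWsub y hy).1 r (Ioo_subset_Icc_self hr)).2.1
  · intro y hy r hr hlt
    rw [← hγ0 y hy]
    exact hanti y (hWsub y hy).1 (Ioo_subset_Icc_self hr) (Ioo_subset_Icc_self (hγ y hy)) hlt
  · intro y hy r hr hlt
    rw [← hγ0 y hy]
    exact hanti y (hWsub y hy).1 (Ioo_subset_Icc_self (hγ y hy)) (Ioo_subset_Icc_self hr) hlt
  · intro y hy v
    have h3 := ((hbox y (hWsub y hy).1 _ (Ioo_subset_Icc_self (hγ y hy))).1.differentiableAt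
      one_ne_zero).hasFDerivAt
    have h4 := ((hsmooth y hy).differentiableAt one_ne_zero).hasFDerivAt
    have h5 : HasFDerivAt (fun z => f (z, γ z)) _ y := h3.comp y ((hasFDerivAt_id y).prodMk h4)
    have h6 : (fun z => f (z, γ z)) =ᶠ[𝓝 y] fun _ => 0 := by
      filter_upwards [hWo.mem_nhds hy] with z hz using hγ0 z hz
    have h7 := h5.unique ((hasFDerivAt_const (0 : ℝ) y).congr_of_eventuallyEq h6)
    simpa using congrArg (fun B : Y →L[ℝ] ℝ => B v) h7
  · exact (huniq p.1 hpW p.2 ⟨hap, hpb⟩ h0).symm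
  · rintro ⟨y, r⟩ ⟨hy, hr⟩
    exact (hbox y (hWsub y hy).1 r (Ioo_subset_Icc_self hr)).2.2

end ImplicitGraph

/-! ### Wave fronts -/

section Fronts

variable {N : ℕ} {c : ℝ}

lemma fderiv_apply_space {f : SpaceTime N → ℝ} {p : SpaceTime N} (hf : DifferentiableAt ℝ f p)
    (v : Space N) : fderiv ℝ f p (v, 0) = inner ℝ (spaceGradient f p) v := by
  have h1 : HasFDerivAt (fun y : Space N => f (y, p.2))
      ((fderiv ℝ f p).comp (ContinuousLinearMap.inl ℝ (Space N) ℝ)) p.1 := by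
    have h2 : HasFDerivAt f (fderiv ℝ f p) ((fun y : Space N => (y, p.2)) p.1) := hf.hasFDerivAt
    exact h2.comp p.1 (hasFDerivAt_prodMk_left p.1 p.2)
  rw [spaceGradient, gradient, InnerProductSpace.toDual_symm_apply, h1.fderiv]
  rfl

lemma fderiv_apply_time {f : SpaceTime N → ℝ} {p : SpaceTime N} (hf : DifferentiableAt ℝ f p) :
    fderiv ℝ f p (0, 1) = deriv (fun s : ℝ => f (p.1, s)) p.2 := by
  have h2 : HasFDerivAt f (fderiv ℝ f p) ((fun s : ℝ => (p.1, s)) p.2) := hf.hasFDerivAt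
  exact (h2.comp_hasDerivAt p.2 ((hasDerivAt_const p.2 p.1).prodMk (hasDerivAt_id p.2))).deriv.symm

namespace IsFrontEquation

variable {F : Set (SpaceTime N)} {p : SpaceTime N} {f : SpaceTime N → ℝ}

lemma differentiableAt (h : IsFrontEquation c F p f) : DifferentiableAt ℝ f p :=
  h.contDiffAt.differentiableAt one_ne_zero

lemma fderiv_apply (h : IsFrontEquation c F p f) (d : SpaceTime N) :
    fderiv ℝ f p d = inner ℝ (spaceGradient f p) d.1 - c * ‖spaceGradient f p‖ * d.2 := by
  have h1 : d = (d.1, (0 : ℝ)) + d.2 • ((0 : Space N), (1 : ℝ)) := by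
    ext <;> simp
  conv_lhs => rw [h1]
  rw [map_add, map_smul, fderiv_apply_space h.differentiableAt, fderiv_apply_time h.differentiableAt,
    h.speed, smul_eq_mul]
  ring

lemma eq_zero (h : IsFrontEquation c F p f) (hp : p ∈ F) : f p = 0 :=
  h.mem_iff.self_of_nhds.1 hp

lemma fderiv_time_neg (h : IsFrontEquation c F p f) (hc : 0 < c) : fderiv ℝ f p (0, 1) < 0 := by
  have := norm_pos_iff.2 h.gradient_ne_zero
  rw [h.fderiv_apply]
  simp
  positivity

/-- The conormal of a front is null, so by Cauchy–Schwarz it annihilates no timelike direction. -/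
lemma fderiv_timelike_ne_zero (h : IsFrontEquation c F p f) {d : SpaceTime N}
    (hd : ‖d.1‖ < c * |d.2|) : fderiv ℝ f p d ≠ 0 := by
  intro h0
  have h1 := norm_pos_iff.2 h.gradient_ne_zero
  rw [h.fderiv_apply, sub_eq_zero] at h0
  have h2 := abs_real_inner_le_norm (spaceGradient f p) d.1
  rw [h0, abs_mul, abs_mul, abs_norm] at h2
  have h3 : c * |d.2| * ‖spaceGradient f p‖ ≤ ‖d.1‖ * ‖spaceGradient f p‖ := by
    have := le_abs_self c
    have h4 := abs_nonneg d.2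
    have h5 : c * |d.2| * ‖spaceGradient f p‖ ≤ |c| * |d.2| * ‖spaceGradient f p‖ := by gcongr
    linarith
  have := le_of_mul_le_mul_right h3 h1
  linarith

end IsFrontEquation

namespace IsWaveFront

variable {F : Set (SpaceTime N)}

/-- Near each of its points a front is the zero set of a continuous function. This is the form that
the Baire argument requires. -/
lemma isLocallyClosed (hF : IsWaveFront c F) : IsLocallyClosed F := by
  refine ((isLocallyClosed_tfae F).out 0 3).2 fun p hp => ?_
  obtain ⟨f, hf⟩ := hF p hp
  obtain ⟨U, hU, hUo, hpU⟩ := mem_nhds_iff.1 (hf.mem_iff.and (hf.contDiffAt.eventually (by simp)))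
  refine ⟨U, hpU, hUo, ?_⟩
  rintro q ⟨hqU, hqF⟩
  rw [(hU hqU).1]
  have hcont : ContinuousAt f q := (hU hqU).2.continuousAt
  have : (𝓝[F] q).NeBot := mem_closure_iff_nhdsWithin_neBot.1 hqF
  refine tendsto_nhds_unique (hcont.mono_left nhdsWithin_le_nhds)
    (tendsto_const_nhds.congr' ?_ : Tendsto f (𝓝[F] q) (𝓝 0))
  filter_upwards [self_mem_nhdsWithin, nhdsWithin_le_nhds (hUo.mem_nhds hqU)] with x hx hxU
  exact ((hU hxU).1.1 hx).symm

lemma measurableSet (hF : IsWaveFront c F) : MeasurableSet F := by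
  obtain ⟨U, C, hU, hC, rfl⟩ := hF.isLocallyClosed
  exact hU.measurableSet.inter hC.measurableSet

/-- A timelike line meets a wave front in a countable set. -/
lemma countable_timelike (hF : IsWaveFront c F) (q : SpaceTime N) {d : SpaceTime N}
    (hd : ‖d.1‖ < c * |d.2|) : {s : ℝ | q + s • d ∈ F}.Countable := by
  -- Along the line `f` has nonzero derivative at each hit, so the hits are isolated from the right,
  -- and a subset of the real line has only countably many such points.
  refine (countable_setOfPred_isolated_right_within
    (s := {s : ℝ | q + s • d ∈ F})).mono fun s hs => ?_
  obtain ⟨f, hf⟩ := hF _ hs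
  have hline : HasDerivAt (fun s : ℝ => q + s • d) d s := by
    simpa using ((hasDerivAt_id s).smul_const d).const_add q
  have h1 : HasDerivAt (fun s : ℝ => f (q + s • d)) (fderiv ℝ f (q + s • d) d) s :=
    hf.differentiableAt.hasFDerivAt.comp_hasDerivAt s hline
  have h2 := h1.eventually_ne (c := 0) (hf.fderiv_timelike_ne_zero hd)
  have h3 : ∀ᶠ r in 𝓝[>] s, q + r • d ∉ F := by
    have h4 := nhdsWithin_le_nhds (s := Ioi s) (hline.continuousAt.eventually hf.mem_iff)
    filter_upwards [h4, h2.filter_mono (nhdsWithin_mono s fun x hx => (ne_of_gt hx))] with r hr1 hr2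
    rw [hr1]
    exact hr2
  refine ⟨hs, ?_⟩
  have h5 : ∀ᶠ r in 𝓝[{s : ℝ | q + s • d ∈ F} ∩ Ioi s] s, False := by
    filter_upwards [h3.filter_mono (nhdsWithin_mono s inter_subset_right), self_mem_nhdsWithin]
      with r hr1 hr2 using hr1 hr2.1
  exact Filter.eventually_false_iff_eq_bot.1 h5

/-- The slice is a hypersurface of space with normal `m`: locally each line parallel to `m` meets it
at most once, and integrating along these lines shows that it is null. -/
lemma volume_slice (hF : IsWaveFront c F) (t : ℝ) : volume {x : Space N | (x, t) ∈ F} = 0 := by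
  have hm : MeasurableSet {x : Space N | (x, t) ∈ F} :=
    hF.measurableSet.preimage measurable_prodMk_right
  refine measure_null_of_locally_null _ fun x hx => ?_
  obtain ⟨f, hf⟩ := hF _ hx
  set m := spaceGradient f (x, t)
  have hm0 : 0 < ‖m‖ := norm_pos_iff.2 hf.gradient_ne_zero
  have hemb : Tendsto (fun y : Space N => (y, t)) (𝓝 x) (𝓝 (x, t)) :=
    (Continuous.prodMk_left t).tendsto x
  have hs : HasStrictFDerivAt f (fderiv ℝ f (x, t)) (x, t) :=
    hf.contDiffAt.hasStrictFDerivAt one_ne_zero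
  have hg : HasStrictFDerivAt (fun y : Space N => f (y, t)) _ x :=
    hs.comp x (g := f) (f := fun y : Space N => (y, t))
      ((hasStrictFDerivAt_id x).prodMk (hasStrictFDerivAt_const t x))
  -- Along `m` the function `f` grows at rate `‖m‖` per unit length, so an error of half that rate
  -- excludes two zeros on one line.
  have h1 := hg.isLittleO.def (show 0 < ‖m‖ / 2 by positivity)
  rw [nhds_prod_eq] at h1
  obtain ⟨U', hU', hUs⟩ := eventually_prod_self_iff (r := fun y z : Space N =>
    ‖f (y, t) - f (z, t) - fderiv ℝ f (x, t) (y - z, (0 : ℝ))‖ ≤ ‖m‖ / 2 * ‖y - z‖).1 h1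
  obtain ⟨U, hU, hUo, hxU⟩ := mem_nhds_iff.1 (inter_mem hU' (hemb.eventually hf.mem_iff))
  refine ⟨U ∩ {x : Space N | (x, t) ∈ F},
    inter_mem (nhdsWithin_le_nhds (hUo.mem_nhds hxU)) self_mem_nhdsWithin, ?_⟩
  rw [measure_eq_zero_iff_ae_notMem]
  refine ae_mem_of_ae_add_linearMap_mem (LinearMap.toSpanSingleton ℝ (Space N) m) volume volume
    (s := (U ∩ {x : Space N | (x, t) ∈ F})ᶜ) (hUo.measurableSet.inter hm).compl fun y => ?_
  have hsub : {s : ℝ | y + s • m ∈ U ∩ {x : Space N | (x, t) ∈ F}}.Subsingleton := by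
    rintro r ⟨hr1, hr2⟩ s ⟨hs1, hs2⟩
    have h2 := hUs _ (hU hr1).1 _ (hU hs1).1
    have h3 : f (y + r • m, t) = 0 := (hU hr1).2.1 hr2
    have h4 : f (y + s • m, t) = 0 := (hU hs1).2.1 hs2
    have h5 : y + r • m - (y + s • m) = (r - s) • m := by rw [sub_smul]; abel
    rw [h5] at h2
    have h6 : (fderiv ℝ f (x, t)) ((r - s) • m, (0 : ℝ)) = (r - s) * (‖m‖ * ‖m‖) := by
      rw [hf.fderiv_apply]
      simp only [inner_smul_right, mul_zero, sub_zero]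
      rw [real_inner_self_eq_norm_mul_norm]
    have h7 : ‖f (y + r • m, t) - f (y + s • m, t) - (fderiv ℝ f (x, t)) ((r - s) • m, (0 : ℝ))‖
      ≤ ‖m‖ / 2 * ‖(r - s) • m‖ := h2
    rw [h3, h4, h6, sub_self, zero_sub, norm_neg, norm_mul, norm_smul, norm_mul, norm_norm] at h7
    have h8 : ‖r - s‖ = 0 := by
      by_contra h9
      have h10 : 0 < ‖r - s‖ := lt_of_le_of_ne (norm_nonneg _) (Ne.symm h9)
      have : 0 < ‖r - s‖ * (‖m‖ * ‖m‖) := by positivity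
      nlinarith
    exact sub_eq_zero.1 (norm_eq_zero.1 h8)
  exact (measure_eq_zero_iff_ae_notMem.1 (hsub.measure_zero volume)).mono fun s hs => hs

end IsWaveFront

lemma volume_image_fst_of_hausdorffMeasure {Z : Set (SpaceTime N)}
    (hZ : Measure.hausdorffMeasure (N : ℝ) Z = 0) : volume (Prod.fst '' Z) = 0 := by
  rw [← EuclideanSpace.euclideanHausdorffMeasure_eq_volume,
    Measure.euclideanHausdorffMeasure_def, Measure.smul_apply]
  have h1 := (LipschitzWith.prod_fst (α := Space N) (β := ℝ)).hausdorffMeasure_image_le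
    (d := (N : ℝ)) (by positivity) Z
  rw [hZ, mul_zero, nonpos_iff_eq_zero] at h1
  rw [h1, smul_zero]

/-- The projection to space is 1-Lipschitz, so the shadow of `Z` is null: over almost every `x` the
whole time line avoids `Z`. -/
lemma ae_forall_notMem_of_hausdorffMeasure {Z : Set (SpaceTime N)}
    (hZ : Measure.hausdorffMeasure (N : ℝ) Z = 0) : ∀ᵐ x : Space N, ∀ t : ℝ, (x, t) ∉ Z := by
  filter_upwards [measure_eq_zero_iff_ae_notMem.1 (volume_image_fst_of_hausdorffMeasure hZ)]
    with x hx t hxt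
  exact hx ⟨_, hxt, rfl⟩

end Fronts

/-! ### Energy flux of a classical solution -/

instance isAddHaarMeasure_spaceTime (N : ℕ) :
    (volume : Measure (SpaceTime N)).IsAddHaarMeasure :=
  inferInstanceAs ((volume : Measure (Space N)).prod (volume : Measure ℝ)).IsAddHaarMeasure

section Flux

variable {N : ℕ} {c : ℝ}

/-- The space part of a covector of space-time. -/
def spacePart (a : SpaceTime N →L[ℝ] ℝ) : Space N :=
  ∑ j : Fin N, a (EuclideanSpace.single j 1, 0) • EuclideanSpace.single j (1 : ℝ)

/-- The space-time energy flux `(-u_t ∇u, E)` of a function with derivative `a`. -/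
def energyFlux (c : ℝ) (a : SpaceTime N →L[ℝ] ℝ) : SpaceTime N :=
  (-(a (0, 1) • spacePart a), 1 / 2 * ((a (0, 1) / c) ^ 2
    + ∑ j : Fin N, (a (EuclideanSpace.single j 1, 0)) ^ 2))

lemma continuous_energyFlux : Continuous (energyFlux (N := N) c) := by
  unfold energyFlux spacePart
  fun_prop

lemma inner_spacePart (a : SpaceTime N →L[ℝ] ℝ) (v : Space N) :
    inner ℝ (spacePart a) v = a (v, 0) := by
  have hv : (v, (0 : ℝ)) = ∑ j : Fin N, v j • ((EuclideanSpace.single j (1 : ℝ) : Space N), (0 : ℝ)) := by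
    rw [Prod.ext_iff]
    constructor
    · have := (EuclideanSpace.basisFun (Fin N) ℝ).sum_repr v
      simp only [EuclideanSpace.basisFun_repr, EuclideanSpace.basisFun_apply] at this
      simp [Prod.fst_sum, this]
    · simp [Prod.snd_sum]
  rw [hv, map_sum, spacePart, sum_inner]
  refine Finset.sum_congr rfl fun j _ => ?_
  rw [inner_smul_left, EuclideanSpace.inner_single_left, map_smul, smul_eq_mul]
  simp [mul_comm]

lemma sum_sq_eq_norm_spacePart (a : SpaceTime N →L[ℝ] ℝ) :
    ∑ j : Fin N, (a (EuclideanSpace.single j 1, 0)) ^ 2 = ‖spacePart a‖ ^ 2 := by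
  rw [← real_inner_self_eq_norm_sq, inner_spacePart]
  conv_rhs => rw [spacePart]
  have : ((∑ j : Fin N, a (EuclideanSpace.single j 1, 0) • EuclideanSpace.single j (1 : ℝ) : Space N),
      (0 : ℝ)) = ∑ j : Fin N, a (EuclideanSpace.single j 1, 0) •
        ((EuclideanSpace.single j (1 : ℝ) : Space N), (0 : ℝ)) := by
    rw [Prod.ext_iff]
    constructor
    · simp [Prod.fst_sum]
    · simp [Prod.snd_sum]
  rw [this, map_sum]
  refine Finset.sum_congr rfl fun j _ => ?_
  rw [map_smul, smul_eq_mul, sq]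

lemma clm_energyFlux (a b : SpaceTime N →L[ℝ] ℝ) :
    b (energyFlux c a) = (energyFlux c a).2 * b (0, 1)
      - ∑ j : Fin N, a (0, 1) * a (EuclideanSpace.single j 1, 0)
        * b (EuclideanSpace.single j 1, 0) := by
  have h1 : energyFlux c a = (energyFlux c a).2 • ((0 : Space N), (1 : ℝ))
      + ((energyFlux c a).1, (0 : ℝ)) := by
    ext <;> simp
  conv_lhs => rw [h1]
  have h2 : inner ℝ (spacePart b) (spacePart a) = ∑ j : Fin N,
      a (EuclideanSpace.single j 1, 0) * b (EuclideanSpace.single j 1, 0) := by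
    conv_lhs => rw [show spacePart a = ∑ j : Fin N, a (EuclideanSpace.single j 1, 0) •
      EuclideanSpace.single j (1 : ℝ) from rfl, inner_sum]
    exact Finset.sum_congr rfl fun j _ => by rw [inner_smul_right, inner_spacePart]
  rw [map_add, map_smul, ← inner_spacePart b]
  simp only [energyFlux, inner_neg_right, inner_smul_right, h2, smul_eq_mul, Finset.mul_sum,
    mul_assoc]
  ring

/-- A jump of the derivative normal to a characteristic surface does not change the flux of
energy through the surface. -/
lemma conormal_energyFlux_add (hc : c ≠ 0) (a : SpaceTime N →L[ℝ] ℝ) (m : Space N) (lam : ℝ)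
    (a' : SpaceTime N →L[ℝ] ℝ) (ha'1 : a' (0, 1) = a (0, 1) - lam * (c * ‖m‖))
    (ha'2 : ∀ v, a' (v, 0) = a (v, 0) + lam * inner ℝ m v) (hm : m ≠ 0) :
    (energyFlux c a').2 - (c * ‖m‖)⁻¹ * inner ℝ m (energyFlux c a').1 =
    (energyFlux c a).2 - (c * ‖m‖)⁻¹ * inner ℝ m (energyFlux c a).1 := by
  have hsp : spacePart a' = spacePart a + lam • m := by
    refine ext_inner_right ℝ fun v => ?_
    rw [inner_spacePart, inner_add_left, inner_spacePart, ha'2, inner_smul_left]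
    simp
  have hm' : ‖m‖ ≠ 0 := norm_ne_zero_iff.2 hm
  -- The terms linear and quadratic in `lam` cancel separately, because the covector with space part
  -- `m` and time part `-c * ‖m‖` is null.
  simp only [energyFlux, sum_sq_eq_norm_spacePart, hsp, ha'1, norm_add_sq_real, inner_neg_right,
    inner_smul_right, inner_add_right, norm_smul, real_inner_self_eq_norm_sq,
    real_inner_comm m (spacePart a), mul_pow, Real.norm_eq_abs, sq_abs]
  field_simp
  ring

lemma exists_bound_energyFlux (M : ℝ) :
    ∃ M', ∀ a : SpaceTime N →L[ℝ] ℝ, ‖a‖ ≤ M → ‖energyFlux c a‖ ≤ M' := by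
  obtain ⟨M', hM'⟩ := (isCompact_closedBall (0 : SpaceTime N →L[ℝ] ℝ) M).exists_bound_of_continuousOn
    (continuous_energyFlux (c := c)).continuousOn
  exact ⟨M', fun a ha => hM' a (by simpa using ha)⟩

end Flux

/-! ### The space-time cylinder and the size of the singular set. -/

section Cylinder

variable {N : ℕ} {Ω : Set (Space N)} {u : SpaceTime N → ℝ}

lemma isOpen_openCylinder (hΩ : IsOpen Ω) : IsOpen (openCylinder Ω) := hΩ.prod isOpen_Ioi

lemma isClosed_closedCylinder : IsClosed (closedCylinder Ω) := isClosed_closure.prod isClosed_Ici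

lemma openCylinder_subset_closedCylinder : openCylinder Ω ⊆ closedCylinder Ω :=
  prod_mono subset_closure Ioi_subset_Ici_self

lemma closedCylinder_mem_nhds (hΩ : IsOpen Ω) {q : SpaceTime N} (hq : q ∈ openCylinder Ω) :
    closedCylinder Ω ∈ 𝓝 q :=
  mem_of_superset ((isOpen_openCylinder hΩ).mem_nhds hq) openCylinder_subset_closedCylinder

lemma cylDeriv_eq_fderiv (hΩ : IsOpen Ω) {q : SpaceTime N} (hq : q ∈ openCylinder Ω) :
    cylDeriv Ω u q = fderiv ℝ u q := fderivWithin_of_mem_nhds (closedCylinder_mem_nhds hΩ hq)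

end Cylinder

namespace IsClassicalSolution

variable {N : ℕ} {c : ℝ} {Ω : Set (Space N)} {G : SpaceTime N → ℝ} {u₀ v₀ : Space N → ℝ}
  {uS p : Space N → ℝ → ℝ} {F : ℕ → Set (SpaceTime N)} {Z : Set (SpaceTime N)}
  {u : SpaceTime N → ℝ}

section

variable (hu : IsClassicalSolution c Ω G u₀ v₀ uS p F Z u)
include hu

/-- Makes the energy at a fixed time meaningful: at each instant almost every point is regular. -/
lemma ae_slice_notMem (t : ℝ) : ∀ᵐ x : Space N, (x, t) ∉ Z ∪ ⋃ k, F k := by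
  have h2 : ∀ᵐ x : Space N, ∀ k, (x, t) ∉ F k := ae_all_iff.2 fun k =>
    measure_eq_zero_iff_ae_notMem.1 ((hu.isWaveFront k).volume_slice t)
  filter_upwards [ae_forall_notMem_of_hausdorffMeasure hu.exceptional_null, h2] with x h1 h2
  rw [mem_union, not_or, mem_iUnion, not_exists]
  exact ⟨h1 t, h2⟩

/-- Allows the fundamental theorem of calculus for `u` along timelike segments that avoid `Z`. -/
lemma countable_timelike {q d : SpaceTime N} (hd : ‖d.1‖ < c * |d.2|) {I : Set ℝ}
    (hI : ∀ s ∈ I, q + s • d ∉ Z) : {s ∈ I | q + s • d ∈ Z ∪ ⋃ k, F k}.Countable := by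
  refine (countable_iUnion fun k => (hu.isWaveFront k).countable_timelike q hd).mono ?_
  rintro s ⟨hs1, hs2 | hs2⟩
  · exact absurd hs2 (hI s hs1)
  · obtain ⟨k, hk⟩ := mem_iUnion.1 hs2
    exact mem_iUnion.2 ⟨k, hk⟩

/-- Fubini in time: over almost every `x` the time line avoids `Z`, and being timelike it meets the
fronts in a countable set. -/
lemma volume_singular (hc : 0 < c) : volume (Z ∪ ⋃ k, F k) = 0 := by
  rw [Measure.volume_eq_prod, Measure.measure_prod_null hu.isClosed_singular.measurableSet]
  filter_upwards [ae_forall_notMem_of_hausdorffMeasure hu.exceptional_null] with x hx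
  have := hu.countable_timelike (q := (x, 0)) (d := (0, 1)) (by simpa using hc) (I := univ)
    (fun s _ => by simpa using hx s)
  have h2 := this.measure_zero volume
  refine (congrArg volume ?_).trans h2
  ext s
  simp

lemma hasFDerivAt (hΩ : IsOpen Ω) {q : SpaceTime N} (hq : q ∈ openCylinder Ω \ (Z ∪ ⋃ k, F k)) :
    HasFDerivAt u (cylDeriv Ω u q) q :=
  (hu.differentiableWithinAt q ⟨openCylinder_subset_closedCylinder hq.1, hq.2⟩).hasFDerivWithinAt.hasFDerivAt
    (closedCylinder_mem_nhds hΩ hq.1)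

lemma measurableSet_regular : MeasurableSet (closedCylinder Ω \ (Z ∪ ⋃ k, F k)) :=
  isClosed_closedCylinder.measurableSet.diff hu.isClosed_singular.measurableSet

lemma restrict_regular (hc : 0 < c) {A : Set (SpaceTime N)} :
    (volume : Measure (SpaceTime N)).restrict (A \ (Z ∪ ⋃ k, F k)) = volume.restrict A :=
  Measure.restrict_congr_set (sdiff_null_ae_eq_self (hu.volume_singular hc))

lemma aestronglyMeasurable_cylDeriv (hc : 0 < c) :
    AEStronglyMeasurable (cylDeriv Ω u) (volume.restrict (closedCylinder Ω)) := by
  rw [← hu.restrict_regular hc]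
  exact hu.continuousOn_deriv.aestronglyMeasurable hu.measurableSet_regular

lemma ae_bound_cylDeriv (hc : 0 < c) (T : ℝ) :
    ∃ M, ∀ᵐ q, q ∈ closedCylinder Ω → q.2 ≤ T → ‖cylDeriv Ω u q‖ ≤ M := by
  obtain ⟨M, hM⟩ := hu.bounded_deriv T
  refine ⟨M, ?_⟩
  filter_upwards [measure_eq_zero_iff_ae_notMem.1 (hu.volume_singular hc)] with q hq h1 h2
  exact hM q ⟨h1, hq⟩ h2

end

end IsClassicalSolution

/-! ### The balance of energy where the solution is regular -/

section Regular

variable {E : Type*} [NormedAddCommGroup E] [NormedSpace ℝ E] [FiniteDimensional ℝ E]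
  [MeasurableSpace E] [BorelSpace E] {μ : Measure E} [μ.IsAddHaarMeasure]

omit [FiniteDimensional ℝ E] in
lemma IsTest.integrable_continuousOn_mul {A : Set E} {φ w : E → ℝ} (hφ : IsTest A φ)
    (hw : ContinuousOn w A) : Integrable (fun q => w q * φ q) μ := by
  refine (integrableOn_iff_integrable_of_support_subset (s := tsupport φ) ?_).1 ?_
  · intro q hq
    exact subset_tsupport φ (right_ne_zero_of_mul hq)
  · exact ((hw.mono hφ.subset).mul hφ.contDiff.continuous.continuousOn).integrableOn_compact hφ.compact

lemma IsTest.integral_fderiv_mul {A : Set E} (hA : IsOpen A) {φ w : E → ℝ} (hφ : IsTest A φ)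
    (hw : ContDiffOn ℝ 1 w A) (v : E) :
    Integrable (fun q => w q * fderiv ℝ φ q v) μ ∧ Integrable (fun q => fderiv ℝ w q v * φ q) μ ∧
    ∫ q, w q * fderiv ℝ φ q v ∂μ = -∫ q, fderiv ℝ w q v * φ q ∂μ := by
  have hd : ContinuousOn (fun q => fderiv ℝ w q v) A :=
    (hw.continuousOn_fderiv_of_isOpen hA le_rfl).clm_apply continuousOn_const
  have h1 : Integrable (fun q => w q * fderiv ℝ φ q v) μ := by
    refine (integrableOn_iff_integrable_of_support_subset (s := tsupport φ) ?_).1 ?_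
    · intro q hq
      refine tsupport_fderiv_subset ℝ (subset_tsupport _ fun h0 => hq ?_)
      simp [h0]
    · exact ((hw.continuousOn.mono hφ.subset).mul
        (hφ.continuous_fderiv.clm_apply continuous_const).continuousOn).integrableOn_compact
        hφ.compact
  have h2 := hφ.integrable_continuousOn_mul (μ := μ) hd
  exact ⟨h1, h2, integral_mul_fderiv_eq_neg_fderiv_mul_of_integrable h2 h1
    (hφ.integrable_continuousOn_mul hw.continuousOn)
    (fun x hx => (hw.contDiffAt (hA.mem_nhds (hφ.subset hx))).differentiableAt one_ne_zero)
    (fun x _ => hφ.differentiable x)⟩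

end Regular

namespace IsClassicalSolution

variable {N : ℕ} {c : ℝ} {Ω : Set (Space N)} {G : SpaceTime N → ℝ} {u₀ v₀ : Space N → ℝ}
  {uS p : Space N → ℝ → ℝ} {F : ℕ → Set (SpaceTime N)} {Z : Set (SpaceTime N)}
  {u : SpaceTime N → ℝ}

/-- The field `(-u_t ∇u, E)`. -/
def _root_.energyFluxField (c : ℝ) (Ω : Set (Space N)) (u : SpaceTime N → ℝ) (q : SpaceTime N) :
    SpaceTime N := energyFlux c (cylDeriv Ω u q)

lemma _root_.laplacian_slice_eq {u : SpaceTime N → ℝ} {q : SpaceTime N}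
    (hu : ContDiffAt ℝ 2 u q) :
    Laplacian.laplacian (fun y : Space N => u (y, q.2)) q.1 = ∑ j : Fin N,
      fderiv ℝ (fderiv ℝ u) q (EuclideanSpace.single j 1, 0) (EuclideanSpace.single j 1, 0) := by
  have hd : DifferentiableAt ℝ (fderiv ℝ u) q :=
    (hu.fderiv_right (m := 1) (by norm_num)).differentiableAt one_ne_zero
  have hev : ∀ᶠ z in 𝓝 q, DifferentiableAt ℝ u z :=
    (hu.eventually (by simp)).mono fun z hz => hz.differentiableAt two_ne_zero
  have hemb : Tendsto (fun y : Space N => (y, q.2)) (𝓝 q.1) (𝓝 q) :=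
    (Continuous.prodMk_left q.2).tendsto q.1
  have h1 : fderiv ℝ (fun y : Space N => u (y, q.2)) =ᶠ[𝓝 q.1]
      fun y => (fderiv ℝ u (y, q.2)).comp (ContinuousLinearMap.inl ℝ (Space N) ℝ) := by
    filter_upwards [hemb.eventually hev] with y hy
    have h2 : HasFDerivAt u (fderiv ℝ u (y, q.2)) ((fun z : Space N => (z, q.2)) y) := hy.hasFDerivAt
    exact (h2.comp y (hasFDerivAt_prodMk_left y q.2)).fderiv
  have h3 : HasFDerivAt (fun y : Space N => fderiv ℝ u (y, q.2))
      ((fderiv ℝ (fderiv ℝ u) q).comp (ContinuousLinearMap.inl ℝ (Space N) ℝ)) q.1 := by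
    have h2 : HasFDerivAt (fderiv ℝ u) (fderiv ℝ (fderiv ℝ u) q)
      ((fun z : Space N => (z, q.2)) q.1) := hd.hasFDerivAt
    exact h2.comp q.1 (hasFDerivAt_prodMk_left q.1 q.2)
  rw [InnerProductSpace.laplacian_eq_iteratedFDeriv_orthonormalBasis _
    (EuclideanSpace.basisFun (Fin N) ℝ)]
  refine Finset.sum_congr rfl fun j _ => ?_
  rw [iteratedFDeriv_two_apply, h1.fderiv_eq,
    (h3.clm_comp (hasFDerivAt_const (ContinuousLinearMap.inl ℝ (Space N) ℝ) q.1)).fderiv]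
  simp

lemma _root_.iteratedDeriv_two_slice_eq {u : SpaceTime N → ℝ} {q : SpaceTime N}
    (hu : ContDiffAt ℝ 2 u q) :
    iteratedDeriv 2 (fun s : ℝ => u (q.1, s)) q.2 = fderiv ℝ (fderiv ℝ u) q (0, 1) (0, 1) := by
  have hd : DifferentiableAt ℝ (fderiv ℝ u) q :=
    (hu.fderiv_right (m := 1) (by norm_num)).differentiableAt one_ne_zero
  have hev : ∀ᶠ z in 𝓝 q, DifferentiableAt ℝ u z :=
    (hu.eventually (by simp)).mono fun z hz => hz.differentiableAt two_ne_zero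
  have hemb : Tendsto (fun s : ℝ => (q.1, s)) (𝓝 q.2) (𝓝 q) :=
    (Continuous.prodMk_right q.1).tendsto q.2
  have hline : ∀ s, HasDerivAt (fun s : ℝ => (q.1, s)) ((0 : Space N), (1 : ℝ)) s := fun s =>
    (hasDerivAt_const s q.1).prodMk (hasDerivAt_id s)
  have h1 : deriv (fun s : ℝ => u (q.1, s)) =ᶠ[𝓝 q.2] fun s => fderiv ℝ u (q.1, s) (0, 1) := by
    filter_upwards [hemb.eventually hev] with s hs
    exact (hs.hasFDerivAt.comp_hasDerivAt s (hline s)).deriv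
  have h2 : HasFDerivAt (fderiv ℝ u) (fderiv ℝ (fderiv ℝ u) q) ((fun s : ℝ => (q.1, s)) q.2) :=
    hd.hasFDerivAt
  have h3 := (h2.comp_hasDerivAt q.2 (hline q.2)).clm_apply
    (hasDerivAt_const q.2 ((0 : Space N), (1 : ℝ)))
  rw [iteratedDeriv_succ, iteratedDeriv_one, h1.deriv_eq]
  exact h3.deriv.trans (by simp)

variable (hu : IsClassicalSolution c Ω G u₀ v₀ uS p F Z u)
include hu

/-- Pointwise, ∂_t E - div(u_t ∇u) = u_t (c⁻² u_tt - Δu), since the mixed terms cancel by symmetry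
of the second derivative; the wave equation turns this into -G u_t. Integration by parts in each
coordinate gives the weak form. -/
theorem isWeakDiv_regular (hΩ : IsOpen Ω) :
    IsWeakDiv volume (energyFluxField c Ω u) (fun q => -(G q * velocity Ω u q))
      (openCylinder Ω \ (Z ∪ ⋃ k, F k)) := by
  intro φ hφ
  set A := openCylinder Ω \ (Z ∪ ⋃ k, F k) with hA_def
  have hA : IsOpen A := (isOpen_openCylinder hΩ).sdiff hu.isClosed_singular
  have hcd : ∀ q ∈ A, cylDeriv Ω u q = fderiv ℝ u q := fun q hq => cylDeriv_eq_fderiv hΩ hq.1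
  have hC1 : ContDiffOn ℝ 1 (fderiv ℝ u) A := hu.contDiffOn.fderiv_of_isOpen hA (by norm_num)
  have happ : ∀ d : SpaceTime N, ContDiffOn ℝ 1 (fun q => fderiv ℝ u q d) A := fun d =>
    hC1.clm_apply contDiffOn_const
  set e : Fin N → SpaceTime N := fun j => (EuclideanSpace.single j 1, 0) with he
  set τ : SpaceTime N := (0, 1) with hτ
  set w : SpaceTime N → ℝ := fun q => 1 / 2 * ((fderiv ℝ u q τ / c) ^ 2
    + ∑ j, (fderiv ℝ u q (e j)) ^ 2) with hw
  have hwC : ContDiffOn ℝ 1 w A := contDiffOn_const.mul ((((happ τ).div_const c).pow 2).add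
    (ContDiffOn.sum fun j _ => (happ (e j)).pow 2))
  have hpC : ∀ j, ContDiffOn ℝ 1 (fun q => fderiv ℝ u q τ * fderiv ℝ u q (e j)) A := fun j =>
    (happ τ).mul (happ (e j))
  -- Off `A` the derivative relative to the cylinder may differ from the full derivative, but there
  -- `fderiv ℝ φ` vanishes.
  have hflux : ∀ q, fderiv ℝ φ q (energyFluxField c Ω u q) =
      w q * fderiv ℝ φ q τ - ∑ j, fderiv ℝ u q τ * fderiv ℝ u q (e j) * fderiv ℝ φ q (e j) := by
    intro q
    by_cases hq : q ∈ A
    · rw [energyFluxField, clm_energyFlux, hcd q hq]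
      rfl
    · rw [hφ.fderiv_eq_zero hq]
      simp
  obtain ⟨hi1, hi2, hi3⟩ := hφ.integral_fderiv_mul (μ := volume) hA hwC τ
  have hj := fun j => hφ.integral_fderiv_mul (μ := volume) hA (hpC j) (e j)
  have hdiv : ∀ q, fderiv ℝ w q τ * φ q
      - ∑ j, fderiv ℝ (fun q => fderiv ℝ u q τ * fderiv ℝ u q (e j)) q (e j) * φ q =
      -(G q * velocity Ω u q) * φ q := by
    intro q
    by_cases hq : q ∈ A
    · have hu2 : ContDiffAt ℝ 2 u q := hu.contDiffOn.contDiffAt (hA.mem_nhds hq)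
      have hD : HasFDerivAt (fderiv ℝ u) (fderiv ℝ (fderiv ℝ u) q) q :=
        ((hC1.contDiffAt (hA.mem_nhds hq)).differentiableAt one_ne_zero).hasFDerivAt
      have hwave := hu.wave_equation q hq
      rw [laplacian_slice_eq hu2, iteratedDeriv_two_slice_eq hu2] at hwave
      have hsymm : IsSymmSndFDerivAt ℝ u q := hu2.isSymmSndFDerivAt (by simp)
      have hDd : ∀ d : SpaceTime N, HasFDerivAt (fun q => fderiv ℝ u q d)
          ((fderiv ℝ (fderiv ℝ u) q).flip d) q := by
        intro d
        have h1 := hD.clm_apply (hasFDerivAt_const d q)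
        simpa using h1
      have hwd : fderiv ℝ w q τ = 1 / 2 * (2 * (fderiv ℝ u q τ / c)
          * (fderiv ℝ (fderiv ℝ u) q τ τ / c)
          + ∑ j, 2 * fderiv ℝ u q (e j) * fderiv ℝ (fderiv ℝ u) q τ (e j)) := by
        have h1 := (((((hDd τ).mul_const c⁻¹).pow 2).add
          (HasFDerivAt.fun_sum fun j (_ : j ∈ Finset.univ) => (hDd (e j)).pow 2)).const_mul
          (1 / 2)).fderiv
        have h2 : fderiv ℝ w q = _ := h1
        rw [h2]
        simp [div_eq_mul_inv]
        ring
      have hjd : ∀ j, fderiv ℝ (fun q => fderiv ℝ u q τ * fderiv ℝ u q (e j)) q (e j) =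
          fderiv ℝ u q τ * fderiv ℝ (fderiv ℝ u) q (e j) (e j)
          + fderiv ℝ u q (e j) * fderiv ℝ (fderiv ℝ u) q (e j) τ := by
        intro j
        have h1 : fderiv ℝ (fun q => fderiv ℝ u q τ * fderiv ℝ u q (e j)) q = _ :=
          ((hDd τ).mul (hDd (e j))).fderiv
        rw [h1]
        simp
      have hv : velocity Ω u q = fderiv ℝ u q τ := by rw [velocity, hcd q hq]
      rw [hwd, hv, ← hwave]
      simp_rw [hjd, hsymm.eq τ]
      have e1 : ∑ j, 2 * fderiv ℝ u q (e j) * fderiv ℝ (fderiv ℝ u) q (e j) τ =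
          2 * ∑ j, fderiv ℝ u q (e j) * fderiv ℝ (fderiv ℝ u) q (e j) τ := by
        rw [Finset.mul_sum]
        exact Finset.sum_congr rfl fun j _ => by ring
      rw [e1, ← Finset.sum_mul, Finset.sum_add_distrib, ← Finset.mul_sum]
      ring
    · rw [hφ.eq_zero hq]
      simp
  -- Integrability is read off from `hdiv`, whose left side is a sum of continuous compactly
  -- supported terms.
  have hGi : Integrable (fun q => -(G q * velocity Ω u q) * φ q) := by
    refine (hi2.sub (integrable_finsetSum Finset.univ fun j _ => (hj j).2.1)).congr
      (Eventually.of_forall fun q => ?_)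
    simp only [Pi.sub_apply]
    exact hdiv q
  simp_rw [hflux]
  rw [integral_add (f := fun q => w q * fderiv ℝ φ q τ -
    ∑ j, fderiv ℝ u q τ * fderiv ℝ u q (e j) * fderiv ℝ φ q (e j))
    (hi1.sub (integrable_finsetSum Finset.univ fun j _ => (hj j).1)) hGi,
    integral_sub hi1 (integrable_finsetSum Finset.univ fun j _ => (hj j).1),
    integral_finsetSum _ fun j _ => (hj j).1]
  simp_rw [← hdiv]
  rw [integral_sub hi2 (integrable_finsetSum Finset.univ fun j _ => (hj j).2.1),
    integral_finsetSum _ fun j _ => (hj j).2.1, hi3]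
  simp_rw [fun j => (hj j).2.2]
  rw [Finset.sum_neg_distrib]
  ring

end IsClassicalSolution

/-! ### Continuity of the tangential derivatives across a front -/

namespace IsClassicalSolution

variable {N : ℕ} {c : ℝ} {Ω : Set (Space N)} {G : SpaceTime N → ℝ} {u₀ v₀ : Space N → ℝ}
  {uS p : Space N → ℝ → ℝ} {F : ℕ → Set (SpaceTime N)} {Z : Set (SpaceTime N)}
  {u : SpaceTime N → ℝ}

variable (hu : IsClassicalSolution c Ω G u₀ v₀ uS p F Z u)
include hu

/-- A mean value inequality: along a timelike segment `u` is continuous and is differentiable off a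
countable set, so it is the integral of its derivative. The covector `a` is the reference value of
that derivative. -/
lemma abs_sub_le_of_timelike (hΩ : IsOpen Ω) {q d : SpaceTime N} (hd : ‖d.1‖ < c * |d.2|)
    (hseg : ∀ s ∈ Icc (0 : ℝ) 1, q + s • d ∈ openCylinder Ω \ Z) {a : SpaceTime N →L[ℝ] ℝ} {ε : ℝ}
    (hε : ∀ s ∈ Icc (0 : ℝ) 1, q + s • d ∉ Z ∪ ⋃ k, F k → ‖cylDeriv Ω u (q + s • d) - a‖ ≤ ε) :
    |u (q + d) - u q - a d| ≤ ε * ‖d‖ := by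
  set S : Set ℝ := {s ∈ Icc (0 : ℝ) 1 | q + s • d ∈ Z ∪ ⋃ k, F k} with hS_def
  have hS : S.Countable := hu.countable_timelike hd fun s hs => (hseg s hs).2
  have hline : ∀ s : ℝ, HasDerivAt (fun s : ℝ => q + s • d) d s := fun s => by
    simpa using ((hasDerivAt_id s).smul_const d).const_add q
  have hcont : Continuous fun s : ℝ => q + s • d := by fun_prop
  have hSm : MeasurableSet S :=
    (isClosed_Icc.inter (hu.isClosed_singular.preimage hcont)).measurableSet
  set f' : ℝ → ℝ := fun s => (cylDeriv Ω u (q + s • d) - a) d with hf'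
  have hmaps : MapsTo (fun s : ℝ => q + s • d) (Icc 0 1 \ S)
      (closedCylinder Ω \ (Z ∪ ⋃ k, F k)) := fun s hs =>
    ⟨openCylinder_subset_closedCylinder (hseg s hs.1).1, fun h => hs.2 ⟨hs.1, h⟩⟩
  have hbound : ∀ s ∈ Icc (0 : ℝ) 1 \ S, ‖f' s‖ ≤ ε * ‖d‖ := by
    intro s hs
    refine ((cylDeriv Ω u (q + s • d) - a).le_opNorm d).trans ?_
    exact mul_le_mul_of_nonneg_right (hε s hs.1 fun h => hs.2 ⟨hs.1, h⟩) (norm_nonneg _)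
  have haeS : ∀ᵐ s, s ∉ S := measure_eq_zero_iff_ae_notMem.1 (hS.measure_zero volume)
  have hint : IntegrableOn f' (Icc 0 1) := by
    have h1 : AEStronglyMeasurable f' (volume.restrict (Icc 0 1)) := by
      rw [← Measure.restrict_congr_set (sdiff_null_ae_eq_self (s := Icc (0 : ℝ) 1)
        (hS.measure_zero volume))]
      refine ContinuousOn.aestronglyMeasurable ?_ (measurableSet_Icc.diff hSm)
      exact ((hu.continuousOn_deriv.comp hcont.continuousOn hmaps).sub continuousOn_const).clm_apply
        continuousOn_const
    refine (integrableOn_const (C := ε * ‖d‖) (by simp)).mono' h1 ?_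
    rw [ae_restrict_iff' measurableSet_Icc]
    filter_upwards [haeS] with s hs hs'
    exact hbound s ⟨hs', hs⟩
  have hFTC := MeasureTheory.integral_eq_of_hasDerivAt_off_countable_of_le
    (fun s : ℝ => u (q + s • d) - s * a d) f' zero_le_one hS ?_ ?_ ?_
  · have h1 : ‖∫ s in (0 : ℝ)..1, f' s‖ ≤ ε * ‖d‖ * |1 - 0| := by
      refine intervalIntegral.norm_integral_le_of_norm_le_const_ae ?_
      filter_upwards [haeS] with s hs hs'
      rw [uIoc_of_le zero_le_one] at hs'
      exact hbound s ⟨Ioc_subset_Icc_self hs', hs⟩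
    rw [hFTC] at h1
    simp only [one_smul, zero_smul, add_zero, one_mul, zero_mul, sub_zero, abs_one, mul_one] at h1
    rw [← Real.norm_eq_abs]
    convert h1 using 2
    ring
  · refine ContinuousOn.sub ?_ (by fun_prop)
    exact hu.continuousOn.comp hcont.continuousOn fun s hs =>
      openCylinder_subset_closedCylinder (hseg s hs).1
  · intro s hs
    have hs' := Ioo_subset_Icc_self hs.1
    have h1 : HasDerivAt (fun s : ℝ => u (q + s • d)) (cylDeriv Ω u (q + s • d) d) s :=
      (hu.hasFDerivAt hΩ ⟨(hseg s hs').1, fun h => hs.2 ⟨hs', h⟩⟩).comp_hasDerivAt s (hline s)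
    have h2 := h1.sub ((hasDerivAt_id s).mul_const (a d))
    exact h2.congr_deriv (by simp [hf'])
  · exact (intervalIntegrable_iff_integrableOn_Icc_of_le zero_le_one).2 hint

/-- Expansion of `u` at a point of a front, in directions pointing strictly to the side `g < 0`. -/
lemma eventually_abs_sub_le (hΩ : IsOpen Ω) (hc : 0 < c) {q : SpaceTime N}
    (hq : q ∈ openCylinder Ω \ Z) (hqS : q ∈ Z ∪ ⋃ k, F k) {g : SpaceTime N → ℝ}
    {g' : SpaceTime N →L[ℝ] ℝ} (hg : HasFDerivAt g g' q) (hg0 : g q = 0)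
    {a : SpaceTime N →L[ℝ] ℝ}
    (ha : Tendsto (cylDeriv Ω u) (𝓝[{x | g x < 0} \ (Z ∪ ⋃ k, F k)] q) (𝓝 a))
    (hZ : IsClosed Z) {e : SpaceTime N} (he1 : e.1 = 0) (he2 : e.2 ≠ 0) (hge : g' e < 0)
    {τ : SpaceTime N} (hτ : g' τ = 0) {δ : ℝ} (hδ : 0 < δ) {ε : ℝ} (hε : 0 < ε) :
    ∀ᶠ h in 𝓝[>] (0 : ℝ), |u (q + h • (τ + δ • e)) - u q - h * a (τ + δ • e)| ≤ ε * h := by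
  have he2' : 0 < c * |e.2| := mul_pos hc (abs_pos.2 he2)
  -- The direction `τ` may be spacelike; adding a large multiple of `e` makes it timelike.
  obtain ⟨Λ, hΛδ, hΛ⟩ : ∃ Λ, δ < Λ ∧ ‖τ.1‖ + c * |τ.2| < Λ * (c * |e.2|) := by
    refine ⟨max (δ + 1) ((‖τ.1‖ + c * |τ.2|) / (c * |e.2|) + 1), ?_, ?_⟩
    · exact (lt_add_one δ).trans_le (le_max_left _ _)
    · rw [← div_lt_iff₀ he2']
      exact (lt_add_one _).trans_le (le_max_right _ _)
  have hΛ0 : 0 < Λ := hδ.trans hΛδ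
  set R : ℝ := ‖τ‖ + Λ * ‖e‖ + 1 with hR
  have hR0 : 0 < R := by positivity
  -- For `ρ` between `δ` and `Λ`, `g' (τ + ρ • e) = ρ * g' e ≤ -κ * R`, and `R` bounds the norm of
  -- the vector: these directions lie in a cone on which `g` is negative near `q`.
  set κ : ℝ := δ * (-g' e) / R with hκ
  have hκ0 : 0 < κ := by
    have : 0 < -g' e := by linarith
    positivity
  obtain ⟨r₁, hr₁, h1⟩ := Metric.eventually_nhds_iff.1
    (hg.isLittleO.def (show 0 < κ / 2 by positivity))
  -- Two segments of length at most `h * R` will be used, hence `ε / (2 * R)`.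
  obtain ⟨r₂, hr₂, h2⟩ := Metric.tendsto_nhdsWithin_nhds.1 ha (ε / (2 * R)) (by positivity)
  obtain ⟨r₃, hr₃, h3⟩ := Metric.isOpen_iff.1 ((isOpen_openCylinder hΩ).sdiff hZ) q hq
  set r := min r₁ (min r₂ r₃) with hr
  have hr0 : 0 < r := lt_min hr₁ (lt_min hr₂ hr₃)
  have hkey : ∀ y : SpaceTime N, g' y ≤ -κ * ‖y‖ → ‖y‖ < r → q + y ∉ Z ∪ ⋃ k, F k →
      ‖cylDeriv Ω u (q + y) - a‖ ≤ ε / (2 * R) := by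
    intro y hy hyr hyS
    have hy0 : 0 < ‖y‖ := by
      rw [norm_pos_iff]
      rintro rfl
      rw [add_zero] at hyS
      exact hyS hqS
    have hd : dist (q + y) q = ‖y‖ := by simp
    have h4 := h1 (y := q + y) (by rw [hd]; exact hyr.trans_le (min_le_left _ _))
    rw [hg0, sub_zero, add_sub_cancel_left, Real.norm_eq_abs] at h4
    have h5 : g (q + y) < 0 := by nlinarith [(abs_le.1 h4).2]
    have h6 := h2 (x := q + y) ⟨h5, hyS⟩ (by
      rw [hd]; exact hyr.trans_le ((min_le_right _ _).trans (min_le_left _ _)))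
    rw [dist_eq_norm] at h6
    exact h6.le
  have hopen : ∀ y : SpaceTime N, ‖y‖ < r → q + y ∈ openCylinder Ω \ Z := fun y hy =>
    h3 (by rw [Metric.mem_ball]; simpa using hy.trans_le ((min_le_right _ _).trans (min_le_right _ _)))
  have hsmall : ∀ᶠ h in 𝓝[>] (0 : ℝ), h * R < r := by
    have : Tendsto (fun h : ℝ => h * R) (𝓝 0) (𝓝 0) :=
      (continuous_id.mul continuous_const).tendsto' 0 0 (by simp)
    exact nhdsWithin_le_nhds (this.eventually (gt_mem_nhds hr0))
  filter_upwards [hsmall, self_mem_nhdsWithin] with h hhr hh0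
  have hh : 0 < h := hh0
  have hnorm : ∀ ρ ∈ Icc 0 Λ, ‖τ + ρ • e‖ ≤ R := by
    intro ρ hρ
    have h4 := norm_add_le τ (ρ • e)
    rw [norm_smul, Real.norm_of_nonneg hρ.1] at h4
    have h5 := mul_le_mul_of_nonneg_right hρ.2 (norm_nonneg e)
    rw [hR]
    linarith
  have hcone : ∀ s : ℝ, 0 ≤ s → s ≤ 1 → ∀ ρ ∈ Icc δ Λ, g' ((s * h) • (τ + ρ • e)) ≤
      -κ * ‖(s * h) • (τ + ρ • e)‖ ∧ ‖(s * h) • (τ + ρ • e)‖ < r := by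
    intro s hs0 hs1 ρ hρ
    have h4 := hnorm ρ ⟨hδ.le.trans hρ.1, hρ.2⟩
    have hsh : 0 ≤ s * h := by positivity
    rw [norm_smul, Real.norm_of_nonneg hsh, map_smul, map_add, hτ, map_smul, zero_add,
      smul_eq_mul, smul_eq_mul]
    constructor
    · have h5 : κ * ‖τ + ρ • e‖ ≤ δ * (-g' e) := by
        calc κ * ‖τ + ρ • e‖ ≤ κ * R := by gcongr
          _ = δ * (-g' e) := by rw [hκ]; field_simp
      have h6 : δ * (-g' e) ≤ ρ * (-g' e) := mul_le_mul_of_nonneg_right hρ.1 (by linarith)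
      nlinarith
    · have h7 : s * h ≤ h := by nlinarith
      calc s * h * ‖τ + ρ • e‖ ≤ h * R := by gcongr
        _ < r := hhr
  -- The target is reached by two timelike segments inside the cone: out along `τ + Λ • e`, then
  -- back along `e`.
  have hseg1 := hu.abs_sub_le_of_timelike hΩ (q := q) (d := h • (τ + Λ • e)) (a := a)
    (ε := ε / (2 * R)) ?_ ?_ ?_
  · have hseg2 := hu.abs_sub_le_of_timelike hΩ (q := q + h • (τ + Λ • e))
      (d := (h * (δ - Λ)) • e) (a := a) (ε := ε / (2 * R)) ?_ ?_ ?_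
    · have hpt : q + h • (τ + Λ • e) + (h * (δ - Λ)) • e = q + h • (τ + δ • e) := by module
      rw [hpt] at hseg2
      have hn1 : ‖h • (τ + Λ • e)‖ ≤ h * R := by
        rw [norm_smul, Real.norm_of_nonneg hh.le]
        exact mul_le_mul_of_nonneg_left (hnorm Λ ⟨hΛ0.le, le_rfl⟩) hh.le
      have hn2 : ‖(h * (δ - Λ)) • e‖ ≤ h * R := by
        rw [norm_smul, norm_mul, Real.norm_of_nonneg hh.le, mul_assoc]
        refine mul_le_mul_of_nonneg_left ?_ hh.le
        rw [Real.norm_eq_abs, abs_of_neg (by linarith), hR]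
        nlinarith [norm_nonneg e, norm_nonneg τ]
      have hsum : h * a (τ + δ • e) = a (h • (τ + Λ • e)) + a ((h * (δ - Λ)) • e) := by
        rw [← map_add, ← smul_eq_mul, ← map_smul]
        congr 1
        module
      have h8 : ε / (2 * R) * (h * R) + ε / (2 * R) * (h * R) = ε * h := by field_simp; ring
      have h9 : 0 ≤ ε / (2 * R) := by positivity
      have h10 := mul_le_mul_of_nonneg_left hn1 h9
      have h11 := mul_le_mul_of_nonneg_left hn2 h9
      rw [hsum]
      rw [abs_le] at hseg1 hseg2 ⊢
      constructor <;> linarith [hseg1.1, hseg1.2, hseg2.1, hseg2.2]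
    · rw [Prod.smul_fst, Prod.smul_snd, he1, smul_zero, norm_zero, smul_eq_mul]
      have h4 : h * (δ - Λ) * e.2 ≠ 0 := mul_ne_zero (mul_ne_zero hh.ne' (by linarith)) he2
      exact mul_pos hc (abs_pos.2 h4)
    · intro s hs
      have hpt : q + h • (τ + Λ • e) + s • (h * (δ - Λ)) • e =
          q + (1 * h) • (τ + (Λ + s * (δ - Λ)) • e) := by module
      rw [hpt]
      exact hopen _ (hcone 1 zero_le_one le_rfl _
        ⟨by nlinarith [hs.1, hs.2], by nlinarith [hs.1, hs.2]⟩).2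
    · intro s hs
      have hpt : q + h • (τ + Λ • e) + s • (h * (δ - Λ)) • e =
          q + (1 * h) • (τ + (Λ + s * (δ - Λ)) • e) := by module
      rw [hpt]
      have h4 := hcone 1 zero_le_one le_rfl (Λ + s * (δ - Λ))
        ⟨by nlinarith [hs.1, hs.2], by nlinarith [hs.1, hs.2]⟩
      exact hkey _ h4.1 h4.2
  · rw [Prod.smul_fst, Prod.smul_snd, norm_smul, Prod.fst_add, Prod.snd_add, Prod.smul_fst,
      Prod.smul_snd, he1, smul_zero, add_zero, smul_eq_mul, smul_eq_mul, abs_mul, Real.norm_eq_abs]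
    have h4 : Λ * |e.2| - |τ.2| ≤ |τ.2 + Λ * e.2| := by
      have := abs_sub_abs_le_abs_sub (Λ * e.2) (-τ.2)
      rw [abs_mul, abs_of_pos hΛ0, abs_neg, sub_neg_eq_add, add_comm (Λ * e.2)] at this
      exact this
    have h5 : 0 < |h| := abs_pos.2 hh.ne'
    have h6 := mul_le_mul_of_nonneg_left h4 hc.le
    have h7 : ‖τ.1‖ < c * |τ.2 + Λ * e.2| := by linarith
    have h8 := mul_lt_mul_of_pos_left h7 h5
    linarith
  · intro s hs
    rw [smul_smul]
    exact hopen _ (hcone s hs.1 hs.2 Λ ⟨hΛδ.le, le_rfl⟩).2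
  · intro s hs
    rw [smul_smul]
    have h4 := hcone s hs.1 hs.2 Λ ⟨hΛδ.le, le_rfl⟩
    exact hkey _ h4.1 h4.2

/-- From `q`, move by `h * τ` and then by a small `h * δ` to either side of the front. Each end
point has a first-order expansion with the one-sided derivative, and the two end points are joined
by a time segment of length `2 * h * δ`, on which `u` varies little because its derivatives are
bounded. Let `h` and then `δ` tend to zero. -/
lemma tangential_eq (hΩ : IsOpen Ω) (hc : 0 < c) {k : ℕ} {q : SpaceTime N} (hqF : q ∈ F k)
    (hqZ : q ∉ Z) {f : SpaceTime N → ℝ} (hf : IsFrontEquation c (F k) q f)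
    {a₁ a₂ : SpaceTime N →L[ℝ] ℝ}
    (ha₁ : Tendsto (cylDeriv Ω u) (𝓝[{x | 0 < f x} \ (Z ∪ ⋃ k, F k)] q) (𝓝 a₁))
    (ha₂ : Tendsto (cylDeriv Ω u) (𝓝[{x | f x < 0} \ (Z ∪ ⋃ k, F k)] q) (𝓝 a₂))
    {τ : SpaceTime N} (hτ : fderiv ℝ f q τ = 0) : a₁ τ = a₂ τ := by
  have hq : q ∈ openCylinder Ω \ Z := ⟨hu.front_subset k hqF, hqZ⟩
  have hqS : q ∈ Z ∪ ⋃ k, F k := Or.inr (mem_iUnion.2 ⟨k, hqF⟩)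
  have hZ := hu.isClosed_exceptional
  set e : SpaceTime N := (0, 1) with he
  have hen : ‖e‖ = 1 := by simp [he, Prod.norm_def]
  have hfe : fderiv ℝ f q e < 0 := hf.fderiv_time_neg hc
  have hfd := hf.differentiableAt.hasFDerivAt
  -- All points used below lie within distance 1 of `q`, so this bound applies to them.
  obtain ⟨M, hM⟩ := hu.bounded_deriv (q.2 + 1)
  obtain ⟨r, hr, hball⟩ := Metric.isOpen_iff.1 ((isOpen_openCylinder hΩ).sdiff hZ) q hq
  -- The summands come from the two expansion errors, the joining time segment, and the values of
  -- `a₁` and `a₂` on `δ • e`.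
  set K : ℝ := 2 + 2 * |M| + ‖a₁‖ + ‖a₂‖ with hK
  have hK0 : 0 < K := by positivity
  have main : ∀ δ > 0, |a₁ τ - a₂ τ| ≤ K * δ := by
    intro δ hδ
    have e1 := hu.eventually_abs_sub_le hΩ hc hq hqS hfd (hf.eq_zero hqF) ha₂ hZ (e := e) rfl
      one_ne_zero hfe hτ hδ hδ
    have hset : {x : SpaceTime N | -f x < 0} = {x | 0 < f x} := by ext x; simp
    have e2 := hu.eventually_abs_sub_le hΩ hc hq hqS (g := fun x => -f x) hfd.neg
      (by rw [hf.eq_zero hqF, neg_zero]) (by rw [hset]; exact ha₁) hZ (e := -e) (by simp [he])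
      (by simp [he]) (by simpa using hfe) (τ := τ) (by simpa using hτ) hδ hδ
    have e3 : ∀ᶠ h in 𝓝[>] (0 : ℝ), h * (‖τ‖ + δ) < min r 1 := by
      have : Tendsto (fun h : ℝ => h * (‖τ‖ + δ)) (𝓝 0) (𝓝 0) :=
        (continuous_id.mul continuous_const).tendsto' 0 0 (by simp)
      exact nhdsWithin_le_nhds (this.eventually (gt_mem_nhds (lt_min hr one_pos)))
    obtain ⟨h, ⟨⟨h1, h2⟩, h3⟩, hh0⟩ := (((e1.and e2).and e3).and
      (self_mem_nhdsWithin (s := Ioi (0 : ℝ)))).exists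
    have hh : 0 < h := hh0
    have hn : ∀ s ∈ Icc (0 : ℝ) 1,
        ‖h • (τ + δ • -e) + s • (2 * h * δ) • e‖ < min r 1 := by
      intro s hs
      have hpt : h • (τ + δ • -e) + s • (2 * h * δ) • e = h • (τ + ((2 * s - 1) * δ) • e) := by
        module
      rw [hpt, norm_smul, Real.norm_of_nonneg hh.le]
      refine lt_of_le_of_lt (mul_le_mul_of_nonneg_left ?_ hh.le) h3
      refine (norm_add_le _ _).trans (add_le_add le_rfl ?_)
      rw [norm_smul, hen, mul_one, norm_mul, Real.norm_of_nonneg hδ.le, Real.norm_eq_abs]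
      refine mul_le_of_le_one_left hδ.le (abs_le.2 ⟨?_, ?_⟩) <;> linarith [hs.1, hs.2]
    have hmem : ∀ s ∈ Icc (0 : ℝ) 1, q + h • (τ + δ • -e) + s • (2 * h * δ) • e ∈
        Metric.ball q (min r 1) := by
      intro s hs
      rw [Metric.mem_ball, add_assoc, dist_self_add_left]
      exact hn s hs
    -- With reference covector zero this is the Lipschitz bound across the front.
    have h4 := hu.abs_sub_le_of_timelike hΩ (q := q + h • (τ + δ • -e)) (d := (2 * h * δ) • e)
      (a := 0) (ε := |M|) ?_ ?_ ?_
    · have hpt : q + h • (τ + δ • -e) + (2 * h * δ) • e = q + h • (τ + δ • e) := by module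
      rw [hpt, norm_smul, hen, mul_one, Real.norm_of_nonneg (by positivity), zero_apply,
        sub_zero] at h4
      have h5 : |a₁ (τ + δ • -e) - a₂ (τ + δ • e)| * h ≤ (2 * δ + 2 * |M| * δ) * h := by
        rw [← abs_of_pos hh, ← abs_mul, abs_of_pos hh]
        rw [abs_le] at h1 h2 h4 ⊢
        constructor <;> nlinarith [h1.1, h1.2, h2.1, h2.2, h4.1, h4.2]
      have h6 := le_of_mul_le_mul_right h5 hh
      have h7 : a₁ (τ + δ • -e) - a₂ (τ + δ • e) = a₁ τ - a₂ τ - δ * (a₁ e + a₂ e) := by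
        simp only [map_add, map_smul, map_neg, smul_eq_mul]
        ring
      rw [h7] at h6
      have h8 : |a₁ e + a₂ e| ≤ ‖a₁‖ + ‖a₂‖ := by
        refine (abs_add_le _ _).trans (add_le_add ?_ ?_)
        · simpa [hen] using a₁.le_opNorm e
        · simpa [hen] using a₂.le_opNorm e
      have h9 : |δ * (a₁ e + a₂ e)| ≤ δ * (‖a₁‖ + ‖a₂‖) := by
        rw [abs_mul, abs_of_pos hδ]
        exact mul_le_mul_of_nonneg_left h8 hδ.le
      have h10 := abs_sub_abs_le_abs_sub (a₁ τ - a₂ τ) (δ * (a₁ e + a₂ e))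
      rw [hK]
      nlinarith
    · have : (0 : ℝ) < 2 * h * δ := by positivity
      simp only [he, Prod.smul_fst, Prod.smul_snd, smul_zero, norm_zero, smul_eq_mul, mul_one]
      exact mul_pos hc (abs_pos.2 this.ne')
    · intro s hs
      exact hball (Metric.ball_subset_ball (min_le_left _ _) (hmem s hs))
    · intro s hs hsS
      rw [sub_zero]
      have h5 := hmem s hs
      refine (hM _ ⟨openCylinder_subset_closedCylinder
        (hball (Metric.ball_subset_ball (min_le_left _ _) h5)).1, hsS⟩ ?_).trans (le_abs_self M)
      have h6 : dist (q + h • (τ + δ • -e) + s • (2 * h * δ) • e).2 q.2 < 1 :=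
        lt_of_le_of_lt (le_max_right _ _) (lt_of_lt_of_le h5 (min_le_right _ _))
      rw [Real.dist_eq] at h6
      linarith [(abs_lt.1 h6).2]
  have h0 : |a₁ τ - a₂ τ| ≤ 0 := by
    refine le_of_forall_pos_le_add fun ε hε => ?_
    have := main (ε / K) (by positivity)
    rw [mul_div_cancel₀ _ hK0.ne'] at this
    linarith
  exact sub_eq_zero.1 (abs_nonpos_iff.1 h0)

end IsClassicalSolution

/-! ### The balance of energy across the fronts -/

lemma HasDerivAt.eventually_pos_right {g : ℝ → ℝ} {g' : ℝ} (hg : HasDerivAt g g' 0) (h0 : g 0 = 0)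
    (hg' : 0 < g') : ∀ᶠ r in 𝓝[>] (0 : ℝ), 0 < g r := by
  filter_upwards [hg.tendsto_slope_zero_right.eventually (lt_mem_nhds hg'),
    self_mem_nhdsWithin] with r hr hr0
  rw [zero_add, h0, sub_zero, smul_eq_mul] at hr
  exact (pos_iff_pos_of_mul_pos hr).1 (inv_pos.2 hr0)

namespace IsClassicalSolution

variable {N : ℕ} {c : ℝ} {Ω : Set (Space N)} {G : SpaceTime N → ℝ} {u₀ v₀ : Space N → ℝ}
  {uS p : Space N → ℝ → ℝ} {F : ℕ → Set (SpaceTime N)} {Z : Set (SpaceTime N)}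
  {u : SpaceTime N → ℝ}

section

variable (hu : IsClassicalSolution c Ω G u₀ v₀ uS p F Z u)
include hu

/-- The two one-sided derivatives differ by a multiple of the conormal of the front, and this
multiple does not enter the energy flux through a characteristic surface, so both sides have the
same limit. -/
lemma exists_conormal_limit (hΩ : IsOpen Ω) (hc : 0 < c) {k : ℕ} {γ : Space N → ℝ} {y : Space N}
    (hγ : DifferentiableAt ℝ γ y) (hmem : ∀ᶠ x in 𝓝 y, (x, γ x) ∈ F k) (hyZ : (y, γ y) ∉ Z) :
    ∃ l, Tendsto (fun r => (energyFluxField c Ω u (y, γ y + r)).2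
        - fderiv ℝ γ y (energyFluxField c Ω u (y, γ y + r)).1)
        (𝓝[{r | 0 < r ∧ (y, γ y + r) ∉ Z ∪ ⋃ k, F k}] 0) (𝓝 l) ∧
      Tendsto (fun r => (energyFluxField c Ω u (y, γ y - r)).2
        - fderiv ℝ γ y (energyFluxField c Ω u (y, γ y - r)).1)
        (𝓝[{r | 0 < r ∧ (y, γ y - r) ∉ Z ∪ ⋃ k, F k}] 0) (𝓝 l) := by
  have hyF : (y, γ y) ∈ F k := hmem.self_of_nhds
  obtain ⟨f, hf⟩ := hu.isWaveFront k _ hyF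
  obtain ⟨-, -, a₁, a₂, -, -, ha₁, ha₂, -, -⟩ := hu.hadamard k _ ⟨hyF, hyZ⟩ f hf
  set m := spaceGradient f (y, γ y) with hm
  have hm0 : m ≠ 0 := hf.gradient_ne_zero
  have hmn : ‖m‖ ≠ 0 := norm_ne_zero_iff.2 hm0
  have hfe := hf.fderiv_time_neg hc
  have hfd := hf.differentiableAt.hasFDerivAt
  -- Differentiation of `f (x, γ x) = 0`: the front moves with speed `c` in the direction of `m`.
  have hgraph : ∀ v, fderiv ℝ γ y v = (c * ‖m‖)⁻¹ * inner ℝ m v := by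
    intro v
    have h1 : HasFDerivAt (fun x => f (x, γ x)) _ y :=
      HasFDerivAt.comp y (f := fun x => (x, γ x)) hfd ((hasFDerivAt_id y).prodMk hγ.hasFDerivAt)
    have h2 : (fun x => f (x, γ x)) =ᶠ[𝓝 y] fun _ => 0 := by
      have hcont : ContinuousAt (fun x => (x, γ x)) y := continuousAt_id.prodMk hγ.continuousAt
      filter_upwards [hmem, hcont.eventually hf.mem_iff] with x hx1 hx2 using hx2.1 hx1
    have h3 := h1.unique ((hasFDerivAt_const (0 : ℝ) y).congr_of_eventuallyEq h2)
    have h4 := congrArg (fun B : Space N →L[ℝ] ℝ => B v) h3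
    simp only [ContinuousLinearMap.comp_apply, zero_apply] at h4
    rw [hf.fderiv_apply] at h4
    simp only [ContinuousLinearMap.prod_apply, ContinuousLinearMap.id_apply] at h4
    rw [← hm] at h4
    field_simp
    linarith
  -- The difference of `a₁` and `a₂` vanishes on the kernel of the conormal; its coefficient is
  -- found in the time direction, which is transversal to the front.
  set lam := (a₁ (0, 1) - a₂ (0, 1)) / fderiv ℝ f (y, γ y) (0, 1) with hlam
  have hjump : ∀ v, a₁ v = a₂ v + lam * fderiv ℝ f (y, γ y) v := by
    intro v
    have h1 := hu.tangential_eq hΩ hc hyF hyZ hf ha₁ ha₂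
      (τ := v - (fderiv ℝ f (y, γ y) v / fderiv ℝ f (y, γ y) (0, 1)) • ((0 : Space N), (1 : ℝ)))
      (by rw [map_sub, map_smul, smul_eq_mul, div_mul_cancel₀ _ hfe.ne, sub_self])
    rw [map_sub, map_sub, map_smul, map_smul, smul_eq_mul, smul_eq_mul] at h1
    rw [hlam]
    have := hfe.ne
    field_simp
    field_simp at h1
    linarith
  have hflux := conormal_energyFlux_add hc.ne' a₂ m lam a₁
    (by rw [hjump, hf.fderiv_apply]; simp [← hm]; ring)
    (fun v => by rw [hjump, hf.fderiv_apply]; simp [← hm]) hm0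
  set conorm : (SpaceTime N →L[ℝ] ℝ) → ℝ := fun a =>
    (energyFlux c a).2 - fderiv ℝ γ y (energyFlux c a).1 with hconorm
  have hcc : Continuous conorm := by
    have h1 : Continuous (energyFlux (N := N) c) := continuous_energyFlux
    exact h1.snd.sub ((fderiv ℝ γ y).continuous.comp h1.fst)
  have heq : conorm a₁ = conorm a₂ := by
    simp only [hconorm, hgraph]
    exact hflux
  have hline : ∀ σ : ℝ, HasDerivAt (fun r : ℝ => f (y, γ y + σ * r))
      (σ * fderiv ℝ f (y, γ y) (0, 1)) 0 := by
    intro σ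
    have h1 : HasDerivAt (fun r : ℝ => (y, γ y + σ * r)) ((0 : Space N), σ) 0 := by
      have := ((hasDerivAt_id (0 : ℝ)).const_mul σ).const_add (γ y)
      exact (hasDerivAt_const (0 : ℝ) y).prodMk (by simpa using this)
    have h2 : HasFDerivAt f (fderiv ℝ f (y, γ y)) ((fun r : ℝ => (y, γ y + σ * r)) 0) := by
      simpa using hfd
    refine (h2.comp_hasDerivAt 0 h1).congr_deriv ?_
    rw [← smul_eq_mul, ← map_smul]
    simp
  have hcontσ : ∀ σ : ℝ, Tendsto (fun r : ℝ => (y, γ y + σ * r)) (𝓝 0) (𝓝 (y, γ y)) := fun σ =>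
    (by fun_prop : Continuous fun r : ℝ => (y, γ y + σ * r)).tendsto' 0 _ (by simp)
  -- `f` decreases in time, so points later than the front lie on the side `f < 0`, where the limit
  -- is `a₂`.
  refine ⟨conorm a₂, ?_, ?_⟩
  · refine (hcc.tendsto a₂).comp (ha₂.comp ?_)
    refine tendsto_nhdsWithin_iff.2 ⟨?_, ?_⟩
    · simpa using (hcontσ 1).mono_left nhdsWithin_le_nhds
    · have h1 : ∀ᶠ r in 𝓝[>] (0 : ℝ), f (y, γ y + 1 * r) < 0 := by
        have h2 := (hline 1).neg.eventually_pos_right (by simpa using hf.eq_zero hyF)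
          (by simpa using hfe)
        filter_upwards [h2] with r hr using neg_pos.1 hr
      filter_upwards [h1.filter_mono (nhdsWithin_mono 0 fun r (hr : 0 < r ∧ _) => hr.1),
        self_mem_nhdsWithin] with r hr1 hr2
      exact ⟨by simpa using hr1, hr2.2⟩
  · rw [← heq]
    refine (hcc.tendsto a₁).comp (ha₁.comp ?_)
    refine tendsto_nhdsWithin_iff.2 ⟨?_, ?_⟩
    · simpa [sub_eq_add_neg] using (hcontσ (-1)).mono_left nhdsWithin_le_nhds
    · have h1 : ∀ᶠ r in 𝓝[>] (0 : ℝ), 0 < f (y, γ y + -1 * r) :=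
        (hline (-1)).eventually_pos_right (by simpa using hf.eq_zero hyF) (by simpa using hfe)
      filter_upwards [h1.filter_mono (nhdsWithin_mono 0 fun r (hr : 0 < r ∧ _) => hr.1),
        self_mem_nhdsWithin] with r hr1 hr2
      exact ⟨by simpa [sub_eq_add_neg] using hr1, hr2.2⟩

end

end IsClassicalSolution

/-! ### Weak divergence across a graph -/

section Crossing

variable {Y : Type*} [NormedAddCommGroup Y] [NormedSpace ℝ Y] [FiniteDimensional ℝ Y]
  [MeasurableSpace Y] [BorelSpace Y]

/-- The divergence theorem is applied above and below the graph. The traces agree while the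
conormals are opposite, so the surface terms cancel. -/
theorem IsWeakDiv.of_graph {ν : Measure Y} [SFinite ν] [IsFiniteMeasureOnCompacts ν]
    {W : Set Y} (hW : IsOpen W) {γ : Y → ℝ} (hγ : ContDiffOn ℝ 1 γ W) {A : Set (Y × ℝ)}
    (hA : IsOpen A) (hAW : ∀ q ∈ A, q.1 ∈ W) {V : Y × ℝ → Y × ℝ} {h : Y × ℝ → ℝ}
    (hdiv : IsWeakDiv (ν.prod volume) V h {q ∈ A | q.2 ≠ γ q.1}) {M : ℝ}
    (hVM : ∀ᵐ q ∂ν.prod volume, q ∈ A → ‖V q‖ ≤ M)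
    (hV : IntegrableOn V A (ν.prod volume)) (hh : IntegrableOn h A (ν.prod volume))
    {N : Set (Y × ℝ)} (hN : ν.prod volume N = 0)
    (hgr : ν.prod volume {q ∈ A | q.2 = γ q.1} = 0)
    (hl : ∀ᵐ y ∂ν, y ∈ W → (y, γ y) ∈ A → ∃ l,
      Tendsto (fun r => (V (y, γ y + r)).2 - fderiv ℝ γ y (V (y, γ y + r)).1)
        (𝓝[{r | 0 < r ∧ (y, γ y + r) ∉ N}] 0) (𝓝 l) ∧
      Tendsto (fun r => (V (y, γ y - r)).2 - fderiv ℝ γ y (V (y, γ y - r)).1)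
        (𝓝[{r | 0 < r ∧ (y, γ y - r) ∉ N}] 0) (𝓝 l)) :
    IsWeakDiv (ν.prod volume) V h A := by
  classical
  intro φ hφ
  set μ := ν.prod (volume : Measure ℝ) with hμ
  set Ap : Set (Y × ℝ) := {q ∈ A | γ q.1 < q.2} with hAp
  set Am : Set (Y × ℝ) := {q ∈ A | q.2 < γ q.1} with hAm
  -- The common limit is chosen as a function of `y`; where none exists the value 0 is immaterial,
  -- since this happens only on a null set of relevant points.
  set l : Y → ℝ := fun y => if hy : ∃ l,
      Tendsto (fun r => (V (y, γ y + r)).2 - fderiv ℝ γ y (V (y, γ y + r)).1)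
        (𝓝[{r | 0 < r ∧ (y, γ y + r) ∉ N}] 0) (𝓝 l) ∧
      Tendsto (fun r => (V (y, γ y - r)).2 - fderiv ℝ γ y (V (y, γ y - r)).1)
        (𝓝[{r | 0 < r ∧ (y, γ y - r) ∉ N}] 0) (𝓝 l) then hy.choose else 0 with hldef
  have hl' : ∀ᵐ y ∂ν, y ∈ W → (y, γ y) ∈ A →
      Tendsto (fun r => (V (y, γ y + r)).2 - fderiv ℝ γ y (V (y, γ y + r)).1)
        (𝓝[{r | 0 < r ∧ (y, γ y + r) ∉ N}] 0) (𝓝 (l y)) ∧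
      Tendsto (fun r => (V (y, γ y - r)).2 - fderiv ℝ γ y (V (y, γ y - r)).1)
        (𝓝[{r | 0 < r ∧ (y, γ y - r) ∉ N}] 0) (𝓝 (l y)) := by
    filter_upwards [hl] with y hy hyW hyA
    have := hy hyW hyA
    simp only [hldef, dif_pos this]
    exact this.choose_spec
  have hcγ : ContinuousOn (fun q : Y × ℝ => γ q.1) A :=
    hγ.continuousOn.comp continuous_fst.continuousOn hAW
  have hApo : IsOpen Ap := by
    have h1 : ContinuousOn (fun q : Y × ℝ => q.2 - γ q.1) A := continuous_snd.continuousOn.sub hcγ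
    have h2 := h1.isOpen_inter_preimage hA (isOpen_Ioi (a := (0 : ℝ)))
    convert h2 using 1
    ext q
    simp [hAp]
  have hAmo : IsOpen Am := by
    have h1 : ContinuousOn (fun q : Y × ℝ => q.2 - γ q.1) A := continuous_snd.continuousOn.sub hcγ
    have h2 := h1.isOpen_inter_preimage hA (isOpen_Iio (a := (0 : ℝ)))
    convert h2 using 1
    ext q
    simp [hAm]
  have hApA : Ap ⊆ A := fun q hq => hq.1
  have hAmA : Am ⊆ A := fun q hq => hq.1
  have h1 : ∫ q in Ap, (fderiv ℝ φ q (V q) + h q * φ q) ∂μ =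
      -∫ y in W, φ (y, γ y) * l y ∂ν := by
    refine integral_above_graph (ContinuousLinearEquiv.refl ℝ (Y × ℝ)) (MeasurePreserving.id _) hW
      hγ hA hAW rfl (hdiv.mono fun q hq => ⟨hq.1, hq.2.ne'⟩) (M := M) ?_ (hV.mono_set hApA)
      (hh.mono_set hApA) hN ?_ hφ
    · filter_upwards [hVM] with q hq hqA using hq (hApA hqA)
    · filter_upwards [hl'] with y hy hyW hyA using (hy hyW hyA).1
  have h2 : ∫ q in Am, (fderiv ℝ φ q (V q) + h q * φ q) ∂μ =
      -∫ y in W, φ (y, γ y) * (-l y) ∂ν := by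
    -- Reflecting the last coordinate turns the region below the graph into one above `-γ`.
    set Θ : (Y × ℝ) ≃L[ℝ] (Y × ℝ) :=
      (ContinuousLinearEquiv.refl ℝ Y).prodCongr (ContinuousLinearEquiv.neg ℝ) with hΘ
    have hΘa : ∀ q, Θ q = (q.1, -q.2) := fun q => rfl
    have hΘs : ∀ q, Θ.symm q = (q.1, -q.2) := fun q => rfl
    have key := integral_above_graph Θ (μ := μ) (ν := ν) (V := V) (h := h) (A := Am) (A₀ := A)
      (γ := fun y => -γ y) (W := W) (M := M) (N := N) (l := fun y => -l y) (φ := φ)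
      ((MeasurePreserving.id ν).prod (Measure.measurePreserving_neg volume))
      hW hγ.neg hA hAW ?_ (hdiv.mono fun q hq => ⟨hq.1, hq.2.ne⟩) ?_ (hV.mono_set hAmA)
      (hh.mono_set hAmA) hN ?_ hφ
    · simpa [hΘa] using key
    · ext q
      simp [hAm, hΘs]
    · filter_upwards [hVM] with q hq hqA using hq (hAmA hqA)
    · filter_upwards [hl'] with y hy hyW hyA
      simp only [hΘa, neg_neg] at hyA
      have h3 := (hy hyW hyA).2.neg
      have h4 : ∀ r : ℝ, Θ (y, -γ y + r) = (y, γ y - r) := fun r => by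
        rw [hΘa]; simp [sub_eq_add_neg, add_comm]
      simp only [h4, graphConormal_apply, hΘs]
      refine h3.congr fun r => ?_
      have h5 : fderiv ℝ (fun y => -γ y) y = -fderiv ℝ γ y := fderiv_fun_neg
      rw [h5]
      simp
      ring
  have hi : IntegrableOn (fun q => fderiv ℝ φ q (V q) + h q * φ q) A μ :=
    (hφ.integrableOn_flux hV).add (hφ.integrableOn_mul hh)
  have hdisj : Disjoint Ap Am := disjoint_left.2 fun q hq hq' => lt_asymm hq.2 hq'.2
  have hae : (Ap ∪ Am : Set (Y × ℝ)) =ᵐ[μ] A := by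
    refine (LE.le.eventuallyLE (union_subset hApA hAmA)).antisymm ?_
    filter_upwards [measure_eq_zero_iff_ae_notMem.1 hgr] with q hq hqA
    rcases lt_trichotomy q.2 (γ q.1) with h | h | h
    · exact Or.inr ⟨hqA, h⟩
    · exact absurd ⟨hqA, h⟩ hq
    · exact Or.inl ⟨hqA, h⟩
  have hsupp : ∫ q, (fderiv ℝ φ q (V q) + h q * φ q) ∂μ =
      ∫ q in A, (fderiv ℝ φ q (V q) + h q * φ q) ∂μ := by
    refine (setIntegral_eq_integral_of_forall_compl_eq_zero fun q hq => ?_).symm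
    rw [hφ.fderiv_eq_zero hq, hφ.eq_zero hq]
    simp
  rw [hsupp, ← setIntegral_congr_set hae, setIntegral_union hdisj hAmo.measurableSet
    (hi.mono_set hApA) (hi.mono_set hAmA), h1, h2]
  simp [integral_neg]

end Crossing

/-! ### Weak energy balance in the open cylinder. -/

namespace IsClassicalSolution

variable {N : ℕ} {c : ℝ} {Ω : Set (Space N)} {G : SpaceTime N → ℝ} {u₀ v₀ : Space N → ℝ}
  {uS p : Space N → ℝ → ℝ} {F : ℕ → Set (SpaceTime N)} {Z : Set (SpaceTime N)}
  {u : SpaceTime N → ℝ}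

section

variable (hu : IsClassicalSolution c Ω G u₀ v₀ uS p F Z u)
include hu

lemma ae_bound_energyFluxField (hc : 0 < c) (T : ℝ) :
    ∃ M, ∀ᵐ q, q ∈ closedCylinder Ω → q.2 ≤ T → ‖energyFluxField c Ω u q‖ ≤ M := by
  obtain ⟨M, hM⟩ := hu.ae_bound_cylDeriv hc T
  obtain ⟨M', hM'⟩ := exists_bound_energyFlux (N := N) (c := c) M
  refine ⟨M', ?_⟩
  filter_upwards [hM] with q hq h1 h2 using hM' _ (hq h1 h2)

lemma integrableOn_energyFluxField (hc : 0 < c) (hΩ : IsOpen Ω) (hΩb : Bornology.IsBounded Ω)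
    (T : ℝ) : IntegrableOn (energyFluxField c Ω u) (Ω ×ˢ Ioc 0 T) := by
  obtain ⟨M, hM⟩ := hu.ae_bound_energyFluxField hc T
  have hsub : Ω ×ˢ Ioc 0 T ⊆ closedCylinder Ω :=
    prod_mono subset_closure fun s hs => hs.1.le
  have hfin : volume (Ω ×ˢ Ioc (0 : ℝ) T) < ⊤ :=
    (hΩb.prod (Metric.isBounded_Ioc 0 T)).measure_lt_top
  refine (integrableOn_const (C := M) hfin.ne).mono'
    (continuous_energyFlux.comp_aestronglyMeasurable
      ((hu.aestronglyMeasurable_cylDeriv hc).mono_measure (Measure.restrict_mono hsub le_rfl))) ?_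
  rw [ae_restrict_iff' (hΩ.measurableSet.prod measurableSet_Ioc)]
  filter_upwards [hM] with q hq hqO using hq (hsub hqO) hqO.2.2

lemma integrableOn_mul_velocity (hc : 0 < c) (hΩ : IsOpen Ω) {T : ℝ}
    (hG : IntegrableOn G (Ω ×ˢ Ioc (0 : ℝ) T)) :
    IntegrableOn (fun q => G q * velocity Ω u q) (Ω ×ˢ Ioc (0 : ℝ) T) := by
  obtain ⟨M, hM⟩ := hu.ae_bound_cylDeriv hc T
  have hsub : Ω ×ˢ Ioc 0 T ⊆ closedCylinder Ω :=
    prod_mono subset_closure fun s hs => hs.1.le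
  have hm : AEStronglyMeasurable (velocity Ω u) (volume.restrict (Ω ×ˢ Ioc (0 : ℝ) T)) :=
    (ContinuousLinearMap.apply ℝ ℝ ((0 : Space N), (1 : ℝ))).continuous.comp_aestronglyMeasurable
      ((hu.aestronglyMeasurable_cylDeriv hc).mono_measure (Measure.restrict_mono hsub le_rfl))
  refine Integrable.mul_bdd (c := M * ‖((0 : Space N), (1 : ℝ))‖) hG hm ?_
  rw [ae_restrict_iff' (hΩ.measurableSet.prod measurableSet_Ioc)]
  filter_upwards [hM] with q hq hqO
  exact ContinuousLinearMap.le_of_opNorm_le _ (hq (hsub hqO) hqO.2.2) _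

/-- The regular balance extends over fronts and over `Z` by `IsWeakDiv.of_interfaces`. Near a point
off `Z` a front is a graph of time over space, and `exists_conormal_limit` supplies the matching
fluxes. -/
theorem isWeakDiv_cylinder (hN : 1 ≤ N) (hΩ : IsOpen Ω) (hΩb : Bornology.IsBounded Ω) (hc : 0 < c)
    {T : ℝ} (hG : IntegrableOn G (Ω ×ˢ Ioc (0 : ℝ) T)) :
    IsWeakDiv volume (energyFluxField c Ω u) (fun q => -(G q * velocity Ω u q))
      (Ω ×ˢ Ioo (0 : ℝ) T) := by
  have hOo : IsOpen (Ω ×ˢ Ioo (0 : ℝ) T) := hΩ.prod isOpen_Ioo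
  have hsub : Ω ×ˢ Ioo (0 : ℝ) T ⊆ Ω ×ˢ Ioc (0 : ℝ) T := prod_mono le_rfl Ioo_subset_Ioc_self
  have hsub2 : Ω ×ˢ Ioo (0 : ℝ) T ⊆ openCylinder Ω := prod_mono le_rfl fun s hs => hs.1
  obtain ⟨M, hM⟩ := hu.ae_bound_energyFluxField hc T
  have hVM : ∀ᵐ q, q ∈ Ω ×ˢ Ioo (0 : ℝ) T → ‖energyFluxField c Ω u q‖ ≤ M := by
    filter_upwards [hM] with q hq hqO
    exact hq (openCylinder_subset_closedCylinder (hsub2 hqO)) hqO.2.2.le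
  have hV := (hu.integrableOn_energyFluxField hc hΩ hΩb T).mono_set hsub
  have hh := ((hu.integrableOn_mul_velocity hc hΩ hG).mono_set hsub).neg
  refine IsWeakDiv.of_interfaces (d := N) hN (by simp [SpaceTime]) hOo hu.isClosed_exceptional
    hu.exceptional_null (fun k => (hu.isWaveFront k).isLocallyClosed) hu.isClosed_singular
    hV.locallyIntegrableOn hh.locallyIntegrableOn hVM
    ((hu.isWeakDiv_regular hΩ).mono (sdiff_subset_sdiff_left hsub2)) ?_
  intro k q hqF hqO hqZ
  obtain ⟨f, hf⟩ := hu.isWaveFront k q hqF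
  -- The box is taken inside the cylinder and away from `Z`, so every point of the graph in it
  -- satisfies Hadamard's conditions.
  obtain ⟨γ, W, a, b, hbox, hqW, hγq, haq, hqb, hsubU⟩ := exists_isGraphBox hf.contDiffAt
    (hf.eq_zero hqF) (hf.fderiv_time_neg hc)
    (inter_mem hf.mem_iff ((hOo.sdiff hu.isClosed_exceptional).mem_nhds ⟨hqO, hqZ⟩))
  refine ⟨W ×ˢ Ioo a b, (hbox.isOpen.prod isOpen_Ioo).mem_nhds ⟨hqW, haq, hqb⟩, ?_⟩
  intro A hA hAB hdiv
  have hAO : A ⊆ Ω ×ˢ Ioo (0 : ℝ) T := fun x hx => (hsubU (hAB hx)).2.1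
  have hgraph : ∀ x ∈ W ×ˢ Ioo a b, x ∈ F k ↔ x.2 = γ x.1 := by
    rintro ⟨x, r⟩ ⟨hx, hr⟩
    have h1 : (x, r) ∈ F k ↔ f (x, r) = 0 := (hsubU ⟨hx, hr⟩).1
    rw [h1]
    constructor
    · intro h0
      rcases lt_trichotomy r (γ x) with h | h | h
      · exact absurd h0 (hbox.pos x hx r hr h).ne'
      · exact h
      · exact absurd h0 (hbox.neg x hx r hr h).ne
    · intro h
      rw [show r = γ x from h]
      exact hbox.eq_zero x hx
  have hset : A \ F k = {x ∈ A | x.2 ≠ γ x.1} := by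
    ext x
    constructor
    · exact fun hx => ⟨hx.1, fun h => hx.2 ((hgraph x (hAB hx.1)).2 h)⟩
    · exact fun hx => ⟨hx.1, fun h => hx.2 ((hgraph x (hAB hx.1)).1 h)⟩
  rw [hset] at hdiv
  have hvol : volume (Z ∪ ⋃ k, F k) = 0 := hu.volume_singular hc
  refine IsWeakDiv.of_graph (ν := volume) hbox.isOpen hbox.contDiffOn hA (fun x hx => (hAB hx).1)
    hdiv (M := M) ?_ (hV.mono_set hAO) (hh.mono_set hAO) hvol ?_ ?_
  · filter_upwards [hVM] with x hx hxA using hx (hAO hxA)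
  · refine measure_mono_null ?_ hvol
    exact fun x hx => Or.inr (mem_iUnion.2 ⟨k, (hgraph x (hAB hx.1)).2 hx.2⟩)
  · refine Eventually.of_forall fun y hyW hyA => ?_
    refine hu.exists_conormal_limit hΩ hc (k := k)
      ((hbox.contDiffOn.contDiffAt (hbox.isOpen.mem_nhds hyW)).differentiableAt one_ne_zero) ?_
      (hsubU (hAB hyA)).2.2
    filter_upwards [hbox.isOpen.mem_nhds hyW] with x hx
    exact (hgraph _ ⟨hx, hbox.mem x hx⟩).2 rfl

end

end IsClassicalSolution

/-! ### Area of graphs -/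

section Area

open scoped ENNReal

/-- Countably many neighbourhoods cover; made disjoint, they add up to the same factor `1 + ε`,
which then tends to 1. -/
lemma measure_le_of_locally_le {X : Type*} [TopologicalSpace X] [SecondCountableTopology X]
    [MeasurableSpace X] [OpensMeasurableSpace X] {κ lam : Measure X} {W : Set X}
    (h : ∀ y ∈ W, ∀ ε : ℝ≥0, 0 < ε → ∃ B ∈ 𝓝 y, ∀ A, MeasurableSet A → A ⊆ B → A ⊆ W →
      κ A ≤ (1 + ε) * lam A) {A : Set X} (hA : MeasurableSet A) (hAW : A ⊆ W) : κ A ≤ lam A := by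
  have key : ∀ ε : ℝ≥0, 0 < ε → κ A ≤ (1 + ε) * lam A := by
    intro ε hε
    rcases A.eq_empty_or_nonempty with rfl | hne
    · simp
    choose! B hB hBA using fun y hy => h y hy ε hε
    obtain ⟨t, htA, htc, hcov⟩ := TopologicalSpace.countable_cover_nhdsWithin
      (f := fun y => interior (B y)) (s := A)
      fun y hy => mem_nhdsWithin_of_mem_nhds (interior_mem_nhds.2 (hB y (hAW hy)))
    have htne : t.Nonempty := by
      obtain ⟨y, hy⟩ := hne
      obtain ⟨i, hi⟩ := mem_iUnion₂.1 (hcov hy)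
      exact ⟨i, hi.1⟩
    obtain ⟨e, rfl⟩ := htc.exists_eq_range htne
    set D : ℕ → Set X := disjointed fun n => interior (B (e n)) with hD
    have hDm : ∀ n, MeasurableSet (D n) :=
      MeasurableSet.disjointed fun n => isOpen_interior.measurableSet
    have hDu : A ⊆ ⋃ n, A ∩ D n := by
      rw [← inter_iUnion, hD, iUnion_disjointed]
      refine subset_inter le_rfl (hcov.trans ?_)
      rw [biUnion_range]
    calc κ A ≤ κ (⋃ n, A ∩ D n) := measure_mono hDu
      _ ≤ ∑' n, κ (A ∩ D n) := measure_iUnion_le _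
      _ ≤ ∑' n, (1 + ε) * lam (A ∩ D n) := by
        refine ENNReal.tsum_le_tsum fun n => hBA (e n) (hAW (htA (mem_range_self n))) _
          (hA.inter (hDm n)) ?_ (inter_subset_left.trans hAW)
        exact inter_subset_right.trans ((disjointed_subset _ n).trans interior_subset)
      _ = (1 + ε) * lam (⋃ n, A ∩ D n) := by
        rw [ENNReal.tsum_mul_left, measure_iUnion _ fun n => hA.inter (hDm n)]
        exact fun i j hij => (disjoint_disjointed _ hij).mono inter_subset_right inter_subset_right
      _ ≤ (1 + ε) * lam A := by
        gcongr
        exact iUnion_subset fun n => inter_subset_left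
  have hlim : Tendsto (fun ε : ℝ≥0 => (1 + (ε : ℝ≥0∞)) * lam A) (𝓝[>] 0) (𝓝 ((1 + 0) * lam A)) := by
    refine ENNReal.Tendsto.mul_const ?_ (Or.inl (by simp))
    refine Tendsto.const_add _ (Tendsto.mono_left ?_ nhdsWithin_le_nhds)
    exact ENNReal.continuous_coe.tendsto' 0 0 (by simp)
  have := ge_of_tendsto hlim (by
    filter_upwards [self_mem_nhdsWithin] with ε hε using key ε hε)
  simpa using this

variable {U V : Type*} [NormedAddCommGroup U] [InnerProductSpace ℝ U] [FiniteDimensional ℝ U]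
  [MeasurableSpace U] [BorelSpace U] [NormedAddCommGroup V] [InnerProductSpace ℝ V]
  [FiniteDimensional ℝ V] [MeasurableSpace V] [BorelSpace V]

omit [InnerProductSpace ℝ V] [FiniteDimensional ℝ V] in
-- On `g '' A` the map `f ∘ g⁻¹`, with any choice of preimages, is `K`-Lipschitz and has image `f ''
-- A`.
lemma euclideanHausdorffMeasure_image_le {X : Type*} {f g : X → V} {A : Set X} {K : ℝ≥0}
    (h : ∀ a ∈ A, ∀ b ∈ A, dist (f a) (f b) ≤ K * dist (g a) (g b)) (d : ℕ) :
    Measure.euclideanHausdorffMeasure d (f '' A) ≤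
      K ^ d * Measure.euclideanHausdorffMeasure d (g '' A) := by
  rcases A.eq_empty_or_nonempty with rfl | ⟨a₀, ha₀⟩
  · simp
  have : Nonempty X := ⟨a₀⟩
  have hinv : ∀ z ∈ g '' A, Function.invFunOn g A z ∈ A ∧ g (Function.invFunOn g A z) = z :=
    fun z hz => ⟨Function.invFunOn_mem hz, Function.invFunOn_eq hz⟩
  have hlip : LipschitzOnWith K (fun z => f (Function.invFunOn g A z)) (g '' A) := by
    refine LipschitzOnWith.of_dist_le_mul fun x hx y hy => ?_
    have := h _ (hinv x hx).1 _ (hinv y hy).1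
    rwa [(hinv x hx).2, (hinv y hy).2] at this
  have himg : (fun z => f (Function.invFunOn g A z)) '' (g '' A) = f '' A := by
    rw [image_image]
    refine image_congr fun a ha => ?_
    have h1 := hinv (g a) (mem_image_of_mem g ha)
    have h2 := h _ h1.1 a ha
    rw [h1.2, dist_self, mul_zero] at h2
    exact dist_le_zero.1 h2
  have h3 := hlip.hausdorffMeasure_image_le (d := (d : ℝ)) (Nat.cast_nonneg d)
  rw [himg, ENNReal.rpow_natCast] at h3
  rw [Measure.euclideanHausdorffMeasure_def, Measure.smul_apply, Measure.smul_apply,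
    mul_smul_comm]
  gcongr

omit [MeasurableSpace U] [BorelSpace U] [MeasurableSpace V] [BorelSpace V] in
-- The Jacobian is the square root of the determinant of `L.adjoint ∘L L`.
lemma continuous_normDet : Continuous fun L : U →L[ℝ] V => (L : U →ₗ[ℝ] V).normDet := by
  have h : ∀ L : U →L[ℝ] V, (L : U →ₗ[ℝ] V).normDet = √((L.adjoint ∘L L).det) := by
    intro L
    have := L.normDet_sq
    simp only [RCLike.ofReal_real_eq_id, id] at this
    rw [← this, Real.sqrt_sq (LinearMap.normDet_nonneg _)]
  simp_rw [h]
  refine Real.continuous_sqrt.comp (ContinuousLinearMap.continuous_det.comp ?_)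
  exact (ContinuousLinearMap.adjoint.continuous.clm_comp continuous_id)

omit [FiniteDimensional ℝ V] in
-- Near `y` the map distorts distances by a factor between `K⁻¹` and `K` compared with its
-- derivative `L`, and for `L` the area is known exactly.
lemma exists_nhds_area {Φ : U → V} {L : U →L[ℝ] V} {y : U} (hΦ : HasStrictFDerivAt Φ L y)
    (hL : Function.Injective L) {K : ℝ≥0} (hK : 1 < K) :
    ∃ B ∈ 𝓝 y, ∀ A ⊆ B,
      Measure.euclideanHausdorffMeasure (Module.finrank ℝ U) (Φ '' A) ≤
        K ^ Module.finrank ℝ U * (ENNReal.ofReal (L : U →ₗ[ℝ] V).normDet * volume A) ∧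
      ENNReal.ofReal (L : U →ₗ[ℝ] V).normDet * volume A ≤
        K ^ Module.finrank ℝ U *
          Measure.euclideanHausdorffMeasure (Module.finrank ℝ U) (Φ '' A) := by
  obtain ⟨m, hm0, hm⟩ := LinearMap.exists_antilipschitzWith (L : U →ₗ[ℝ] V)
    (LinearMap.ker_eq_bot.2 hL)
  have hK' : (1 : ℝ) < K := hK
  have hm0' : (0 : ℝ) < m := hm0
  -- This makes `1 - η = K⁻¹`, and also `1 + η ≤ K`.
  set η : ℝ := 1 - (K : ℝ)⁻¹ with hη
  have hη0 : 0 < η := sub_pos.2 (inv_lt_one_of_one_lt₀ hK')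
  have hηK : η ≤ K - 1 := by
    have h1 : (K : ℝ) * (K : ℝ)⁻¹ = 1 := mul_inv_cancel₀ (by linarith)
    have h2 : 0 < (K : ℝ)⁻¹ := inv_pos.2 (by linarith)
    rw [hη]; nlinarith [sq_nonneg ((K : ℝ) - 1)]
  -- `‖a - b‖ ≤ m * ‖L (a - b)‖`, so the approximation error becomes `η` relative to `‖L (a - b)‖`.
  set δ : ℝ≥0 := ⟨η / m, by positivity⟩ with hδ
  have hδ0 : 0 < δ := by
    have : 0 < η / m := by positivity
    exact this
  obtain ⟨B, hB, happ⟩ := hΦ.approximates_deriv_on_nhds (c := δ) (Or.inr hδ0)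
  have key : ∀ a ∈ B, ∀ b ∈ B, ‖Φ a - Φ b - L (a - b)‖ ≤ η * ‖L (a - b)‖ := by
    intro a ha b hb
    refine (happ a ha b hb).trans ?_
    have h1 := hm.le_mul_dist a b
    rw [dist_eq_norm, dist_eq_norm, ← map_sub] at h1
    calc (δ : ℝ) * ‖a - b‖ ≤ (η / m) * (m * ‖L (a - b)‖) := by
          refine mul_le_mul_of_nonneg_left h1 ?_
          positivity
      _ = η * ‖L (a - b)‖ := by field_simp
  refine ⟨B, hB, fun A hA => ?_⟩
  have e1 := (L : U →ₗ[ℝ] V).euclideanHausdorffMeasure_image_eq_normDet_mul_volume A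
  have e2 : (fun x => (L : U →ₗ[ℝ] V) x) '' A = L '' A := rfl
  rw [← e1]
  constructor
  · refine euclideanHausdorffMeasure_image_le (fun a ha b hb => ?_) _
    have h1 := key a (hA ha) b (hA hb)
    rw [dist_eq_norm, dist_eq_norm]
    have h2 := norm_add_le (Φ a - Φ b - L (a - b)) (L (a - b))
    rw [sub_add_cancel] at h2
    have h3 : ‖(L : U →ₗ[ℝ] V) a - (L : U →ₗ[ℝ] V) b‖ = ‖L (a - b)‖ := by rw [map_sub]; rfl
    rw [h3]
    nlinarith [norm_nonneg (L (a - b))]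
  · refine euclideanHausdorffMeasure_image_le (fun a ha b hb => ?_) _
    have h1 := key a (hA ha) b (hA hb)
    rw [dist_eq_norm, dist_eq_norm]
    have h2 := norm_sub_le (Φ a - Φ b) (Φ a - Φ b - L (a - b))
    rw [sub_sub_cancel] at h2
    have h3 : ‖(L : U →ₗ[ℝ] V) a - (L : U →ₗ[ℝ] V) b‖ = ‖L (a - b)‖ := by rw [map_sub]; rfl
    rw [h3]
    have h4 : (K : ℝ)⁻¹ * ‖L (a - b)‖ ≤ ‖Φ a - Φ b‖ := by rw [hη] at h1; nlinarith
    rwa [inv_mul_le_iff₀ (by linarith)] at h4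

/-- The area formula for an embedded parametrized surface. -/
theorem euclideanHausdorffMeasure_image_eq_lintegral {Φ : U → V} {P : V → U} {W : Set U}
    (hW : IsOpen W) (hΦ : ContDiffOn ℝ 1 Φ W) (hP : Measurable P) (hPΦ : ∀ y ∈ W, P (Φ y) = y)
    (hinj : ∀ y ∈ W, Function.Injective (fderiv ℝ Φ y)) {A : Set U} (hA : MeasurableSet A)
    (hAW : A ⊆ W) :
    Measure.euclideanHausdorffMeasure (Module.finrank ℝ U) (Φ '' A) =
      ∫⁻ y in A, ENNReal.ofReal (fderiv ℝ Φ y : U →ₗ[ℝ] V).normDet := by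
  set d := Module.finrank ℝ U with hd
  set J : U → ℝ≥0∞ := fun y => ENNReal.ofReal (fderiv ℝ Φ y : U →ₗ[ℝ] V).normDet with hJ
  -- `P` inverts `Φ` on `W`, so this push-forward is the area of the image, already in the form of a
  -- measure on the parameter space.
  set κ : Measure U := ((Measure.euclideanHausdorffMeasure d).restrict (Φ '' W)).map P with hκ
  set lam : Measure U := volume.withDensity J with hlam
  have hκA : ∀ A, MeasurableSet A → A ⊆ W → κ A = Measure.euclideanHausdorffMeasure d (Φ '' A) := by
    intro A hA hAW
    rw [hκ, Measure.map_apply hP hA, Measure.restrict_apply (hP hA)]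
    congr 1
    ext x
    constructor
    · rintro ⟨hx, y, hy, rfl⟩
      rw [mem_preimage, hPΦ y hy] at hx
      exact mem_image_of_mem _ hx
    · rintro ⟨y, hy, rfl⟩
      refine ⟨?_, mem_image_of_mem _ (hAW hy)⟩
      rw [mem_preimage, hPΦ y (hAW hy)]
      exact hy
  have hlamA : ∀ A, MeasurableSet A → lam A = ∫⁻ y in A, J y := fun A hA =>
    withDensity_apply _ hA
  have hloc : ∀ y ∈ W, ∀ ε : ℝ≥0, 0 < ε → ∃ B ∈ 𝓝 y, ∀ A, MeasurableSet A → A ⊆ B → A ⊆ W →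
      κ A ≤ (1 + ε) * lam A ∧ lam A ≤ (1 + ε) * κ A := by
    intro y hy ε hε
    -- The power `d` is lost in comparing areas, one further factor in freezing the Jacobian.
    obtain ⟨K, hK1, hK⟩ : ∃ K : ℝ≥0, 1 < K ∧ K ^ (d + 1) < 1 + ε := by
      have h1 : Tendsto (fun K : ℝ≥0 => K ^ (d + 1)) (𝓝[>] 1) (𝓝 1) :=
        ((continuous_pow (d + 1)).tendsto' 1 1 (one_pow _)).mono_left nhdsWithin_le_nhds
      obtain ⟨K, hK, hK1⟩ := ((h1.eventually (gt_mem_nhds (show (1 : ℝ≥0) < 1 + ε by simpa))).and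
        self_mem_nhdsWithin).exists
      exact ⟨K, hK1, hK⟩
    have hKε : (K : ℝ≥0∞) ^ d * K ≤ 1 + ε := by
      rw [← pow_succ]
      exact_mod_cast hK.le
    have hC : ContDiffAt ℝ 1 Φ y := hΦ.contDiffAt (hW.mem_nhds hy)
    obtain ⟨B₁, hB₁, harea⟩ := exists_nhds_area (hC.hasStrictFDerivAt one_ne_zero) (hinj y hy) hK1
    have hpos : 0 < (fderiv ℝ Φ y : U →ₗ[ℝ] V).normDet := by
      refine (LinearMap.normDet_nonneg _).lt_of_ne' ?_
      rw [Ne, LinearMap.normDet_eq_zero_iff_ker_ne_bot, not_not]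
      exact LinearMap.ker_eq_bot.2 (hinj y hy)
    have hJc : ContinuousAt (fun y => (fderiv ℝ Φ y : U →ₗ[ℝ] V).normDet) y :=
      continuous_normDet.continuousAt.comp (hC.fderiv_right (m := 0) (by simp)).continuousAt
    have hK' : (1 : ℝ) < K := hK1
    have h2 : ∀ᶠ z in 𝓝 y, (fderiv ℝ Φ z : U →ₗ[ℝ] V).normDet <
        K * (fderiv ℝ Φ y : U →ₗ[ℝ] V).normDet :=
      hJc.eventually (gt_mem_nhds (by nlinarith))
    have h3 : ∀ᶠ z in 𝓝 y, (fderiv ℝ Φ y : U →ₗ[ℝ] V).normDet / K <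
        (fderiv ℝ Φ z : U →ₗ[ℝ] V).normDet :=
      hJc.eventually (lt_mem_nhds (div_lt_self hpos hK'))
    refine ⟨B₁ ∩ {z | _ ∧ _}, inter_mem hB₁ (h2.and h3), fun A hA hAB hAW => ?_⟩
    obtain ⟨a1, a2⟩ := harea A fun z hz => (hAB hz).1
    rw [hκA A hA hAW, hlamA A hA]
    have b1 : ∫⁻ z in A, J z ≤ K * (J y * volume A) := by
      calc ∫⁻ z in A, J z ≤ ∫⁻ z in A, K * J y := by
            refine setLIntegral_mono' hA fun z hz => ?_
            simp only [hJ]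
            rw [← ENNReal.ofReal_coe_nnreal, ← ENNReal.ofReal_mul (by positivity)]
            exact ENNReal.ofReal_le_ofReal (hAB hz).2.1.le
        _ = K * (J y * volume A) := by rw [setLIntegral_const, mul_assoc]
    have b2 : J y * volume A ≤ K * ∫⁻ z in A, J z := by
      calc J y * volume A = ∫⁻ z in A, J y := by rw [setLIntegral_const]
        _ ≤ ∫⁻ z in A, K * J z := by
            refine setLIntegral_mono' hA fun z hz => ?_
            simp only [hJ]
            rw [← ENNReal.ofReal_coe_nnreal, ← ENNReal.ofReal_mul (by positivity)]
            refine ENNReal.ofReal_le_ofReal ?_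
            have := (hAB hz).2.2.le
            rwa [div_le_iff₀' (by linarith)] at this
        _ = K * ∫⁻ z in A, J z := by rw [lintegral_const_mul' _ _ (by simp)]
    constructor
    · calc _ ≤ K ^ d * (J y * volume A) := a1
        _ ≤ K ^ d * (K * ∫⁻ z in A, J z) := by gcongr
        _ = (K ^ d * K) * ∫⁻ z in A, J z := by rw [mul_assoc]
        _ ≤ _ := by gcongr
    · calc _ ≤ K * (J y * volume A) := b1
        _ ≤ K * (K ^ d * Measure.euclideanHausdorffMeasure d (Φ '' A)) := by gcongr
        _ = (K ^ d * K) * Measure.euclideanHausdorffMeasure d (Φ '' A) := by ring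
        _ ≤ _ := by gcongr
  rw [← hκA A hA hAW, ← hlamA A hA]
  refine le_antisymm (measure_le_of_locally_le (fun y hy ε hε => ?_) hA hAW)
    (measure_le_of_locally_le (fun y hy ε hε => ?_) hA hAW)
  · obtain ⟨B, hB, h⟩ := hloc y hy ε hε
    exact ⟨B, hB, fun A hA hAB hAW => (h A hA hAB hAW).1⟩
  · obtain ⟨B, hB, h⟩ := hloc y hy ε hε
    exact ⟨B, hB, fun A hA hAB hAW => (h A hA hAB hAW).2⟩

theorem map_withDensity_normDet {Φ : U → V} {P : V → U} {W : Set U}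
    (hW : IsOpen W) (hΦ : ContDiffOn ℝ 1 Φ W) (hP : Measurable P) (hPΦ : ∀ y ∈ W, P (Φ y) = y)
    (hinj : ∀ y ∈ W, Function.Injective (fderiv ℝ Φ y)) :
    ((volume.restrict W).withDensity
        fun y => ENNReal.ofReal (fderiv ℝ Φ y : U →ₗ[ℝ] V).normDet).map Φ =
      (Measure.euclideanHausdorffMeasure (Module.finrank ℝ U)).restrict (Φ '' W) := by
  ext B hB
  have hcont := hΦ.continuousOn
  have hae : AEMeasurable Φ ((volume.restrict W).withDensity
      fun y => ENNReal.ofReal (fderiv ℝ Φ y : U →ₗ[ℝ] V).normDet) :=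
    (hcont.aemeasurable hW.measurableSet).mono_ac (withDensity_absolutelyContinuous _ _)
  obtain ⟨C, hC, hCB⟩ : ∃ C, MeasurableSet C ∧ Φ ⁻¹' B ∩ W = C := by
    refine ⟨_, ?_, rfl⟩
    have h1 : Measurable (W.domRestrict Φ) := (continuousOn_iff_continuous_domRestrict.1 hcont).measurable
    have h2 := (MeasurableEmbedding.subtype_coe hW.measurableSet).measurableSet_image.2 (h1 hB)
    convert h2 using 1
    ext y
    constructor
    · exact fun hy => ⟨⟨y, hy.2⟩, hy.1, rfl⟩
    · rintro ⟨⟨y, hy⟩, h3, rfl⟩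
      exact ⟨h3, hy⟩
  have hCW : C ⊆ W := by rw [← hCB]; exact inter_subset_right
  rw [Measure.restrict_apply hB, Measure.map_apply_of_aemeasurable hae hB]
  have himg : B ∩ Φ '' W = Φ '' C := by
    rw [← hCB, inter_comm (Φ ⁻¹' B), image_inter_preimage, inter_comm]
  rw [himg, euclideanHausdorffMeasure_image_eq_lintegral hW hΦ hP hPΦ hinj hC hCW]
  rw [← restrict_withDensity hW.measurableSet, Measure.restrict_apply' hW.measurableSet, hCB,
    withDensity_apply _ hC]

end Area

/-! ### Graphs over a hyperplane -/

section Hyperplane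

variable {V : Type*} [NormedAddCommGroup V] [InnerProductSpace ℝ V] [FiniteDimensional ℝ V]

omit [FiniteDimensional ℝ V] in
lemma inner_orthogonal_singleton {n : V} (y : (ℝ ∙ n)ᗮ) : inner ℝ n (y : V) = 0 :=
  Submodule.mem_orthogonal_singleton_iff_inner_right.1 y.2

omit [FiniteDimensional ℝ V] in
lemma orthogonalProjectionOnto_add_inner_smul {n : V} (hn : ‖n‖ = 1) (x : V) :
    (((ℝ ∙ n)ᗮ.orthogonalProjectionOnto x : (ℝ ∙ n)ᗮ) : V) + inner ℝ n x • n = x := by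
  have h1 : (((ℝ ∙ n)ᗮ.orthogonalProjectionOnto x : (ℝ ∙ n)ᗮ) : V) = (ℝ ∙ n)ᗮ.starProjection x := rfl
  rw [h1, Submodule.starProjection_orthogonal', sub_apply, Submodule.starProjection_unit_singleton ℝ hn]
  simp

/-- The decomposition of space into a hyperplane and its normal line. -/
def hyperplaneEquiv (n : V) (hn : ‖n‖ = 1) : ((ℝ ∙ n)ᗮ × ℝ) ≃L[ℝ] V :=
  LinearEquiv.toContinuousLinearEquiv
    { toFun := fun q => (q.1 : V) + q.2 • n
      map_add' := fun p q => by simp [add_smul]; abel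
      map_smul' := fun a p => by simp [smul_smul]
      invFun := fun x => ((ℝ ∙ n)ᗮ.orthogonalProjectionOnto x, inner ℝ n x)
      left_inv := fun q => by
        have h2 : inner ℝ n ((q.1 : V) + q.2 • n) = q.2 := by
          rw [inner_add_right, inner_orthogonal_singleton, inner_smul_right,
            real_inner_self_eq_norm_sq, hn]
          simp
        refine Prod.ext (Subtype.ext ?_) h2
        have h1 := orthogonalProjectionOnto_add_inner_smul hn ((q.1 : V) + q.2 • n)
        rw [h2] at h1
        exact add_right_cancel h1
      right_inv := fun x => orthogonalProjectionOnto_add_inner_smul hn x }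

lemma hyperplaneEquiv_apply (n : V) (hn : ‖n‖ = 1) (q : (ℝ ∙ n)ᗮ × ℝ) :
    hyperplaneEquiv n hn q = (q.1 : V) + q.2 • n := rfl

lemma hyperplaneEquiv_symm_apply (n : V) (hn : ‖n‖ = 1) (x : V) :
    (hyperplaneEquiv n hn).symm x = ((ℝ ∙ n)ᗮ.orthogonalProjectionOnto x, inner ℝ n x) := rfl

/-- Coordinates of space-time adapted to a hyperplane of space. -/
def hyperplaneTimeEquiv (n : V) (hn : ‖n‖ = 1) : (((ℝ ∙ n)ᗮ × ℝ) × ℝ) ≃L[ℝ] (V × ℝ) :=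
  ((ContinuousLinearEquiv.prodAssoc ℝ (ℝ ∙ n)ᗮ ℝ ℝ).trans
    (((ContinuousLinearEquiv.refl ℝ (ℝ ∙ n)ᗮ).prodCongr (ContinuousLinearEquiv.prodComm ℝ ℝ ℝ)).trans
      (ContinuousLinearEquiv.prodAssoc ℝ (ℝ ∙ n)ᗮ ℝ ℝ).symm)).trans
    ((hyperplaneEquiv n hn).prodCongr (ContinuousLinearEquiv.refl ℝ ℝ))

/-- Time is grouped with the hyperplane and the normal coordinate comes last, so the lateral
boundary is a graph in the sense of `integral_above_graph`. -/
lemma hyperplaneTimeEquiv_apply (n : V) (hn : ‖n‖ = 1) (q : ((ℝ ∙ n)ᗮ × ℝ) × ℝ) :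
    hyperplaneTimeEquiv n hn q = (hyperplaneEquiv n hn (q.1.1, q.2), q.1.2) := rfl

lemma hyperplaneTimeEquiv_symm_apply (n : V) (hn : ‖n‖ = 1) (q : V × ℝ) :
    (hyperplaneTimeEquiv n hn).symm q =
      (((hyperplaneEquiv n hn).symm q.1 |>.1, q.2), ((hyperplaneEquiv n hn).symm q.1).2) := rfl

variable [MeasurableSpace V] [BorelSpace V]

lemma measurePreserving_hyperplaneEquiv (n : V) (hn : ‖n‖ = 1) :
    MeasurePreserving (hyperplaneEquiv n hn) := by
  have h1 := ((ℝ ∙ n).measurePreserving_measurableEquivProd (0 : V)).symm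
  rw [InnerProductSpace.euclideanHausdorffMeasure_eq_volume] at h1
  have h2 := ((LinearIsometryEquiv.toSpanUnitSingleton (𝕜 := ℝ) n hn).measurePreserving.prod
    (MeasurePreserving.id (volume : Measure (ℝ ∙ n)ᗮ)))
  have h3 := Measure.measurePreserving_swap (μ := (volume : Measure (ℝ ∙ n)ᗮ))
    (ν := (volume : Measure ℝ))
  convert h1.comp (h2.comp h3) using 1
  · funext q
    rw [hyperplaneEquiv_apply]
    simp [add_comm]
  · rfl

lemma measurePreserving_hyperplaneTimeEquiv (n : V) (hn : ‖n‖ = 1) :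
    MeasurePreserving (hyperplaneTimeEquiv n hn)
      (((volume : Measure (ℝ ∙ n)ᗮ).prod (volume : Measure ℝ)).prod volume)
      ((volume : Measure V).prod volume) := by
  have h1 := measurePreserving_prodAssoc (volume : Measure (ℝ ∙ n)ᗮ) (volume : Measure ℝ)
    (volume : Measure ℝ)
  have h2 := (MeasurePreserving.id (volume : Measure (ℝ ∙ n)ᗮ)).prod
    (Measure.measurePreserving_swap (μ := (volume : Measure ℝ)) (ν := (volume : Measure ℝ)))
  have h3 := (measurePreserving_hyperplaneEquiv n hn).prod (MeasurePreserving.id (volume : Measure ℝ))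
  exact h3.comp (h1.symm.comp (h2.comp h1))

omit [MeasurableSpace V] [BorelSpace V] in
/-- The area element of a graph over a hyperplane with normal `n`, whose conormal is `w`. -/
lemma normDet_graph {n : V} (hn : ‖n‖ = 1) {w : V} (hw : inner ℝ w n ≠ 0)
    {L : (ℝ ∙ n)ᗮ →L[ℝ] V} (hL : ∀ v, L v = (v : V) - (inner ℝ w (v : V) / inner ℝ w n) • n) :
    (L : (ℝ ∙ n)ᗮ →ₗ[ℝ] V).normDet = ‖w‖ / |inner ℝ w n| := by
  classical
  set k := inner ℝ w n with hk
  set P : (ℝ ∙ n)ᗮ := (ℝ ∙ n)ᗮ.orthogonalProjectionOnto w with hP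
  have hw1 : (P : V) + k • n = w := by
    rw [hk, real_inner_comm]; exact orthogonalProjectionOnto_add_inner_smul hn w
  have hnn : inner ℝ n n = (1 : ℝ) := by rw [real_inner_self_eq_norm_sq, hn, one_pow]
  have hnv : ∀ v : (ℝ ∙ n)ᗮ, inner ℝ n (v : V) = 0 := inner_orthogonal_singleton
  have hvn : ∀ v : (ℝ ∙ n)ᗮ, inner ℝ (v : V) n = 0 := fun v => by
    rw [real_inner_comm]; exact hnv v
  have hwv : ∀ v : (ℝ ∙ n)ᗮ, inner ℝ w (v : V) = inner ℝ (P : V) (v : V) := by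
    intro v
    rw [← hw1, inner_add_left, inner_smul_left, hnv]
    simp
  have hnorm : ‖w‖ ^ 2 = ‖P‖ ^ 2 + k ^ 2 := by
    rw [← real_inner_self_eq_norm_sq w, ← hw1]
    simp only [inner_add_left, inner_add_right, inner_smul_left, inner_smul_right, hnv, hvn, hnn,
      real_inner_self_eq_norm_sq]
    simp
    ring
  set b := stdOrthonormalBasis ℝ (ℝ ∙ n)ᗮ with hb
  have h1 := LinearMap.normDet_sq_eq_det_gram (L : (ℝ ∙ n)ᗮ →ₗ[ℝ] V) b
  set a : Fin (Module.finrank ℝ (ℝ ∙ n)ᗮ) → ℝ := fun i => inner ℝ w (b i : V) / k with ha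
  -- The Gram matrix is a rank-one perturbation of the identity, so its determinant is `1 + a ⬝ᵥ a`.
  have h2 : Matrix.gram ℝ (fun i => (L : (ℝ ∙ n)ᗮ →ₗ[ℝ] V) (b i)) =
      1 + Matrix.replicateCol Unit a * Matrix.replicateRow Unit a := by
    ext i j
    have h3 : inner ℝ (b i : V) (b j : V) = (1 : Matrix _ _ ℝ) i j := by
      have := (orthonormal_iff_ite.1 b.orthonormal) i j
      rw [Matrix.one_apply, ← this]
      rfl
    rw [Matrix.gram_apply, ContinuousLinearMap.coe_coe, hL, hL]
    simp only [inner_sub_left, inner_sub_right, inner_smul_left, inner_smul_right, hnv, hvn, hnn, h3,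
      Matrix.add_apply, Matrix.mul_apply, Matrix.replicateCol_apply, Matrix.replicateRow_apply, ha]
    simp
    ring
  rw [h2, Matrix.det_one_add_replicateCol_mul_replicateRow] at h1
  have h4 : a ⬝ᵥ a = ‖P‖ ^ 2 / k ^ 2 := by
    rw [← b.sum_sq_norm_inner_right P, dotProduct, Finset.sum_div]
    refine Finset.sum_congr rfl fun i _ => ?_
    simp only [ha]
    rw [hwv, Real.norm_eq_abs, sq_abs, real_inner_comm]
    have : inner ℝ (b i : V) (P : V) = inner ℝ (b i) P := rfl
    rw [this]
    field_simp
  rw [h4] at h1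
  have h5 : (L : (ℝ ∙ n)ᗮ →ₗ[ℝ] V).normDet ^ 2 = (‖w‖ / |k|) ^ 2 := by
    have h1' : (L : (ℝ ∙ n)ᗮ →ₗ[ℝ] V).normDet ^ 2 = 1 + ‖P‖ ^ 2 / k ^ 2 := h1
    rw [h1', div_pow, sq_abs, hnorm]
    field_simp
    ring
  exact (pow_left_inj₀ (LinearMap.normDet_nonneg _) (by positivity) two_ne_zero).1 h5

end Hyperplane

/-! ### Surface measure times a second measure, in a parametrization. -/

section ProductArea

lemma map_prod_eq_map_prodMap {α β T : Type*} [MeasurableSpace α] [MeasurableSpace β]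
    [MeasurableSpace T] {μ : Measure α} [SFinite μ] {ν : Measure T} [SFinite ν] {f : α → β}
    (hf : AEMeasurable f μ) : (μ.map f).prod ν = (μ.prod ν).map (Prod.map f id) := by
  have h1 : Prod.map f id =ᵐ[μ.prod ν] Prod.map (hf.mk f) id := by
    filter_upwards [Measure.quasiMeasurePreserving_fst.ae hf.ae_eq_mk] with q hq
    exact Prod.ext hq rfl
  have h2 := Measure.map_prod_map μ ν hf.measurable_mk (measurable_id (α := T))
  rw [Measure.map_congr hf.ae_eq_mk, Measure.map_congr h1, ← h2, Measure.map_id]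

variable {U V T : Type*} [NormedAddCommGroup U] [InnerProductSpace ℝ U] [FiniteDimensional ℝ U]
  [MeasurableSpace U] [BorelSpace U] [NormedAddCommGroup V] [InnerProductSpace ℝ V]
  [FiniteDimensional ℝ V] [MeasurableSpace V] [BorelSpace V] [MeasurableSpace T]
  {ν : Measure T} [SFinite ν] {Φ : U → V} {P : V → U} {W : Set U}

lemma restrict_image_prod_eq_map (hW : IsOpen W) (hΦ : ContDiffOn ℝ 1 Φ W) (hP : Measurable P)
    (hPΦ : ∀ y ∈ W, P (Φ y) = y) (hinj : ∀ y ∈ W, Function.Injective (fderiv ℝ Φ y)) :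
    AEMeasurable (Prod.map Φ id) ((((volume.restrict W).prod ν)).withDensity
        fun q => ENNReal.ofReal (fderiv ℝ Φ q.1 : U →ₗ[ℝ] V).normDet) ∧
    ((Measure.euclideanHausdorffMeasure (Module.finrank ℝ U)).restrict (Φ '' W)).prod ν =
      (((volume.restrict W).prod ν).withDensity
        fun q => ENNReal.ofReal (fderiv ℝ Φ q.1 : U →ₗ[ℝ] V).normDet).map (Prod.map Φ id) := by
  have hJ : Measurable fun y => ENNReal.ofReal (fderiv ℝ Φ y : U →ₗ[ℝ] V).normDet :=
    (continuous_normDet.measurable.comp (measurable_fderiv ℝ Φ)).ennreal_ofReal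
  have hae : AEMeasurable Φ ((volume.restrict W).withDensity
      fun y => ENNReal.ofReal (fderiv ℝ Φ y : U →ₗ[ℝ] V).normDet) :=
    (hΦ.continuousOn.aemeasurable hW.measurableSet).mono_ac (withDensity_absolutelyContinuous _ _)
  rw [← map_withDensity_normDet hW hΦ hP hPΦ hinj, map_prod_eq_map_prodMap hae,
    prod_withDensity_left hJ]
  refine ⟨?_, rfl⟩
  refine AEMeasurable.mono_ac ?_ (withDensity_absolutelyContinuous _ _)
  have h1 := hΦ.continuousOn.aemeasurable (μ := volume) hW.measurableSet
  exact (h1.comp_quasiMeasurePreserving Measure.quasiMeasurePreserving_fst).prodMk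
    measurable_snd.aemeasurable

lemma prod_restrict_image_null (hW : IsOpen W) (hΦ : ContDiffOn ℝ 1 Φ W) (hP : Measurable P)
    (hPΦ : ∀ y ∈ W, P (Φ y) = y) (hinj : ∀ y ∈ W, Function.Injective (fderiv ℝ Φ y))
    {N : Set (V × T)} (hN : MeasurableSet N)
    (h0 : ∀ᵐ q ∂(volume.restrict W).prod ν, (Φ q.1, q.2) ∉ N) :
    (((Measure.euclideanHausdorffMeasure (Module.finrank ℝ U)).restrict (Φ '' W)).prod ν) N = 0 := by
  obtain ⟨h1, h2⟩ := restrict_image_prod_eq_map (ν := ν) hW hΦ hP hPΦ hinj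
  rw [h2, Measure.map_apply_of_aemeasurable h1 hN]
  refine withDensity_absolutelyContinuous _ _ ?_
  exact measure_eq_zero_iff_ae_notMem.2 h0

lemma integral_restrict_image_prod (hW : IsOpen W) (hΦ : ContDiffOn ℝ 1 Φ W) (hP : Measurable P)
    (hPΦ : ∀ y ∈ W, P (Φ y) = y) (hinj : ∀ y ∈ W, Function.Injective (fderiv ℝ Φ y))
    {g : V × T → ℝ} (hg : AEStronglyMeasurable g
      (((Measure.euclideanHausdorffMeasure (Module.finrank ℝ U)).restrict (Φ '' W)).prod ν)) :
    ∫ q, g q ∂((Measure.euclideanHausdorffMeasure (Module.finrank ℝ U)).restrict (Φ '' W)).prod ν =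
      ∫ q, (fderiv ℝ Φ q.1 : U →ₗ[ℝ] V).normDet * g (Φ q.1, q.2) ∂(volume.restrict W).prod ν := by
  obtain ⟨h1, h2⟩ := restrict_image_prod_eq_map (ν := ν) hW hΦ hP hPΦ hinj
  have hJ : Measurable fun q : U × T => ENNReal.ofReal (fderiv ℝ Φ q.1 : U →ₗ[ℝ] V).normDet :=
    (continuous_normDet.measurable.comp
      ((measurable_fderiv ℝ Φ).comp measurable_fst)).ennreal_ofReal
  rw [h2] at hg ⊢
  rw [integral_map h1 hg, integral_withDensity_eq_integral_toReal_smul hJ (by simp)]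
  refine integral_congr_ae (Eventually.of_forall fun q => ?_)
  simp only [smul_eq_mul]
  rw [ENNReal.toReal_ofReal (LinearMap.normDet_nonneg _)]
  rfl

end ProductArea

/-! ### Charts of the boundary -/

lemma inner_gradient_apply {V : Type*} [NormedAddCommGroup V] [InnerProductSpace ℝ V]
    [CompleteSpace V] (g : V → ℝ) (x v : V) : inner ℝ (gradient g x) v = fderiv ℝ g x v :=
  InnerProductSpace.toDual_symm_apply

/-- The cylinder over the base `W` with axis `n`, between the heights `a` and `b`. -/
def graphRegion {N : ℕ} (n : Space N) (hn : ‖n‖ = 1) (W : Set (ℝ ∙ n)ᗮ) (a b : ℝ) : Set (Space N) :=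
  {x | (hyperplaneEquiv n hn).symm x ∈ W ×ˢ Ioo a b}

/-- The boundary of `Ω` is the graph of `γ` over `W` in the direction `n`, with `Ω` above it, and
`g` is a defining function of `Ω` near this part of the boundary. -/
structure IsBoundaryChart {N : ℕ} (Ω : Set (Space N)) (g : Space N → ℝ) (n : Space N) (hn : ‖n‖ = 1)
    (γ : (ℝ ∙ n)ᗮ → ℝ) (W : Set (ℝ ∙ n)ᗮ) (a b : ℝ) : Prop where
  box : IsGraphBox (fun q => g (hyperplaneEquiv n hn q)) γ W a b
  contDiffAt : ∀ x ∈ graphRegion n hn W a b, ContDiffAt ℝ 1 g x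
  mem_iff : ∀ x ∈ graphRegion n hn W a b, x ∈ Ω ↔ g x < 0
  normal : ∀ x ∈ graphRegion n hn W a b, g x = 0 → gradient g x ≠ 0 →
    IsOuterUnitNormal Ω x (‖gradient g x‖⁻¹ • gradient g x)

/-- The parametrization of a graph over a hyperplane. -/
def graphMap {N : ℕ} (n : Space N) (hn : ‖n‖ = 1) (γ : (ℝ ∙ n)ᗮ → ℝ) (y : (ℝ ∙ n)ᗮ) : Space N :=
  hyperplaneEquiv n hn (y, γ y)

/-- The axis is the inner unit normal at the given point: the defining function decreases along it,
so Ω lies above the graph. -/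
lemma IsLyapunovDomain.exists_isBoundaryChart {N : ℕ} {Ω : Set (Space N)} (hΩ : IsLyapunovDomain Ω)
    {x₀ : Space N} (hx₀ : x₀ ∈ frontier Ω) :
    ∃ g n, ∃ hn : ‖n‖ = 1, ∃ γ W a b, IsBoundaryChart Ω g n hn γ W a b ∧
      x₀ ∈ graphRegion n hn W a b := by
  obtain ⟨α, hα, -, hb⟩ := hΩ.boundary
  obtain ⟨g, hg⟩ := hb x₀ hx₀
  obtain ⟨C, U₀, hU₀, hCU⟩ := hg.holder
  have hw : ‖gradient g x₀‖ ≠ 0 := norm_ne_zero_iff.2 hg.gradient_ne_zero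
  set n : Space N := -(‖gradient g x₀‖⁻¹ • gradient g x₀) with hn_def
  have hn : ‖n‖ = 1 := by
    rw [hn_def, norm_neg, norm_smul, norm_inv, norm_norm, inv_mul_cancel₀ hw]
  set e := hyperplaneEquiv n hn with he
  set p := e.symm x₀ with hp
  have hep : e p = x₀ := e.apply_symm_apply x₀
  have hC : ContDiffAt ℝ 1 (fun q => g (e q)) p :=
    ContDiffAt.comp p (by rw [hep]; exact hg.contDiffAt) e.contDiff.contDiffAt
  have hd : fderiv ℝ (fun q => g (e q)) p (0, 1) < 0 := by
    have h1 : HasFDerivAt g (fderiv ℝ g x₀) (e p) := by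
      rw [hep]; exact (hg.contDiffAt.differentiableAt one_ne_zero).hasFDerivAt
    have h2 : fderiv ℝ (fun q => g (e q)) p = _ := (h1.comp p e.hasFDerivAt).fderiv
    rw [h2, ContinuousLinearMap.comp_apply]
    have h3 : (e : ((ℝ ∙ n)ᗮ × ℝ) →L[ℝ] Space N) (0, 1) = n := by
      have : e (0, 1) = n := by rw [he, hyperplaneEquiv_apply]; simp
      exact this
    rw [h3, ← inner_gradient_apply, hn_def, inner_neg_right, inner_smul_right,
      real_inner_self_eq_norm_sq]
    have : 0 < ‖gradient g x₀‖ := (norm_nonneg _).lt_of_ne' hw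
    field_simp
    linarith
  -- These properties persist at nearby points, so that `g` serves as a defining function at every
  -- boundary point of the chart.
  have hev : ∀ᶠ x in 𝓝 x₀, (ContDiffAt ℝ 1 g x ∧ U₀ ∈ 𝓝 x) ∧
      ∀ᶠ y in 𝓝 x, y ∈ Ω ↔ g y < 0 :=
    ((hg.contDiffAt.eventually (by simp)).and (eventually_mem_nhds_iff.2 hU₀)).and
      hg.mem_iff.eventually_nhds
  have hU : {q | (ContDiffAt ℝ 1 g (e q) ∧ U₀ ∈ 𝓝 (e q)) ∧ ∀ᶠ y in 𝓝 (e q), y ∈ Ω ↔ g y < 0}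
      ∈ 𝓝 p := by
    have h1 : Tendsto e (𝓝 p) (𝓝 x₀) := by rw [← hep]; exact e.continuous.tendsto p
    exact h1.eventually hev
  obtain ⟨γ, W, a, b, hbox, hpW, -, hap, hpb, hsub⟩ :=
    exists_isGraphBox hC (by rw [hep]; exact hg.eq_zero) hd hU
  have hsub' : ∀ x ∈ graphRegion n hn W a b, (ContDiffAt ℝ 1 g x ∧ U₀ ∈ 𝓝 x) ∧
      ∀ᶠ y in 𝓝 x, y ∈ Ω ↔ g y < 0 := by
    intro x hx
    have := hsub hx
    simpa [he] using this
  refine ⟨g, n, hn, γ, W, a, b, ⟨hbox, fun x hx => (hsub' x hx).1.1,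
    fun x hx => (hsub' x hx).2.self_of_nhds, fun x hx h0 hne => ?_⟩, ⟨hpW, hap, hpb⟩⟩
  exact ⟨α, hα, g, ⟨(hsub' x hx).1.1, h0, hne, ⟨C, U₀, (hsub' x hx).1.2, hCU⟩, (hsub' x hx).2⟩, rfl⟩

namespace IsBoundaryChart

variable {N : ℕ} {Ω : Set (Space N)} {g : Space N → ℝ} {n : Space N} {hn : ‖n‖ = 1}
  {γ : (ℝ ∙ n)ᗮ → ℝ} {W : Set (ℝ ∙ n)ᗮ} {a b : ℝ}

lemma symm_graphMap (y : (ℝ ∙ n)ᗮ) : (hyperplaneEquiv n hn).symm (graphMap n hn γ y) = (y, γ y) :=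
  (hyperplaneEquiv n hn).symm_apply_apply _

variable (h : IsBoundaryChart Ω g n hn γ W a b)
include h

lemma isOpen_graphRegion : IsOpen (graphRegion n hn W a b) :=
  (h.box.isOpen.prod isOpen_Ioo).preimage (hyperplaneEquiv n hn).symm.continuous

lemma graphMap_mem {y : (ℝ ∙ n)ᗮ} (hy : y ∈ W) : graphMap n hn γ y ∈ graphRegion n hn W a b := by
  rw [graphRegion, mem_ofPred_eq, symm_graphMap]
  exact ⟨hy, h.box.mem y hy⟩

lemma graphMap_eq_zero {y : (ℝ ∙ n)ᗮ} (hy : y ∈ W) : g (graphMap n hn γ y) = 0 := h.box.eq_zero y hy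

lemma inter_eq : Ω ∩ graphRegion n hn W a b = {x ∈ graphRegion n hn W a b |
    γ ((hyperplaneEquiv n hn).symm x).1 < ((hyperplaneEquiv n hn).symm x).2} := by
  ext x
  constructor
  · rintro ⟨hxΩ, hxB⟩
    refine ⟨hxB, ?_⟩
    have h1 := (h.mem_iff x hxB).1 hxΩ
    by_contra hle
    rcases (not_lt.1 hle).lt_or_eq with h2 | h2
    · have := h.box.pos _ hxB.1 _ hxB.2 h2
      simp at this
      linarith
    · have := h.box.eq_zero _ hxB.1
      rw [← h2] at this
      simp at this
      linarith
  · rintro ⟨hxB, hlt⟩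
    refine ⟨(h.mem_iff x hxB).2 ?_, hxB⟩
    simpa using h.box.neg _ hxB.1 _ hxB.2 hlt

lemma frontier_inter (hΩ : IsOpen Ω) :
    frontier Ω ∩ graphRegion n hn W a b = graphMap n hn γ '' W := by
  ext x
  constructor
  · rintro ⟨hxS, hxB⟩
    refine ⟨((hyperplaneEquiv n hn).symm x).1, hxB.1, ?_⟩
    have hxΩ : x ∉ Ω := by rw [hΩ.frontier_eq] at hxS; exact hxS.2
    have h1 : ¬ γ ((hyperplaneEquiv n hn).symm x).1 < ((hyperplaneEquiv n hn).symm x).2 := fun hlt =>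
      hxΩ ((h.inter_eq.symm ▸ (⟨hxB, hlt⟩ : x ∈ {x ∈ graphRegion n hn W a b | _}) :
        x ∈ Ω ∩ graphRegion n hn W a b)).1
    rcases (not_lt.1 h1).lt_or_eq with h2 | h2
    · exfalso
      have h3 := h.box.pos _ hxB.1 _ hxB.2 h2
      simp only [Prod.mk.eta, ContinuousLinearEquiv.apply_symm_apply] at h3
      have h4 : ∀ᶠ z in 𝓝 x, 0 < g z := (h.contDiffAt x hxB).continuousAt.eventually (lt_mem_nhds h3)
      have h5 := h4.and (h.isOpen_graphRegion.mem_nhds hxB)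
      obtain ⟨z, hz, hzΩ⟩ := mem_closure_iff_nhds.1 (frontier_subset_closure hxS) _ h5
      exact lt_asymm hz.1 ((h.mem_iff z hz.2).1 hzΩ)
    · rw [graphMap, ← h2]
      simp
  · rintro ⟨y, hy, rfl⟩
    have hB := h.graphMap_mem hy
    refine ⟨?_, hB⟩
    rw [hΩ.frontier_eq]
    constructor
    · have hcont : Tendsto (fun r : ℝ => hyperplaneEquiv n hn (y, r)) (𝓝[>] (γ y))
          (𝓝 (graphMap n hn γ y)) :=
        (((hyperplaneEquiv n hn).continuous.comp (Continuous.prodMk_right y)).tendsto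
          (γ y)).mono_left nhdsWithin_le_nhds
      refine mem_closure_of_tendsto hcont ?_
      have h1 : ∀ᶠ r in 𝓝[>] (γ y), hyperplaneEquiv n hn (y, r) ∈ graphRegion n hn W a b :=
        hcont.eventually (h.isOpen_graphRegion.mem_nhds hB)
      filter_upwards [h1, self_mem_nhdsWithin] with r hr1 hr2
      have : hyperplaneEquiv n hn (y, r) ∈ Ω ∩ graphRegion n hn W a b := by
        rw [h.inter_eq]
        exact ⟨hr1, by simpa using hr2⟩
      exact this.1
    · rw [h.mem_iff _ hB, h.graphMap_eq_zero hy]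
      exact lt_irrefl 0

lemma contDiffOn_graphMap : ContDiffOn ℝ 1 (graphMap n hn γ) W :=
  (hyperplaneEquiv n hn).contDiff.comp_contDiffOn (contDiffOn_id.prodMk h.box.contDiffOn)

lemma fderiv_box {q : (ℝ ∙ n)ᗮ × ℝ} (hq : q ∈ W ×ˢ Ioo a b) (d : (ℝ ∙ n)ᗮ × ℝ) :
    fderiv ℝ (fun q => g (hyperplaneEquiv n hn q)) q d =
      inner ℝ (gradient g (hyperplaneEquiv n hn q)) (hyperplaneEquiv n hn d) := by
  have hmem : hyperplaneEquiv n hn q ∈ graphRegion n hn W a b := by simpa [graphRegion] using hq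
  have h1 := ((h.contDiffAt _ hmem).differentiableAt one_ne_zero).hasFDerivAt
  have h2 : fderiv ℝ (fun q => g (hyperplaneEquiv n hn q)) q = _ :=
    (h1.comp q (hyperplaneEquiv n hn).hasFDerivAt).fderiv
  rw [h2, inner_gradient_apply]
  rfl

lemma inner_gradient_neg {y : (ℝ ∙ n)ᗮ} (hy : y ∈ W) :
    inner ℝ (gradient g (graphMap n hn γ y)) n < 0 := by
  have h1 := h.box.deriv_neg y hy (γ y) (h.box.mem y hy)
  rw [h.fderiv_box ⟨hy, h.box.mem y hy⟩, hyperplaneEquiv_apply n hn (0, 1)] at h1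
  simp only [ZeroMemClass.coe_zero, one_smul, zero_add] at h1
  exact h1

lemma gradient_ne_zero {y : (ℝ ∙ n)ᗮ} (hy : y ∈ W) : gradient g (graphMap n hn γ y) ≠ 0 := by
  intro h0
  have := h.inner_gradient_neg hy
  rw [h0, inner_zero_left] at this
  exact lt_irrefl _ this

lemma fderiv_graph_apply {y : (ℝ ∙ n)ᗮ} (hy : y ∈ W) (v : (ℝ ∙ n)ᗮ) :
    fderiv ℝ γ y v = -(inner ℝ (gradient g (graphMap n hn γ y)) (v : Space N) /
      inner ℝ (gradient g (graphMap n hn γ y)) n) := by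
  have h1 := h.box.fderiv_graph y hy v
  rw [h.fderiv_box ⟨hy, h.box.mem y hy⟩,
    hyperplaneEquiv_apply n hn (v, fderiv ℝ γ y v)] at h1
  simp only [inner_add_right, inner_smul_right] at h1
  have h2 := (h.inner_gradient_neg hy).ne
  change inner ℝ (gradient g (graphMap n hn γ y)) (v : Space N) +
    fderiv ℝ γ y v * inner ℝ (gradient g (graphMap n hn γ y)) n = 0 at h1
  field_simp
  linarith

lemma fderiv_graphMap {y : (ℝ ∙ n)ᗮ} (hy : y ∈ W) (v : (ℝ ∙ n)ᗮ) :
    fderiv ℝ (graphMap n hn γ) y v = (v : Space N) -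
      (inner ℝ (gradient g (graphMap n hn γ y)) (v : Space N) /
        inner ℝ (gradient g (graphMap n hn γ y)) n) • n := by
  have h1 : HasFDerivAt γ (fderiv ℝ γ y) y :=
    ((h.box.contDiffOn.contDiffAt (h.box.isOpen.mem_nhds hy)).differentiableAt one_ne_zero).hasFDerivAt
  have h2 : HasFDerivAt (fun y => (y, γ y)) _ y := (hasFDerivAt_id y).prodMk h1
  have h3 : fderiv ℝ (graphMap n hn γ) y = _ :=
    (HasFDerivAt.comp y (hyperplaneEquiv n hn).hasFDerivAt h2).fderiv
  rw [h3]
  change hyperplaneEquiv n hn (v, fderiv ℝ γ y v) = _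
  rw [hyperplaneEquiv_apply, h.fderiv_graph_apply hy, neg_smul, sub_eq_add_neg]

lemma fderiv_graphMap_injective {y : (ℝ ∙ n)ᗮ} (hy : y ∈ W) :
    Function.Injective (fderiv ℝ (graphMap n hn γ) y) := by
  rw [injective_iff_map_eq_zero]
  intro v hv
  rw [h.fderiv_graphMap hy] at hv
  have h1 : hyperplaneEquiv n hn (v, -(inner ℝ (gradient g (graphMap n hn γ y)) (v : Space N) /
        inner ℝ (gradient g (graphMap n hn γ y)) n)) = 0 := by
    rw [hyperplaneEquiv_apply, neg_smul, ← sub_eq_add_neg]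
    exact hv
  rw [map_eq_zero_iff _ (hyperplaneEquiv n hn).injective] at h1
  exact congrArg Prod.fst h1

lemma normDet_graphMap {y : (ℝ ∙ n)ᗮ} (hy : y ∈ W) :
    (fderiv ℝ (graphMap n hn γ) y : (ℝ ∙ n)ᗮ →ₗ[ℝ] Space N).normDet =
      ‖gradient g (graphMap n hn γ y)‖ / |inner ℝ (gradient g (graphMap n hn γ y)) n| :=
  normDet_graph hn (h.inner_gradient_neg hy).ne (h.fderiv_graphMap hy)

/-- The conormal of the lateral boundary of the space-time cylinder over `Ω`. -/
lemma graphConormal_eq {y : (ℝ ∙ n)ᗮ} (hy : y ∈ W) (s : ℝ) (v : SpaceTime N) :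
    graphConormal (hyperplaneTimeEquiv n hn) (fun z : (ℝ ∙ n)ᗮ × ℝ => γ z.1) (y, s) v =
      -((fderiv ℝ (graphMap n hn γ) y : (ℝ ∙ n)ᗮ →ₗ[ℝ] Space N).normDet *
        inner ℝ (‖gradient g (graphMap n hn γ y)‖⁻¹ • gradient g (graphMap n hn γ y)) v.1) := by
  have h1 : HasFDerivAt γ (fderiv ℝ γ y) y :=
    ((h.box.contDiffOn.contDiffAt (h.box.isOpen.mem_nhds hy)).differentiableAt one_ne_zero).hasFDerivAt
  have h2 : fderiv ℝ (fun z : (ℝ ∙ n)ᗮ × ℝ => γ z.1) (y, s) = _ :=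
    (HasFDerivAt.comp (y, s) h1 hasFDerivAt_fst).fderiv
  rw [graphConormal_apply, h2, h.normDet_graphMap hy, hyperplaneTimeEquiv_symm_apply,
    hyperplaneEquiv_symm_apply]
  set w := gradient g (graphMap n hn γ y) with hw
  set P : (ℝ ∙ n)ᗮ := (ℝ ∙ n)ᗮ.orthogonalProjectionOnto v.1 with hP
  change inner ℝ n v.1 - fderiv ℝ γ y P = _
  have h3 : inner ℝ w v.1 = inner ℝ w (P : Space N) + inner ℝ n v.1 * inner ℝ w n := by
    conv_lhs => rw [← orthogonalProjectionOnto_add_inner_smul hn v.1]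
    rw [inner_add_right, inner_smul_right]
  have h4 : inner ℝ w n < 0 := h.inner_gradient_neg hy
  have h5 : ‖w‖ ≠ 0 := norm_ne_zero_iff.2 (h.gradient_ne_zero hy)
  rw [h.fderiv_graph_apply hy, ← hw, abs_of_neg h4, inner_smul_left, h3]
  have h6 := h4.ne
  simp only [conj_trivial]
  field_simp
  ring

end IsBoundaryChart

/-! ### The flux of energy through the boundary -/

lemma finrank_orthogonal_singleton {N : ℕ} {n : Space N} (hn : ‖n‖ = 1) :
    Module.finrank ℝ (ℝ ∙ n)ᗮ = N - 1 := by
  have hn0 : n ≠ 0 := by rintro rfl; simp at hn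
  have h1 := (ℝ ∙ n).finrank_add_finrank_orthogonal
  rw [finrank_span_singleton hn0, finrank_euclideanSpace_fin] at h1
  omega

/-- The product of the surface measure of the boundary of `Ω` and of Lebesgue measure on `(0, t]`. -/
def boundaryMeasure {N : ℕ} (Ω : Set (Space N)) (t : ℝ) : Measure (SpaceTime N) :=
  ((Measure.euclideanHausdorffMeasure (N - 1)).restrict (frontier Ω)).prod
    (volume.restrict (Ioc (0 : ℝ) t))

section Chart

variable {N : ℕ} {Ω : Set (Space N)} {g : Space N → ℝ} {n : Space N} {hn : ‖n‖ = 1}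
  {γ : (ℝ ∙ n)ᗮ → ℝ} {W : Set (ℝ ∙ n)ᗮ} {a b : ℝ}

namespace IsBoundaryChart

lemma measurable_proj : Measurable fun x : Space N => ((hyperplaneEquiv n hn).symm x).1 :=
  (continuous_fst.comp (hyperplaneEquiv n hn).symm.continuous).measurable

lemma proj_graphMap (y : (ℝ ∙ n)ᗮ) : ((hyperplaneEquiv n hn).symm (graphMap n hn γ y)).1 = y := by
  rw [symm_graphMap]

/-- Projecting space orthogonally onto the hyperplane and keeping time is a 1-Lipschitz map into a
space of dimension `N`; there the image of `Z` is null, whatever the graph. -/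
lemma ae_notMem_of_hausdorffMeasure (hN : 1 ≤ N) (hn : ‖n‖ = 1) (γ : (ℝ ∙ n)ᗮ → ℝ)
    {Z : Set (SpaceTime N)}
    (hZ : Measure.hausdorffMeasure (N : ℝ) Z = 0) :
    ∀ᵐ q ∂(volume : Measure (ℝ ∙ n)ᗮ).prod (volume : Measure ℝ), (graphMap n hn γ q.1, q.2) ∉ Z := by
  set ψ : SpaceTime N → (ℝ ∙ n)ᗮ × ℝ := fun q => ((ℝ ∙ n)ᗮ.orthogonalProjectionOnto q.1, q.2) with hψ
  have hlip : LipschitzWith 1 ψ := by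
    refine LipschitzWith.of_dist_le_mul fun p q => ?_
    rw [NNReal.coe_one, one_mul, Prod.dist_eq, Prod.dist_eq]
    refine max_le_max ?_ le_rfl
    rw [dist_eq_norm, dist_eq_norm, hψ]
    simp only
    rw [← map_sub]
    exact ((ℝ ∙ n)ᗮ.orthogonalProjectionOnto.le_of_opNorm_le
      (Submodule.orthogonalProjectionOnto_norm_le _) _).trans (by rw [one_mul])
  have h1 := hlip.hausdorffMeasure_image_le (d := (N : ℝ)) (by positivity) Z
  rw [hZ, mul_zero, nonpos_iff_eq_zero] at h1
  have hfin : Module.finrank ℝ ((ℝ ∙ n)ᗮ × ℝ) = N := by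
    rw [Module.finrank_prod, finrank_orthogonal_singleton hn, Module.finrank_self]
    omega
  have h2 : ((volume : Measure (ℝ ∙ n)ᗮ).prod (volume : Measure ℝ)) (ψ '' Z) = 0 := by
    -- With the maximum norm on the product this measure is used only as a Haar measure; absolute
    -- continuity is enough.
    have h3 : (Measure.hausdorffMeasure (N : ℝ) :
        Measure ((ℝ ∙ n)ᗮ × ℝ)).IsAddHaarMeasure := by
      have h4 := isAddHaarMeasure_hausdorffMeasure (E := (ℝ ∙ n)ᗮ × ℝ)
      rwa [hfin] at h4
    exact (Measure.absolutelyContinuous_isAddHaarMeasure _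
      (Measure.hausdorffMeasure (N : ℝ) : Measure ((ℝ ∙ n)ᗮ × ℝ))) h1
  filter_upwards [measure_eq_zero_iff_ae_notMem.1 h2] with q hq hqZ
  refine hq ⟨_, hqZ, ?_⟩
  have := proj_graphMap (n := n) (hn := hn) (γ := γ) q.1
  rw [hyperplaneEquiv_symm_apply] at this
  exact Prod.ext this rfl

variable (h : IsBoundaryChart Ω g n hn γ W a b)
include h

lemma measurableSet_piece : MeasurableSet (frontier Ω ∩ graphRegion n hn W a b) :=
  isClosed_frontier.measurableSet.inter h.isOpen_graphRegion.measurableSet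

/-- With `K = 2`, the image of a small ball has area at most a constant times its volume. -/
lemma finiteAtFilter (hΩ : IsOpen Ω) {x₀ : Space N} (hx₀ : x₀ ∈ frontier Ω)
    (hx₀B : x₀ ∈ graphRegion n hn W a b) :
    (Measure.euclideanHausdorffMeasure (N - 1)).FiniteAtFilter (𝓝[frontier Ω] x₀) := by
  obtain ⟨y, hy, rfl⟩ := (h.frontier_inter hΩ).le ⟨hx₀, hx₀B⟩
  have hC : ContDiffAt ℝ 1 (graphMap n hn γ) y :=
    h.contDiffOn_graphMap.contDiffAt (h.box.isOpen.mem_nhds hy)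
  obtain ⟨B, hB, harea⟩ := exists_nhds_area (hC.hasStrictFDerivAt one_ne_zero)
    (h.fderiv_graphMap_injective hy) (K := 2) one_lt_two
  set B' := B ∩ Metric.ball y 1 with hB'
  have h1 := (harea B' inter_subset_left).1
  rw [finrank_orthogonal_singleton hn] at h1
  refine ⟨graphMap n hn γ '' B', ?_, h1.trans_lt ?_⟩
  · have h2 : (fun x => ((hyperplaneEquiv n hn).symm x).1) ⁻¹' B' ∈ 𝓝 (graphMap n hn γ y) := by
      refine (continuous_fst.comp (hyperplaneEquiv n hn).symm.continuous).continuousAt.preimage_mem_nhds ?_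
      change B' ∈ 𝓝 ((hyperplaneEquiv n hn).symm (graphMap n hn γ y)).1
      rw [proj_graphMap]
      exact inter_mem hB (Metric.ball_mem_nhds y one_pos)
    have h3 := inter_mem_nhdsWithin (frontier Ω)
      (inter_mem h2 (h.isOpen_graphRegion.mem_nhds hx₀B))
    refine mem_of_superset h3 ?_
    rintro x ⟨hx1, hx2, hx3⟩
    obtain ⟨z, hz, rfl⟩ := (h.frontier_inter hΩ).le ⟨hx1, hx3⟩
    rw [mem_preimage, proj_graphMap] at hx2
    exact mem_image_of_mem _ hx2
  · refine ENNReal.mul_lt_top (by simp) (ENNReal.mul_lt_top (by simp) ?_)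
    exact (measure_mono inter_subset_right).trans_lt measure_ball_lt_top

end IsBoundaryChart

end Chart

section

variable {N : ℕ} {Ω : Set (Space N)}

lemma IsLyapunovDomain.isFiniteMeasure_restrict_frontier (hΩ : IsLyapunovDomain Ω) :
    IsFiniteMeasure ((Measure.euclideanHausdorffMeasure (N - 1) : Measure (Space N)).restrict
      (frontier Ω)) := by
  have hcomp : IsCompact (frontier Ω) :=
    hΩ.isBounded.isCompact_closure.of_isClosed_subset isClosed_frontier frontier_subset_closure
  refine ⟨?_⟩
  rw [Measure.restrict_apply_univ]
  refine hcomp.measure_lt_top_of_nhdsWithin fun x hx => ?_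
  obtain ⟨g, n, hn, γ, W, a, b, h, hxB⟩ := hΩ.exists_isBoundaryChart hx
  exact h.finiteAtFilter hΩ.isOpen hx hxB

lemma IsLyapunovDomain.isFiniteMeasure_boundaryMeasure (hΩ : IsLyapunovDomain Ω) (t : ℝ) :
    IsFiniteMeasure (boundaryMeasure Ω t) := by
  have := hΩ.isFiniteMeasure_restrict_frontier
  have : IsFiniteMeasure ((volume : Measure ℝ).restrict (Ioc (0 : ℝ) t)) := ⟨by simp⟩
  unfold boundaryMeasure
  infer_instance

end

namespace IsBoundaryChart

variable {N : ℕ} {Ω : Set (Space N)} {g : Space N → ℝ} {n : Space N} {hn : ‖n‖ = 1}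
  {γ : (ℝ ∙ n)ᗮ → ℝ} {W : Set (ℝ ∙ n)ᗮ} {a b : ℝ}
  (h : IsBoundaryChart Ω g n hn γ W a b)
include h

lemma restrict_boundaryMeasure (hΩ : IsLyapunovDomain Ω) (t : ℝ) :
    (boundaryMeasure Ω t).restrict (graphRegion n hn W a b ×ˢ univ) =
      ((Measure.euclideanHausdorffMeasure (Module.finrank ℝ (ℝ ∙ n)ᗮ)).restrict
        (graphMap n hn γ '' W)).prod (volume.restrict (Ioc (0 : ℝ) t)) := by
  have := hΩ.isFiniteMeasure_restrict_frontier
  rw [boundaryMeasure, ← Measure.prod_restrict, Measure.restrict_univ,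
    Measure.restrict_restrict h.isOpen_graphRegion.measurableSet, inter_comm,
    h.frontier_inter hΩ.isOpen, finrank_orthogonal_singleton hn]

lemma boundaryMeasure_null (hN : 1 ≤ N) (hΩ : IsLyapunovDomain Ω) (t : ℝ) {Z : Set (SpaceTime N)}
    (hZc : IsClosed Z) (hZ : Measure.hausdorffMeasure (N : ℝ) Z = 0) :
    (boundaryMeasure Ω t).restrict (graphRegion n hn W a b ×ˢ univ) Z = 0 := by
  rw [h.restrict_boundaryMeasure hΩ]
  refine prod_restrict_image_null h.box.isOpen h.contDiffOn_graphMap measurable_proj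
    (fun y _ => proj_graphMap y) (fun y hy => h.fderiv_graphMap_injective hy) hZc.measurableSet ?_
  rw [Measure.prod_restrict]
  exact ae_restrict_of_ae (ae_notMem_of_hausdorffMeasure hN hn γ hZ)

end IsBoundaryChart

lemma ae_boundaryMeasure_mem {N : ℕ} {Ω : Set (Space N)} (hΩ : IsLyapunovDomain Ω) (t : ℝ) :
    ∀ᵐ q ∂boundaryMeasure Ω t, q.1 ∈ frontier Ω ∧ q.2 ∈ Ioc (0 : ℝ) t := by
  have := hΩ.isFiniteMeasure_restrict_frontier
  have h1 : ∀ᵐ x ∂(Measure.euclideanHausdorffMeasure (N - 1) : Measure (Space N)).restrict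
      (frontier Ω), x ∈ frontier Ω := ae_restrict_mem isClosed_frontier.measurableSet
  have h2 : ∀ᵐ s ∂(volume : Measure ℝ).restrict (Ioc (0 : ℝ) t), s ∈ Ioc (0 : ℝ) t :=
    ae_restrict_mem measurableSet_Ioc
  filter_upwards [Measure.quasiMeasurePreserving_fst.ae h1,
    Measure.quasiMeasurePreserving_snd.ae h2] with q hq1 hq2 using ⟨hq1, hq2⟩

/-! ### Boundary data of a classical solution. -/

namespace IsClassicalSolution

variable {N : ℕ} {c : ℝ} {Ω : Set (Space N)} {G : SpaceTime N → ℝ} {u₀ v₀ : Space N → ℝ}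
  {uS p : Space N → ℝ → ℝ} {F : ℕ → Set (SpaceTime N)} {Z : Set (SpaceTime N)}
  {u : SpaceTime N → ℝ}

section

variable (hu : IsClassicalSolution c Ω G u₀ v₀ uS p F Z u)
include hu

/-- Fronts lie in the open cylinder, so on the lateral boundary only `Z` is singular. -/
lemma frontier_mem_regular (hΩ : IsOpen Ω) {x : Space N} (hx : x ∈ frontier Ω) {s : ℝ} (hs : 0 ≤ s)
    (hZ : (x, s) ∉ Z) : (x, s) ∈ closedCylinder Ω \ (Z ∪ ⋃ k, F k) := by
  refine ⟨⟨frontier_subset_closure hx, hs⟩, ?_⟩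
  rintro (h | h)
  · exact hZ h
  · obtain ⟨k, hk⟩ := mem_iUnion.1 h
    rw [hΩ.frontier_eq] at hx
    exact hx.2 (hu.front_subset k hk).1

/-- The time direction stays in the lateral boundary, so the boundary values can be differentiated
by the chain rule within the cylinder. -/
lemma deriv_boundary_value (hΩ : IsOpen Ω) {x : Space N} (hx : x ∈ frontier Ω) {s : ℝ} (hs : 0 < s)
    (hZ : (x, s) ∉ Z) : deriv (uS x) s = velocity Ω u (x, s) := by
  have h1 := (hu.differentiableWithinAt _ (hu.frontier_mem_regular hΩ hx hs.le hZ)).hasFDerivWithinAt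
  have h2 : HasDerivAt (fun r : ℝ => (x, r)) ((0 : Space N), (1 : ℝ)) s :=
    (hasDerivAt_const s x).prodMk (hasDerivAt_id s)
  have h3 : HasDerivWithinAt (fun r : ℝ => u (x, r)) (velocity Ω u (x, s)) (Ioi 0) s :=
    h1.comp_hasDerivWithinAt s h2.hasDerivWithinAt
      fun r hr => ⟨frontier_subset_closure hx, (mem_Ioi.1 hr).le⟩
  have h4 : HasDerivAt (fun r : ℝ => u (x, r)) (velocity Ω u (x, s)) s :=
    h3.hasDerivAt (Ioi_mem_nhds hs)
  refine (h4.congr_of_eventuallyEq ?_).deriv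
  filter_upwards [Ioi_mem_nhds hs] with r hr using (hu.boundary_value x hx r (le_of_lt hr)).symm

end

section

variable (hu : IsClassicalSolution c Ω G u₀ v₀ uS p F Z u)
  {g : Space N → ℝ} {n : Space N} {hn : ‖n‖ = 1}
  {γ : (ℝ ∙ n)ᗮ → ℝ} {W : Set (ℝ ∙ n)ᗮ} {a b : ℝ} (h : IsBoundaryChart Ω g n hn γ W a b)
include hu h

lemma boundary_flux_eq (hΩ : IsOpen Ω) {y : (ℝ ∙ n)ᗮ} (hy : y ∈ W) {s : ℝ} (hs : 0 < s)
    (hZ : (graphMap n hn γ y, s) ∉ Z) :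
    deriv (uS (graphMap n hn γ y)) s * p (graphMap n hn γ y) s =
      velocity Ω u (graphMap n hn γ y, s) * spaceDeriv Ω u (graphMap n hn γ y, s)
        (‖gradient g (graphMap n hn γ y)‖⁻¹ • gradient g (graphMap n hn γ y)) := by
  have hx : graphMap n hn γ y ∈ frontier Ω :=
    ((h.frontier_inter hΩ).ge (mem_image_of_mem _ hy)).1
  rw [hu.deriv_boundary_value hΩ hx hs hZ]
  rw [hu.boundary_normal_deriv _ hx s hs.le hZ _ (h.normal _ (h.graphMap_mem hy)
    (h.graphMap_eq_zero hy) (h.gradient_ne_zero hy))]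

/-- The derivative is continuous up to regular boundary points. The conormal of the lateral boundary
is minus the area element times the outer normal, which applied to -u_t ∇u gives u_t ∂u/∂n times the
area element. -/
lemma tendsto_conormal_boundary (hΩ : IsOpen Ω) {y : (ℝ ∙ n)ᗮ} (hy : y ∈ W) {s : ℝ} (hs : 0 < s)
    (hZ : (graphMap n hn γ y, s) ∉ Z) :
    Tendsto (fun r => graphConormal (hyperplaneTimeEquiv n hn) (fun z : (ℝ ∙ n)ᗮ × ℝ => γ z.1) (y, s)
        (energyFluxField c Ω u (hyperplaneTimeEquiv n hn ((y, s), γ y + r))))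
      (𝓝[{r | 0 < r ∧ hyperplaneTimeEquiv n hn ((y, s), γ y + r) ∉ Z ∪ ⋃ k, F k}] 0)
      (𝓝 ((fderiv ℝ (graphMap n hn γ) y : (ℝ ∙ n)ᗮ →ₗ[ℝ] Space N).normDet *
        (deriv (uS (graphMap n hn γ y)) s * p (graphMap n hn γ y) s))) := by
  have hx : graphMap n hn γ y ∈ frontier Ω :=
    ((h.frontier_inter hΩ).ge (mem_image_of_mem _ hy)).1
  have hlim : (fderiv ℝ (graphMap n hn γ) y : (ℝ ∙ n)ᗮ →ₗ[ℝ] Space N).normDet *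
        (deriv (uS (graphMap n hn γ y)) s * p (graphMap n hn γ y) s) =
      graphConormal (hyperplaneTimeEquiv n hn) (fun z : (ℝ ∙ n)ᗮ × ℝ => γ z.1) (y, s)
        (energyFlux c (cylDeriv Ω u (graphMap n hn γ y, s))) := by
    rw [hu.boundary_flux_eq h hΩ hy hs hZ, h.graphConormal_eq hy]
    simp only [energyFlux, inner_neg_right, inner_smul_right]
    rw [real_inner_comm, inner_spacePart]
    simp only [velocity, spaceDeriv]
    ring
  rw [hlim]
  refine ((graphConormal (hyperplaneTimeEquiv n hn) (fun z : (ℝ ∙ n)ᗮ × ℝ => γ z.1)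
    (y, s)).continuous.tendsto _).comp ((continuous_energyFlux.tendsto _).comp ?_)
  have hreg := hu.frontier_mem_regular hΩ hx hs.le hZ
  refine Tendsto.comp (hu.continuousOn_deriv _ hreg) ?_
  have hc : Continuous fun r : ℝ => hyperplaneTimeEquiv n hn ((y, s), γ y + r) :=
    (hyperplaneTimeEquiv n hn).continuous.comp (by fun_prop)
  have hc0 : Tendsto (fun r : ℝ => hyperplaneTimeEquiv n hn ((y, s), γ y + r)) (𝓝 0)
      (𝓝 (graphMap n hn γ y, s)) := hc.tendsto' 0 _ (by
    rw [hyperplaneTimeEquiv_apply]; simp [graphMap])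
  refine tendsto_nhdsWithin_iff.2 ⟨hc0.mono_left nhdsWithin_le_nhds, ?_⟩
  have h1 : ∀ᶠ r in 𝓝 (0 : ℝ), (hyperplaneTimeEquiv n hn ((y, s), γ y + r)).1 ∈
      graphRegion n hn W a b :=
    (continuous_fst.tendsto _).comp hc0 |>.eventually
      (h.isOpen_graphRegion.mem_nhds (h.graphMap_mem hy))
  filter_upwards [nhdsWithin_le_nhds h1, self_mem_nhdsWithin] with r hr1 hr2
  refine ⟨⟨subset_closure ?_, hs.le⟩, hr2.2⟩
  have : (hyperplaneTimeEquiv n hn ((y, s), γ y + r)).1 ∈ Ω ∩ graphRegion n hn W a b := by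
    rw [h.inter_eq]
    refine ⟨hr1, ?_⟩
    rw [hyperplaneTimeEquiv_apply, ContinuousLinearEquiv.symm_apply_apply]
    simpa using hr2.1
  exact this.1

end

end IsClassicalSolution

/-! ### Energy balance up to the lateral boundary. -/

namespace IsClassicalSolution

variable {N : ℕ} {c : ℝ} {Ω : Set (Space N)} {G : SpaceTime N → ℝ} {u₀ v₀ : Space N → ℝ}
  {uS p : Space N → ℝ → ℝ} {F : ℕ → Set (SpaceTime N)} {Z : Set (SpaceTime N)}
  {u : SpaceTime N → ℝ}

section

variable (hu : IsClassicalSolution c Ω G u₀ v₀ uS p F Z u)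
include hu

/-- No measurability of the data is given. On the set `D` of full measure the integrand equals the
product of `u_t` and the normal derivative, which is continuous there and bounded. -/
lemma integrableOn_boundary_flux_graphRegion (hN : 1 ≤ N) (hΩ : IsLyapunovDomain Ω) (t : ℝ)
    {g : Space N → ℝ} {n : Space N} {hn : ‖n‖ = 1}
    {γ : (ℝ ∙ n)ᗮ → ℝ} {W : Set (ℝ ∙ n)ᗮ} {a b : ℝ} (h : IsBoundaryChart Ω g n hn γ W a b) :
    IntegrableOn (fun q : SpaceTime N => deriv (uS q.1) q.2 * p q.1 q.2)
      (graphRegion n hn W a b ×ˢ univ) (boundaryMeasure Ω t) := by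
  have := hΩ.isFiniteMeasure_boundaryMeasure t
  set μ := (boundaryMeasure Ω t).restrict (graphRegion n hn W a b ×ˢ univ) with hμ
  set D : Set (SpaceTime N) :=
    ((frontier Ω ∩ graphRegion n hn W a b) ×ˢ Ioc (0 : ℝ) t) \ Z with hD
  have hDm : MeasurableSet D :=
    (h.measurableSet_piece.prod measurableSet_Ioc).diff hu.isClosed_exceptional.measurableSet
  have hae : ∀ᵐ q ∂μ, q ∈ D := by
    have h1 : ∀ᵐ q ∂μ, q ∈ graphRegion n hn W a b ×ˢ (univ : Set ℝ) :=
      ae_restrict_mem (h.isOpen_graphRegion.measurableSet.prod MeasurableSet.univ)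
    filter_upwards [h1, ae_restrict_of_ae (ae_boundaryMeasure_mem hΩ t),
      measure_eq_zero_iff_ae_notMem.1 (h.boundaryMeasure_null hN hΩ t hu.isClosed_exceptional
        hu.exceptional_null)] with q hq1 hq2 hq3
    exact ⟨⟨⟨hq2.1, hq1.1⟩, hq2.2⟩, hq3⟩
  set ν : Space N → Space N := fun x => ‖gradient g x‖⁻¹ • gradient g x with hν
  have hDy : ∀ q ∈ D, ∃ y ∈ W, graphMap n hn γ y = q.1 := fun q hq =>
    (h.frontier_inter hΩ.isOpen).le hq.1.1
  have hDreg : ∀ q ∈ D, q ∈ closedCylinder Ω \ (Z ∪ ⋃ k, F k) := fun q hq =>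
    hu.frontier_mem_regular hΩ.isOpen hq.1.1.1 hq.1.2.1.le hq.2
  have heq : ∀ q ∈ D, deriv (uS q.1) q.2 * p q.1 q.2 =
      velocity Ω u q * spaceDeriv Ω u q (ν q.1) := by
    intro q hq
    obtain ⟨y, hy, hyq⟩ := hDy q hq
    have h1 := hu.boundary_flux_eq h hΩ.isOpen hy hq.1.2.1 (by rw [hyq]; exact hq.2)
    rw [hyq] at h1
    exact h1
  have hνne : ∀ q ∈ D, ‖gradient g q.1‖ ≠ 0 := by
    intro q hq
    obtain ⟨y, hy, hyq⟩ := hDy q hq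
    rw [← hyq]
    exact norm_ne_zero_iff.2 (h.gradient_ne_zero hy)
  have hνc : ContinuousOn (fun q : SpaceTime N => ν q.1) D := by
    have h1 : ContinuousOn (fun q : SpaceTime N => gradient g q.1) D := by
      intro q hq
      have h2 : ContinuousAt (gradient g) q.1 :=
        (InnerProductSpace.toDual ℝ (Space N)).symm.continuous.continuousAt.comp
          ((h.contDiffAt q.1 hq.1.1.2).fderiv_right (m := 0) (by simp)).continuousAt
      exact (h2.comp continuous_fst.continuousAt).continuousWithinAt
    exact (h1.norm.inv₀ hνne).smul h1
  have hdc : ContinuousOn (cylDeriv Ω u) D := hu.continuousOn_deriv.mono hDreg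
  have hbc : ContinuousOn (fun q => velocity Ω u q * spaceDeriv Ω u q (ν q.1)) D :=
    (hdc.clm_apply continuousOn_const).mul (hdc.clm_apply (hνc.prodMk continuousOn_const))
  have hres : μ.restrict D = μ := Measure.restrict_eq_self_of_ae_mem hae
  obtain ⟨M, hM⟩ := hu.bounded_deriv t
  refine Integrable.mono' (g := fun _ => M * M) (integrable_const _) ?_ ?_
  · rw [← hμ, ← hres]
    refine (hbc.aestronglyMeasurable hDm).congr ?_
    filter_upwards [ae_restrict_mem hDm] with q hq using (heq q hq).symm
  · filter_upwards [hae] with q hq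
    rw [heq q hq, norm_mul]
    have h1 := hM q (hDreg q hq) hq.1.2.2
    have h0 : 0 ≤ M := (norm_nonneg _).trans h1
    have h2 : ‖((0 : Space N), (1 : ℝ))‖ = 1 := by simp [Prod.norm_def]
    have h3 : ‖(ν q.1, (0 : ℝ))‖ = 1 := by
      simp [Prod.norm_def, hν, norm_smul, inv_mul_cancel₀ (hνne q hq)]
    have h4 : ‖velocity Ω u q‖ ≤ M := by
      have := (cylDeriv Ω u q).le_of_opNorm_le h1 ((0 : Space N), (1 : ℝ))
      rwa [h2, mul_one] at this
    have h5 : ‖spaceDeriv Ω u q (ν q.1)‖ ≤ M := by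
      have := (cylDeriv Ω u q).le_of_opNorm_le h1 (ν q.1, (0 : ℝ))
      rwa [h3, mul_one] at this
    exact mul_le_mul h4 h5 (norm_nonneg _) h0

theorem integrable_boundary_flux (hN : 1 ≤ N) (hΩ : IsLyapunovDomain Ω) (t : ℝ) :
    Integrable (fun q : SpaceTime N => deriv (uS q.1) q.2 * p q.1 q.2) (boundaryMeasure Ω t) := by
  have hcomp : IsCompact (frontier Ω ×ˢ Icc (0 : ℝ) t) :=
    (hΩ.isBounded.isCompact_closure.of_isClosed_subset isClosed_frontier
      frontier_subset_closure).prod isCompact_Icc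
  have h1 : IntegrableOn (fun q : SpaceTime N => deriv (uS q.1) q.2 * p q.1 q.2)
      (frontier Ω ×ˢ Icc (0 : ℝ) t) (boundaryMeasure Ω t) := by
    refine LocallyIntegrableOn.integrableOn_isCompact (fun q hq => ?_) hcomp
    obtain ⟨g, n, hn, γ, W, a, b, h, hqB⟩ := hΩ.exists_isBoundaryChart hq.1
    refine ⟨graphRegion n hn W a b ×ˢ univ, mem_nhdsWithin_of_mem_nhds ?_,
      hu.integrableOn_boundary_flux_graphRegion hN hΩ t h⟩
    exact (h.isOpen_graphRegion.prod isOpen_univ).mem_nhds ⟨hqB, mem_univ _⟩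
  rw [IntegrableOn, Measure.restrict_eq_self_of_ae_mem] at h1
  · exact h1
  · filter_upwards [ae_boundaryMeasure_mem hΩ t] with q hq using ⟨hq.1, Ioc_subset_Icc_self hq.2⟩

/-- The surface term of `integral_above_graph` carries the area element of the graph, and this turns
the integral over the parameters into one for the surface measure. -/
lemma integral_chart (hN : 1 ≤ N) (hΩ : IsLyapunovDomain Ω) (hc : 0 < c) {t : ℝ}
    (hG : IntegrableOn G (Ω ×ˢ Ioc (0 : ℝ) t))
    {g : Space N → ℝ} {n : Space N} {hn : ‖n‖ = 1}
    {γ : (ℝ ∙ n)ᗮ → ℝ} {W : Set (ℝ ∙ n)ᗮ} {a b : ℝ} (h : IsBoundaryChart Ω g n hn γ W a b)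
    {φ : SpaceTime N → ℝ} (hφ : IsTest (graphRegion n hn W a b ×ˢ Ioo (0 : ℝ) t) φ) :
    ∫ q in Ω ×ˢ Ioo (0 : ℝ) t, (fderiv ℝ φ q (energyFluxField c Ω u q)
      + -(G q * velocity Ω u q) * φ q) =
    -∫ q, φ q * (deriv (uS q.1) q.2 * p q.1 q.2) ∂boundaryMeasure Ω t := by
  set R := graphRegion n hn W a b with hR
  have hRo : IsOpen R := h.isOpen_graphRegion
  set A : Set (SpaceTime N) := (Ω ∩ R) ×ˢ Ioo (0 : ℝ) t with hA
  have hAsub : A ⊆ Ω ×ˢ Ioo (0 : ℝ) t := prod_mono inter_subset_left le_rfl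
  have hsub : Ω ×ˢ Ioo (0 : ℝ) t ⊆ Ω ×ˢ Ioc (0 : ℝ) t := prod_mono le_rfl Ioo_subset_Ioc_self
  have hAsub' := hAsub.trans hsub
  obtain ⟨M, hM⟩ := hu.ae_bound_energyFluxField hc t
  have e1 : ∫ q in Ω ×ˢ Ioo (0 : ℝ) t, (fderiv ℝ φ q (energyFluxField c Ω u q)
      + -(G q * velocity Ω u q) * φ q) =
      ∫ q in A, (fderiv ℝ φ q (energyFluxField c Ω u q) + -(G q * velocity Ω u q) * φ q) := by
    refine setIntegral_eq_of_subset_of_forall_sdiff_eq_zero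
      (hΩ.isOpen.measurableSet.prod measurableSet_Ioo) hAsub fun q hq => ?_
    have : q ∉ R ×ˢ Ioo (0 : ℝ) t := fun hq' => hq.2 ⟨⟨hq.1.1, hq'.1⟩, hq.1.2⟩
    rw [hφ.fderiv_eq_zero this, hφ.eq_zero this]
    simp
  have hvol : (volume : Measure (SpaceTime N)) (Z ∪ ⋃ k, F k) = 0 := hu.volume_singular hc
  have e2 := integral_above_graph (μ := (volume : Measure (SpaceTime N)))
    (ν := (volume : Measure (ℝ ∙ n)ᗮ).prod (volume : Measure ℝ)) (hyperplaneTimeEquiv n hn)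
    (measurePreserving_hyperplaneTimeEquiv n hn) (W := W ×ˢ univ) (h.box.isOpen.prod isOpen_univ)
    (γ := fun z => γ z.1) (h.box.contDiffOn.comp contDiffOn_fst fun z hz => hz.1)
    (A₀ := R ×ˢ Ioo (0 : ℝ) t) (A := A) (hRo.prod isOpen_Ioo) (fun q hq => ⟨hq.1.1, mem_univ _⟩)
    ?_ ((hu.isWeakDiv_cylinder hN hΩ.isOpen hΩ.isBounded hc hG).mono hAsub) (M := M) ?_
    ((hu.integrableOn_energyFluxField hc hΩ.isOpen hΩ.isBounded t).mono_set hAsub')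
    ((hu.integrableOn_mul_velocity hc hΩ.isOpen hG).mono_set hAsub').neg hvol
    (l := fun z => (fderiv ℝ (graphMap n hn γ) z.1 : (ℝ ∙ n)ᗮ →ₗ[ℝ] Space N).normDet *
        (deriv (uS (graphMap n hn γ z.1)) z.2 * p (graphMap n hn γ z.1) z.2)) ?_ hφ
  · rw [e1]
    refine e2.trans ?_
    congr 1
    have hpt : ∀ z : (ℝ ∙ n)ᗮ × ℝ, hyperplaneTimeEquiv n hn (z, γ z.1) = (graphMap n hn γ z.1, z.2) :=
      fun z => rfl
    simp only [hpt]
    have f1 : ∫ q, φ q * (deriv (uS q.1) q.2 * p q.1 q.2) ∂boundaryMeasure Ω t =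
        ∫ q in R ×ˢ univ, φ q * (deriv (uS q.1) q.2 * p q.1 q.2) ∂boundaryMeasure Ω t := by
      refine (setIntegral_eq_integral_of_forall_compl_eq_zero fun q hq => ?_).symm
      rw [hφ.eq_zero fun hq' => hq ⟨hq'.1, mem_univ _⟩, zero_mul]
    have hint : IntegrableOn (fun q : SpaceTime N => φ q * (deriv (uS q.1) q.2 * p q.1 q.2))
        (R ×ˢ univ) (boundaryMeasure Ω t) := by
      obtain ⟨C, -, hC⟩ := hφ.exists_bound
      exact (hu.integrableOn_boundary_flux_graphRegion hN hΩ t h).bdd_mul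
        hφ.contDiff.continuous.aestronglyMeasurable (Eventually.of_forall fun q => (hC q).1)
    have hsm := hint.aestronglyMeasurable
    rw [f1]
    rw [h.restrict_boundaryMeasure hΩ] at hsm ⊢
    rw [integral_restrict_image_prod h.box.isOpen h.contDiffOn_graphMap
      IsBoundaryChart.measurable_proj (fun y _ => IsBoundaryChart.proj_graphMap y)
      (fun y hy => h.fderiv_graphMap_injective hy) hsm, Measure.prod_restrict]
    -- The parameter domains differ only at times outside `(0, t]`, where `φ` vanishes.
    refine (setIntegral_eq_of_subset_of_forall_sdiff_eq_zero
      (h.box.isOpen.measurableSet.prod MeasurableSet.univ) (prod_mono le_rfl (subset_univ _))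
        fun z hz => ?_).trans (integral_congr_ae (Eventually.of_forall fun z => ?_))
    · rw [hφ.eq_zero, zero_mul]
      exact fun hz' => hz.2 ⟨hz.1.1, Ioo_subset_Ioc_self hz'.2⟩
    · simp only
      ring
  · ext q
    constructor
    · rintro ⟨h1, h2⟩
      have := h.inter_eq.le h1
      exact ⟨⟨h1.2, h2⟩, this.2⟩
    · rintro ⟨⟨h1, h2⟩, h3⟩
      exact ⟨h.inter_eq.ge ⟨h1, h3⟩, h2⟩
  · filter_upwards [hM] with q hq hqA
    exact hq (openCylinder_subset_closedCylinder ⟨(hAsub hqA).1, (hAsub hqA).2.1⟩) (hAsub hqA).2.2.le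
  · filter_upwards [IsBoundaryChart.ae_notMem_of_hausdorffMeasure hN hn γ hu.exceptional_null]
      with z hz hzW hzA
    exact hu.tendsto_conormal_boundary h hΩ.isOpen hzW.1 hzA.2.1 hz

/-- The balance of energy, tested by functions vanishing near the bottom and the top of the
cylinder. -/
theorem integral_energyFluxField (hN : 1 ≤ N) (hΩ : IsLyapunovDomain Ω) (hc : 0 < c) {t : ℝ}
    (hG : IntegrableOn G (Ω ×ˢ Ioc (0 : ℝ) t)) {φ : SpaceTime N → ℝ}
    (hφ : IsTest (univ ×ˢ Ioo (0 : ℝ) t) φ) :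
    ∫ q in Ω ×ˢ Ioo (0 : ℝ) t, (fderiv ℝ φ q (energyFluxField c Ω u q)
      + -(G q * velocity Ω u q) * φ q) =
    -∫ q, φ q * (deriv (uS q.1) q.2 * p q.1 q.2) ∂boundaryMeasure Ω t := by
  have hsub : Ω ×ˢ Ioo (0 : ℝ) t ⊆ Ω ×ˢ Ioc (0 : ℝ) t := prod_mono le_rfl Ioo_subset_Ioc_self
  have hV := (hu.integrableOn_energyFluxField hc hΩ.isOpen hΩ.isBounded t).mono_set hsub
  have hh := ((hu.integrableOn_mul_velocity hc hΩ.isOpen hG).mono_set hsub).neg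
  have hb := hu.integrable_boundary_flux hN hΩ t
  have hbφ : ∀ φ : SpaceTime N → ℝ, IsTest (univ ×ˢ Ioo (0 : ℝ) t) φ →
      Integrable (fun q => φ q * (deriv (uS q.1) q.2 * p q.1 q.2)) (boundaryMeasure Ω t) := by
    intro φ hφ
    obtain ⟨C, -, hC⟩ := hφ.exists_bound
    exact hb.bdd_mul hφ.contDiff.continuous.aestronglyMeasurable
      (Eventually.of_forall fun q => (hC q).1)
  refine hφ.induction_local (P := fun φ => ∫ q in Ω ×ˢ Ioo (0 : ℝ) t,
    (fderiv ℝ φ q (energyFluxField c Ω u q) + -(G q * velocity Ω u q) * φ q) =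
      -∫ q, φ q * (deriv (uS q.1) q.2 * p q.1 q.2) ∂boundaryMeasure Ω t) (by simp) ?_ ?_
  · intro φ ψ hφ hψ h1 h2
    have e1 : ∀ q, fderiv ℝ (φ + ψ) q (energyFluxField c Ω u q) +
        -(G q * velocity Ω u q) * (φ + ψ) q =
        (fderiv ℝ φ q (energyFluxField c Ω u q) + -(G q * velocity Ω u q) * φ q) +
        (fderiv ℝ ψ q (energyFluxField c Ω u q) + -(G q * velocity Ω u q) * ψ q) := by
      intro q
      rw [fderiv_add (hφ.differentiable q) (hψ.differentiable q)]
      simp only [add_apply, Pi.add_apply]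
      ring
    have e2 : ∀ q : SpaceTime N, (φ + ψ) q * (deriv (uS q.1) q.2 * p q.1 q.2) =
        φ q * (deriv (uS q.1) q.2 * p q.1 q.2) + ψ q * (deriv (uS q.1) q.2 * p q.1 q.2) := by
      intro q
      rw [Pi.add_apply, add_mul]
    simp only [e1, e2]
    have e3 : ∀ χ : SpaceTime N → ℝ, IsTest (univ ×ˢ Ioo (0 : ℝ) t) χ → IntegrableOn (fun q =>
        fderiv ℝ χ q (energyFluxField c Ω u q) + -(G q * velocity Ω u q) * χ q)
        (Ω ×ˢ Ioo (0 : ℝ) t) := fun χ hχ => (hχ.integrableOn_flux hV).add (hχ.integrableOn_mul hh)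
    rw [integral_add (e3 φ hφ) (e3 ψ hψ), h1, h2, integral_add (hbφ φ hφ) (hbφ ψ hψ)]
    ring
  -- A boundary point has a chart; at a point of Ω the surface term vanishes and the interior
  -- balance applies; outside the closure both sides vanish.
  · rintro ⟨x, s⟩ ⟨-, hs⟩
    have hvanish : ∀ (B : Set (Space N)), Disjoint B (frontier Ω) → ∀ φ : SpaceTime N → ℝ,
        IsTest ((univ ×ˢ Ioo (0 : ℝ) t) ∩ (B ×ˢ univ)) φ →
        ∫ q, φ q * (deriv (uS q.1) q.2 * p q.1 q.2) ∂boundaryMeasure Ω t = 0 := by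
      intro B hB φ hφ
      refine integral_eq_zero_of_ae ?_
      filter_upwards [ae_boundaryMeasure_mem hΩ t] with q hq
      rw [hφ.eq_zero fun hq' => disjoint_left.1 hB hq'.2.1 hq.1, zero_mul]
      rfl
    by_cases hxS : x ∈ frontier Ω
    · obtain ⟨g, n, hn, γ, W, a, b, h, hxB⟩ := hΩ.exists_isBoundaryChart hxS
      refine ⟨graphRegion n hn W a b ×ˢ univ,
        (h.isOpen_graphRegion.prod isOpen_univ).mem_nhds ⟨hxB, mem_univ _⟩, fun φ hφ => ?_⟩
      exact hu.integral_chart hN hΩ hc hG h (hφ.mono fun q hq => ⟨hq.2.1, hq.1.2⟩)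
    · by_cases hxΩ : x ∈ Ω
      · refine ⟨Ω ×ˢ univ, (hΩ.isOpen.prod isOpen_univ).mem_nhds ⟨hxΩ, mem_univ _⟩, fun φ hφ => ?_⟩
        rw [hvanish Ω ?_ φ hφ, neg_zero]
        · have hφ' : IsTest (Ω ×ˢ Ioo (0 : ℝ) t) φ := hφ.mono fun q hq => ⟨hq.2.1, hq.1.2⟩
          rw [setIntegral_eq_integral_of_forall_compl_eq_zero fun q hq => ?_]
          · exact hu.isWeakDiv_cylinder hN hΩ.isOpen hΩ.isBounded hc hG φ hφ'
          · rw [hφ'.fderiv_eq_zero hq, hφ'.eq_zero hq]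
            simp
        · rw [disjoint_left]
          intro z hz hz'
          rw [hΩ.isOpen.frontier_eq] at hz'
          exact hz'.2 hz
      · have hxc : x ∈ (closure Ω)ᶜ := by
          intro hx
          exact hxS (by rw [hΩ.isOpen.frontier_eq]; exact ⟨hx, hxΩ⟩)
        refine ⟨(closure Ω)ᶜ ×ˢ univ,
          (isClosed_closure.isOpen_compl.prod isOpen_univ).mem_nhds ⟨hxc, mem_univ _⟩,
          fun φ hφ => ?_⟩
        rw [hvanish (closure Ω)ᶜ
          (disjoint_left.2 fun z hz hz' => hz (frontier_subset_closure hz')) φ hφ,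
          neg_zero]
        refine setIntegral_eq_zero_of_forall_eq_zero fun q hq => ?_
        have hq' : q ∉ (univ ×ˢ Ioo (0 : ℝ) t) ∩ ((closure Ω)ᶜ ×ˢ univ) := fun hq' =>
          hq'.2.1 (subset_closure hq.1)
        rw [hφ.fderiv_eq_zero hq', hφ.eq_zero hq']
        simp

end

end IsClassicalSolution

/-! ### Cutoff in time -/

/-- A smooth cutoff function of the interval `(0, t)`, which is `1` away from its ends. -/
def timeCutoff (t a s : ℝ) : ℝ := smoothStep (a * s) + smoothStep (a * (t - s)) - 1

section TimeCutoff

variable {t a : ℝ}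

lemma contDiff_timeCutoff : ContDiff ℝ 1 (timeCutoff t a) :=
  ((contDiff_smoothStep.comp (contDiff_const.mul contDiff_id)).add
    (contDiff_smoothStep.comp (contDiff_const.mul (contDiff_const.sub contDiff_id)))).sub
    contDiff_const

lemma hasDerivAt_timeCutoff (s : ℝ) :
    HasDerivAt (timeCutoff t a) (stepKernel a s - stepKernel a (t - s)) s := by
  have hd : ∀ r, HasDerivAt smoothStep (deriv smoothStep r) r := fun r =>
    (contDiff_smoothStep.differentiable one_ne_zero r).hasDerivAt
  have h1 : HasDerivAt (fun s : ℝ => smoothStep (a * s)) (deriv smoothStep (a * s) * a) s :=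
    HasDerivAt.comp (h₂ := smoothStep) s (hd (a * s)) (by simpa using (hasDerivAt_id s).const_mul a)
  have h2 : HasDerivAt (fun s : ℝ => smoothStep (a * (t - s)))
      (deriv smoothStep (a * (t - s)) * -a) s :=
    HasDerivAt.comp (h₂ := smoothStep) s (hd (a * (t - s))) (by simpa using ((hasDerivAt_id s).const_sub t).const_mul a)
  refine ((h1.add h2).sub_const 1).congr_deriv ?_
  simp only [stepKernel]
  ring

lemma abs_timeCutoff_le (s : ℝ) : |timeCutoff t a s| ≤ 3 := by
  have h1 := abs_le.1 (abs_smoothStep_le (a * s))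
  have h2 := abs_le.1 (abs_smoothStep_le (a * (t - s)))
  rw [timeCutoff, abs_le]
  constructor <;> linarith [h1.1, h1.2, h2.1, h2.2]

/-- `3 ≤ a * t` forces one step to be 1 where the other is 0: if `a * s < 1`, then `a * (t - s) >
2`. -/
lemma timeCutoff_eq_zero (ha : 0 < a) (hat : 3 ≤ a * t) {s : ℝ} (hs : s ∉ Icc (1 / a) (t - 1 / a)) :
    timeCutoff t a s = 0 := by
  have h1 : a * (1 / a) = 1 := mul_one_div_cancel ha.ne'
  rw [mem_Icc, not_and_or, not_le, not_le] at hs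
  rcases hs with hs | hs
  · have h2 := mul_lt_mul_of_pos_left hs ha
    rw [timeCutoff, smoothStep_of_le (by linarith), smoothStep_of_ge (by rw [mul_sub]; linarith)]
    norm_num
  · have h2 := mul_lt_mul_of_pos_left hs ha
    rw [mul_sub] at h2
    rw [timeCutoff, smoothStep_of_ge (by linarith), smoothStep_of_le (by rw [mul_sub]; linarith)]
    norm_num

lemma tendsto_timeCutoff {s : ℝ} (hs : s ∈ Ioo 0 t) :
    Tendsto (fun k : ℕ => timeCutoff t (k + 1) s) atTop (𝓝 1) := by
  refine tendsto_const_nhds.congr' ?_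
  have h0 : Tendsto (fun k : ℕ => (k : ℝ) + 1) atTop atTop :=
    tendsto_atTop_add_const_right _ _ tendsto_natCast_atTop_atTop
  filter_upwards [(h0.atTop_mul_const hs.1).eventually_ge_atTop 2,
    (h0.atTop_mul_const (sub_pos.2 hs.2)).eventually_ge_atTop 2] with k hk1 hk2
  rw [timeCutoff, smoothStep_of_ge hk1, smoothStep_of_ge hk2]
  norm_num

end TimeCutoff

/-- A cutoff function in space. -/
lemma exists_spaceCutoff {N : ℕ} {Ω : Set (Space N)} (hΩ : Bornology.IsBounded Ω) :
    ∃ η : Space N → ℝ, ContDiff ℝ 1 η ∧ HasCompactSupport η ∧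
      ∀ x ∈ closure Ω, η =ᶠ[𝓝 x] fun _ => 1 := by
  obtain ⟨R, hR⟩ := hΩ.closure.subset_ball (0 : Space N)
  have hR' : (0 : ℝ) < max R 1 := lt_max_of_lt_right one_pos
  let f : ContDiffBump (0 : Space N) := ⟨max R 1, max R 1 + 1, hR', lt_add_one _⟩
  refine ⟨f, f.contDiff, f.hasCompactSupport, fun x hx => ?_⟩
  filter_upwards [Metric.isOpen_ball.mem_nhds (hR hx)] with z hz
  exact f.one_of_mem_closedBall
    (Metric.ball_subset_closedBall (Metric.ball_subset_ball (le_max_left _ _) hz))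

lemma isTest_cutoff {N : ℕ} {η : Space N → ℝ} (hη : ContDiff ℝ 1 η) (hηc : HasCompactSupport η)
    {t a : ℝ} (ha : 0 < a) (hat : 3 ≤ a * t) :
    IsTest (univ ×ˢ Ioo (0 : ℝ) t) fun q : SpaceTime N => η q.1 * timeCutoff t a q.2 := by
  have hsub : tsupport (fun q : SpaceTime N => η q.1 * timeCutoff t a q.2) ⊆
      tsupport η ×ˢ Icc (1 / a) (t - 1 / a) := by
    refine closure_minimal ?_ ((isClosed_tsupport η).prod isClosed_Icc)
    intro q hq
    refine ⟨subset_tsupport η (left_ne_zero_of_mul hq), ?_⟩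
    by_contra h
    exact right_ne_zero_of_mul hq (timeCutoff_eq_zero ha hat h)
  refine ⟨(hη.comp contDiff_fst).mul (contDiff_timeCutoff.comp contDiff_snd), ?_, ?_⟩
  · exact (hηc.isCompact.prod isCompact_Icc).of_isClosed_subset (isClosed_tsupport _) hsub
  · refine hsub.trans (prod_mono (subset_univ _) fun s hs => ?_)
    have : 0 < 1 / a := by positivity
    exact ⟨by linarith [hs.1], by linarith [hs.2]⟩

/-! ### Passage to the limit in the time cut-off. -/

namespace IsClassicalSolution

variable {N : ℕ} {c : ℝ} {Ω : Set (Space N)} {G : SpaceTime N → ℝ} {u₀ v₀ : Space N → ℝ}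
  {uS p : Space N → ℝ → ℝ} {F : ℕ → Set (SpaceTime N)} {Z : Set (SpaceTime N)}
  {u : SpaceTime N → ℝ}

section

variable (hu : IsClassicalSolution c Ω G u₀ v₀ uS p F Z u)
include hu

lemma exists_bound_energyDensity (T : ℝ) : ∃ M, ∀ q ∈ closedCylinder Ω \ (Z ∪ ⋃ k, F k),
    q.2 ≤ T → ‖energyDensity c Ω u q‖ ≤ M := by
  obtain ⟨M, hM⟩ := hu.bounded_deriv T
  obtain ⟨M', hM'⟩ := exists_bound_energyFlux (N := N) (c := c) M
  exact ⟨M', fun q hq hqT => (norm_snd_le (energyFlux c (cylDeriv Ω u q))).trans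
    (hM' _ (hM q hq hqT))⟩

lemma continuousOn_energyDensity :
    ContinuousOn (energyDensity c Ω u) (closedCylinder Ω \ (Z ∪ ⋃ k, F k)) :=
  (continuous_energyFlux (N := N) (c := c)).snd.comp_continuousOn hu.continuousOn_deriv

lemma integrableOn_energyDensity (hΩ : IsOpen Ω) (hΩb : Bornology.IsBounded Ω) {t : ℝ}
    (ht : 0 ≤ t) : IntegrableOn (fun x : Space N => energyDensity c Ω u (x, t)) Ω := by
  obtain ⟨M, hM⟩ := hu.exists_bound_energyDensity t
  set A : Set (Space N) := Ω \ {x | (x, t) ∈ Z ∪ ⋃ k, F k} with hA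
  have hclosed : IsClosed {x : Space N | (x, t) ∈ Z ∪ ⋃ k, F k} :=
    hu.isClosed_singular.preimage (Continuous.prodMk_left t)
  have hnull : volume {x : Space N | (x, t) ∈ Z ∪ ⋃ k, F k} = 0 :=
    measure_eq_zero_iff_ae_notMem.2 (hu.ae_slice_notMem t)
  have hmaps : MapsTo (fun x : Space N => (x, t)) A (closedCylinder Ω \ (Z ∪ ⋃ k, F k)) :=
    fun x hx => ⟨⟨subset_closure hx.1, ht⟩, hx.2⟩
  have hAm : MeasurableSet A := hΩ.measurableSet.diff hclosed.measurableSet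
  have hres : (volume : Measure (Space N)).restrict A = volume.restrict Ω :=
    Measure.restrict_congr_set (sdiff_null_ae_eq_self hnull)
  rw [IntegrableOn, ← hres]
  refine (integrableOn_const (C := M) ((measure_mono sdiff_subset).trans_lt
    hΩb.measure_lt_top).ne).mono' ?_ ?_
  · exact (hu.continuousOn_energyDensity.comp (Continuous.prodMk_left t).continuousOn
      hmaps).aestronglyMeasurable hAm
  · filter_upwards [ae_restrict_mem hAm] with x hx using hM _ (hmaps hx) le_rfl

lemma aestronglyMeasurable_indicator_energyDensity (hc : 0 < c) (hΩ : IsOpen Ω) (t : ℝ) :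
    AEStronglyMeasurable ((Ω ×ˢ Ioo (0 : ℝ) t).indicator (energyDensity c Ω u))
      ((volume.restrict Ω).prod volume) := by
  have h1 : AEStronglyMeasurable (energyDensity c Ω u)
      ((volume : Measure (SpaceTime N)).restrict (Ω ×ˢ Ioo (0 : ℝ) t)) := by
    have h2 := (hu.aestronglyMeasurable_cylDeriv hc).mono_measure
      (Measure.restrict_mono (show Ω ×ˢ Ioo (0 : ℝ) t ⊆ closedCylinder Ω from
        prod_mono subset_closure fun s hs => hs.1.le) le_rfl)
    exact (continuous_energyFlux (N := N) (c := c)).snd.comp_aestronglyMeasurable h2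
  have h3 := (aestronglyMeasurable_indicator_iff (hΩ.measurableSet.prod measurableSet_Ioo)).2 h1
  refine h3.mono_measure ?_
  rw [show (volume.restrict Ω).prod (volume : Measure ℝ) =
    (volume : Measure (SpaceTime N)).restrict (Ω ×ˢ univ) by
      rw [Measure.volume_eq_prod, ← Measure.prod_restrict, Measure.restrict_univ]]
  exact Measure.restrict_le_self

omit hu in
lemma _root_.restrict_prod_volume (Ω : Set (Space N)) :
    (volume.restrict Ω).prod (volume : Measure ℝ) =
      (volume : Measure (SpaceTime N)).restrict (Ω ×ˢ univ) := by
  rw [Measure.volume_eq_prod, ← Measure.prod_restrict, Measure.restrict_univ]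

omit hu in
-- Extension by zero in time gives the form required by `tendsto_integral_stepKernel_prod`, where
-- the last variable runs over the whole line.
lemma _root_.setIntegral_mul_eq_integral_mul_indicator (hΩ : IsOpen Ω) (t : ℝ)
    (K f : SpaceTime N → ℝ) :
    ∫ q in Ω ×ˢ Ioo (0 : ℝ) t, K q * f q =
      ∫ q, K q * (Ω ×ˢ Ioo (0 : ℝ) t).indicator f q ∂(volume.restrict Ω).prod volume := by
  have hm : MeasurableSet (Ω ×ˢ Ioo (0 : ℝ) t) := hΩ.measurableSet.prod measurableSet_Ioo
  have h1 : (fun q => K q * (Ω ×ˢ Ioo (0 : ℝ) t).indicator f q) =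
      (Ω ×ˢ Ioo (0 : ℝ) t).indicator fun q => K q * f q := by
    funext q
    by_cases hq : q ∈ Ω ×ˢ Ioo (0 : ℝ) t
    · rw [indicator_of_mem hq, indicator_of_mem hq]
    · rw [indicator_of_notMem hq, indicator_of_notMem hq, mul_zero]
  rw [h1, integral_indicator hm, restrict_prod_volume, Measure.restrict_restrict hm,
    inter_eq_self_of_subset_left (prod_mono le_rfl (subset_univ _))]

lemma exists_ae_bound_indicator_energyDensity (hc : 0 < c) (t : ℝ) :
    ∃ M, ∀ᵐ q ∂(volume.restrict Ω).prod (volume : Measure ℝ),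
      ‖(Ω ×ˢ Ioo (0 : ℝ) t).indicator (energyDensity c Ω u) q‖ ≤ M := by
  obtain ⟨M, hM⟩ := hu.exists_bound_energyDensity t
  refine ⟨max M 0, ?_⟩
  rw [restrict_prod_volume]
  refine ae_restrict_of_ae ?_
  filter_upwards [measure_eq_zero_iff_ae_notMem.1 (hu.volume_singular hc)] with q hq
  by_cases hqO : q ∈ Ω ×ˢ Ioo (0 : ℝ) t
  · rw [indicator_of_mem hqO]
    exact (hM q ⟨⟨subset_closure hqO.1, hqO.2.1.le⟩, hq⟩ hqO.2.2.le).trans (le_max_left _ _)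
  · rw [indicator_of_notMem hqO, norm_zero]
    exact le_max_right _ _

lemma tendsto_energyDensity {x : Space N} (hx : x ∈ Ω) {s t : ℝ} (hs : 0 ≤ s)
    (hsing : (x, s) ∉ Z ∪ ⋃ k, F k) {l : Filter ℝ} {τ : ℝ → ℝ} (hτ : Tendsto τ l (𝓝 s))
    (hl : ∀ᶠ r in l, τ r ∈ Ioo 0 t ∧ (x, τ r) ∉ Z ∪ ⋃ k, F k) :
    Tendsto (fun r => (Ω ×ˢ Ioo (0 : ℝ) t).indicator (energyDensity c Ω u) (x, τ r)) l
      (𝓝 (energyDensity c Ω u (x, s))) := by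
  have h1 : Tendsto (fun r => (x, τ r)) l (𝓝[closedCylinder Ω \ (Z ∪ ⋃ k, F k)] (x, s)) := by
    refine tendsto_nhdsWithin_iff.2 ⟨tendsto_const_nhds.prodMk_nhds hτ, ?_⟩
    filter_upwards [hl] with r hr using ⟨⟨subset_closure hx, hr.1.1.le⟩, hr.2⟩
  have h2 : (x, s) ∈ closedCylinder Ω \ (Z ∪ ⋃ k, F k) := ⟨⟨subset_closure hx, hs⟩, hsing⟩
  refine (Tendsto.comp (hu.continuousOn_energyDensity _ h2) h1).congr' ?_
  filter_upwards [hl] with r hr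
  exact (indicator_of_mem (show (x, τ r) ∈ Ω ×ˢ Ioo (0 : ℝ) t from ⟨hx, hr.1⟩) _).symm

/-- For almost every `x` the point `(x, 0)` is regular, so the energy density has its initial value
as limit along regular times; the kernel selects that value. -/
lemma tendsto_integral_stepKernel_bottom (hc : 0 < c) (hΩ : IsOpen Ω)
    (hΩb : Bornology.IsBounded Ω) {t : ℝ} (ht : 0 < t) :
    Tendsto (fun k : ℕ => ∫ q in Ω ×ˢ Ioo (0 : ℝ) t, stepKernel (k + 1) q.2 * energyDensity c Ω u q)
      atTop (𝓝 (∫ x in Ω, energyDensity c Ω u (x, 0))) := by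
  obtain ⟨M, hM⟩ := hu.exists_ae_bound_indicator_energyDensity hc t
  simp_rw [setIntegral_mul_eq_integral_mul_indicator hΩ t]
  refine tendsto_integral_stepKernel_prod (b := fun _ => M) (N := Z ∪ ⋃ k, F k)
    (hu.aestronglyMeasurable_indicator_energyDensity hc hΩ t)
    (integrableOn_const hΩb.measure_lt_top.ne) hM ?_ ?_
  · rw [restrict_prod_volume]
    exact Measure.absolutelyContinuous_of_le Measure.restrict_le_self (hu.volume_singular hc)
  · filter_upwards [ae_restrict_mem hΩ.measurableSet, ae_restrict_of_ae (hu.ae_slice_notMem 0)]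
      with x hx hxs
    refine hu.tendsto_energyDensity hx le_rfl hxs (tendsto_id.mono_left nhdsWithin_le_nhds) ?_
    filter_upwards [self_mem_nhdsWithin, nhdsWithin_le_nhds (Iio_mem_nhds ht)] with r hr hrt
    exact ⟨⟨hr.1, hrt⟩, hr.2⟩

lemma tendsto_integral_stepKernel_top (hc : 0 < c) (hΩ : IsOpen Ω)
    (hΩb : Bornology.IsBounded Ω) {t : ℝ} (ht : 0 < t) :
    Tendsto (fun k : ℕ => ∫ q in Ω ×ˢ Ioo (0 : ℝ) t,
        stepKernel (k + 1) (t - q.2) * energyDensity c Ω u q)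
      atTop (𝓝 (∫ x in Ω, energyDensity c Ω u (x, t))) := by
  obtain ⟨M, hM⟩ := hu.exists_ae_bound_indicator_energyDensity hc t
  -- Reversing time reduces the top to a kernel concentrating at 0 from the right.
  set S : SpaceTime N ≃ᵐ SpaceTime N :=
    (MeasurableEquiv.refl (Space N)).prodCongr (MeasurableEquiv.subLeft t) with hS
  have hSa : ∀ q, S q = (q.1, t - q.2) := fun q => rfl
  have hSm : MeasurePreserving S ((volume.restrict Ω).prod volume)
      ((volume.restrict Ω).prod volume) :=
    (MeasurePreserving.id (volume.restrict Ω)).prod (Measure.measurePreserving_sub_left volume t)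
  have e1 : ∀ k : ℕ, ∫ q in Ω ×ˢ Ioo (0 : ℝ) t, stepKernel (k + 1) (t - q.2) * energyDensity c Ω u q =
      ∫ q, stepKernel (k + 1) q.2 * (Ω ×ˢ Ioo (0 : ℝ) t).indicator (energyDensity c Ω u) (S q)
        ∂(volume.restrict Ω).prod volume := by
    intro k
    rw [setIntegral_mul_eq_integral_mul_indicator hΩ t, ← hSm.integral_comp S.measurableEmbedding]
    simp only [hSa, sub_sub_cancel]
  simp_rw [e1]
  refine tendsto_integral_stepKernel_prod (b := fun _ => M) (N := S ⁻¹' (Z ∪ ⋃ k, F k))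
    ((hu.aestronglyMeasurable_indicator_energyDensity hc hΩ t).comp_measurePreserving hSm)
    (integrableOn_const hΩb.measure_lt_top.ne) (hSm.quasiMeasurePreserving.ae hM) ?_ ?_
  · refine hSm.quasiMeasurePreserving.preimage_null ?_
    rw [restrict_prod_volume]
    exact Measure.absolutelyContinuous_of_le Measure.restrict_le_self (hu.volume_singular hc)
  · filter_upwards [ae_restrict_mem hΩ.measurableSet, ae_restrict_of_ae (hu.ae_slice_notMem t)]
      with x hx hxs
    have hlim : Tendsto (fun r : ℝ => t - r) (𝓝 0) (𝓝 t) :=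
      (by fun_prop : Continuous fun r : ℝ => t - r).tendsto' 0 t (sub_zero t)
    refine hu.tendsto_energyDensity hx ht.le hxs (hlim.mono_left nhdsWithin_le_nhds) ?_
    filter_upwards [self_mem_nhdsWithin, nhdsWithin_le_nhds (Iio_mem_nhds ht)] with r hr hrt
    exact ⟨⟨sub_pos.2 hrt, sub_lt_self t hr.1⟩, hr.2⟩

/-- Over the closure of Ω the space cut-off is 1, so the differential of the test function is purely
temporal and sees only the time component of the flux, the energy density. -/
lemma integral_cutoff (hN : 1 ≤ N) (hΩ : IsLyapunovDomain Ω) (hc : 0 < c) {t : ℝ}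
    (hG : IntegrableOn G (Ω ×ˢ Ioc (0 : ℝ) t)) {k : ℕ} (hk : 3 ≤ ((k : ℝ) + 1) * t) :
    (∫ q in Ω ×ˢ Ioo (0 : ℝ) t, stepKernel (k + 1) q.2 * energyDensity c Ω u q)
      - (∫ q in Ω ×ˢ Ioo (0 : ℝ) t, stepKernel (k + 1) (t - q.2) * energyDensity c Ω u q)
      - (∫ q in Ω ×ˢ Ioo (0 : ℝ) t, timeCutoff t (k + 1) q.2 * (G q * velocity Ω u q)) =
    -∫ q, timeCutoff t (k + 1) q.2 * (deriv (uS q.1) q.2 * p q.1 q.2) ∂boundaryMeasure Ω t := by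
  obtain ⟨η, hη, hηc, hη1⟩ := exists_spaceCutoff hΩ.isBounded
  have hsub : Ω ×ˢ Ioo (0 : ℝ) t ⊆ Ω ×ˢ Ioc (0 : ℝ) t := prod_mono le_rfl Ioo_subset_Ioc_self
  have hmeas : MeasurableSet (Ω ×ˢ Ioo (0 : ℝ) t) := hΩ.isOpen.measurableSet.prod measurableSet_Ioo
  have hφ := isTest_cutoff hη hηc (a := (k : ℝ) + 1) (by positivity) hk
  have key := hu.integral_energyFluxField hN hΩ hc hG hφ
  have hrhs : ∫ q, (η q.1 * timeCutoff t (k + 1) q.2) * (deriv (uS q.1) q.2 * p q.1 q.2)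
      ∂boundaryMeasure Ω t =
      ∫ q, timeCutoff t (k + 1) q.2 * (deriv (uS q.1) q.2 * p q.1 q.2) ∂boundaryMeasure Ω t := by
    refine integral_congr_ae ?_
    filter_upwards [ae_boundaryMeasure_mem hΩ t] with q hq
    rw [(hη1 q.1 (frontier_subset_closure hq.1)).self_of_nhds, one_mul]
  have hpt : ∀ q ∈ Ω ×ˢ Ioo (0 : ℝ) t,
      fderiv ℝ (fun q : SpaceTime N => η q.1 * timeCutoff t (k + 1) q.2) q
        (energyFluxField c Ω u q) + -(G q * velocity Ω u q) * (η q.1 * timeCutoff t (k + 1) q.2) =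
      stepKernel (k + 1) q.2 * energyDensity c Ω u q
        - stepKernel (k + 1) (t - q.2) * energyDensity c Ω u q
        - timeCutoff t (k + 1) q.2 * (G q * velocity Ω u q) := by
    intro q hq
    have h1 := hη1 q.1 (subset_closure hq.1)
    have h2 : HasFDerivAt (fun q : SpaceTime N => timeCutoff t (k + 1) q.2) _ q :=
      (hasDerivAt_timeCutoff (t := t) (a := (k : ℝ) + 1) q.2).hasFDerivAt.comp q hasFDerivAt_snd
    have h3 : (fun q : SpaceTime N => η q.1 * timeCutoff t (k + 1) q.2) =ᶠ[𝓝 q]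
        fun q => timeCutoff t (k + 1) q.2 := by
      filter_upwards [continuous_fst.continuousAt.eventually h1] with z hz
      rw [hz, one_mul]
    rw [h3.fderiv_eq, h2.fderiv, h1.self_of_nhds]
    change (energyFluxField c Ω u q).2 • (stepKernel (k + 1) q.2 - stepKernel (k + 1) (t - q.2)) +
      -(G q * velocity Ω u q) * (1 * timeCutoff t (k + 1) q.2) = _
    rw [show (energyFluxField c Ω u q).2 = energyDensity c Ω u q from rfl, smul_eq_mul]
    ring
  rw [hrhs, setIntegral_congr_fun hmeas hpt] at key
  have hE : IntegrableOn (energyDensity c Ω u) (Ω ×ˢ Ioo (0 : ℝ) t) :=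
    ((hu.integrableOn_energyFluxField hc hΩ.isOpen hΩ.isBounded t).mono_set hsub).snd
  have hGu := (hu.integrableOn_mul_velocity hc hΩ.isOpen hG).mono_set hsub
  obtain ⟨C, hC⟩ := hasCompactSupport_deriv_smoothStep.exists_bound_of_continuous
    continuous_deriv_smoothStep
  have hC' : ∀ r, ‖stepKernel (k + 1) r‖ ≤ ((k : ℝ) + 1) * C := by
    intro r
    rw [stepKernel, norm_mul, Real.norm_of_nonneg (by positivity)]
    exact mul_le_mul_of_nonneg_left (hC _) (by positivity)
  have i1 : IntegrableOn (fun q : SpaceTime N => stepKernel (k + 1) q.2 * energyDensity c Ω u q)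
      (Ω ×ˢ Ioo (0 : ℝ) t) :=
    hE.bdd_mul ((continuous_stepKernel _).comp continuous_snd).aestronglyMeasurable
      (Eventually.of_forall fun q => hC' _)
  have i2 : IntegrableOn (fun q : SpaceTime N => stepKernel (k + 1) (t - q.2) *
      energyDensity c Ω u q) (Ω ×ˢ Ioo (0 : ℝ) t) :=
    hE.bdd_mul ((continuous_stepKernel _).comp
      (continuous_const.sub continuous_snd)).aestronglyMeasurable
      (Eventually.of_forall fun q => hC' _)
  have i3 : IntegrableOn (fun q : SpaceTime N => timeCutoff t (k + 1) q.2 *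
      (G q * velocity Ω u q)) (Ω ×ˢ Ioo (0 : ℝ) t) :=
    hGu.bdd_mul (contDiff_timeCutoff.continuous.comp continuous_snd).aestronglyMeasurable
      (Eventually.of_forall fun q => abs_timeCutoff_le _)
  have i12 : IntegrableOn (fun q : SpaceTime N => stepKernel (k + 1) q.2 * energyDensity c Ω u q
      - stepKernel (k + 1) (t - q.2) * energyDensity c Ω u q) (Ω ×ˢ Ioo (0 : ℝ) t) := i1.sub i2
  rw [← integral_sub i1 i2, ← integral_sub i12 i3]
  exact key

/-- The limit of `integral_cutoff`: the two kernel terms tend to the initial and final energies, the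
other two converge by domination. -/
theorem energy_balance (hN : 1 ≤ N) (hΩ : IsLyapunovDomain Ω) (hc : 0 < c) {t : ℝ} (ht : 0 < t)
    (hG : IntegrableOn G (Ω ×ˢ Ioc (0 : ℝ) t)) :
    (∫ x in Ω, energyDensity c Ω u (x, 0)) - (∫ x in Ω, energyDensity c Ω u (x, t))
      - (∫ q in Ω ×ˢ Ioo (0 : ℝ) t, G q * velocity Ω u q) =
    -∫ q, deriv (uS q.1) q.2 * p q.1 q.2 ∂boundaryMeasure Ω t := by
  have hsub : Ω ×ˢ Ioo (0 : ℝ) t ⊆ Ω ×ˢ Ioc (0 : ℝ) t := prod_mono le_rfl Ioo_subset_Ioc_self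
  have hmeas : MeasurableSet (Ω ×ˢ Ioo (0 : ℝ) t) := hΩ.isOpen.measurableSet.prod measurableSet_Ioo
  have hGu := (hu.integrableOn_mul_velocity hc hΩ.isOpen hG).mono_set hsub
  have hb := hu.integrable_boundary_flux hN hΩ t
  have hfin := hΩ.isFiniteMeasure_restrict_frontier
  have hcut : ∀ k : ℕ, Continuous fun q : SpaceTime N => timeCutoff t (k + 1) q.2 := fun k =>
    contDiff_timeCutoff.continuous.comp continuous_snd
  have t3 : Tendsto (fun k : ℕ => ∫ q in Ω ×ˢ Ioo (0 : ℝ) t,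
      timeCutoff t (k + 1) q.2 * (G q * velocity Ω u q)) atTop
      (𝓝 (∫ q in Ω ×ˢ Ioo (0 : ℝ) t, G q * velocity Ω u q)) := by
    refine tendsto_integral_of_dominated_convergence (fun q => 3 * ‖G q * velocity Ω u q‖)
      (fun k => (hcut k).aestronglyMeasurable.mul hGu.1) (hGu.norm.const_mul 3) (fun k => ?_) ?_
    · refine Eventually.of_forall fun q => ?_
      rw [norm_mul]
      exact mul_le_mul_of_nonneg_right (abs_timeCutoff_le _) (norm_nonneg _)
    · filter_upwards [ae_restrict_mem hmeas] with q hq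
      simpa using (tendsto_timeCutoff hq.2).mul_const (G q * velocity Ω u q)
  have t4 : Tendsto (fun k : ℕ => ∫ q, timeCutoff t (k + 1) q.2 *
      (deriv (uS q.1) q.2 * p q.1 q.2) ∂boundaryMeasure Ω t) atTop
      (𝓝 (∫ q, deriv (uS q.1) q.2 * p q.1 q.2 ∂boundaryMeasure Ω t)) := by
    refine tendsto_integral_of_dominated_convergence
      (fun q => 3 * ‖deriv (uS q.1) q.2 * p q.1 q.2‖)
      (fun k => (hcut k).aestronglyMeasurable.mul hb.1) (hb.norm.const_mul 3) (fun k => ?_) ?_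
    · refine Eventually.of_forall fun q => ?_
      rw [norm_mul]
      exact mul_le_mul_of_nonneg_right (abs_timeCutoff_le _) (norm_nonneg _)
    -- At `s = t` the cut-offs do not tend to 1, but this instant is null.
    · have h1 : ∀ᵐ s ∂(volume : Measure ℝ).restrict (Ioc (0 : ℝ) t), s ≠ t :=
        ae_restrict_of_ae (measure_eq_zero_iff_ae_notMem.1 (measure_singleton t))
      filter_upwards [ae_boundaryMeasure_mem hΩ t,
        Measure.quasiMeasurePreserving_snd.ae h1] with q hq hqt
      simpa using (tendsto_timeCutoff ⟨hq.2.1, hq.2.2.lt_of_ne hqt⟩).mul_const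
        (deriv (uS q.1) q.2 * p q.1 q.2)
  have h0 : Tendsto (fun k : ℕ => ((k : ℝ) + 1) * t) atTop atTop :=
    (tendsto_atTop_add_const_right _ _ tendsto_natCast_atTop_atTop).atTop_mul_const ht
  refine tendsto_nhds_unique (((hu.tendsto_integral_stepKernel_bottom hc hΩ.isOpen hΩ.isBounded
    ht).sub (hu.tendsto_integral_stepKernel_top hc hΩ.isOpen hΩ.isBounded ht)).sub t3)
    (t4.neg.congr' ?_)
  filter_upwards [h0.eventually_ge_atTop 3] with k hk
  exact (hu.integral_cutoff hN hΩ hc hG hk).symm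

end

end IsClassicalSolution

end

theorem theorem2p1 {N : ℕ} (hN : 1 ≤ N) {c : ℝ} (hc : 0 < c)
    (Ω : Set (Space N)) (hΩ : IsLyapunovDomain Ω)
    (G : SpaceTime N → ℝ) (hG : ∀ T : ℝ, IntegrableOn G (Ω ×ˢ Ioc (0 : ℝ) T))
    (u₀ v₀ : Space N → ℝ) (uS p : Space N → ℝ → ℝ)
    (F : ℕ → Set (SpaceTime N)) (Z : Set (SpaceTime N)) (u : SpaceTime N → ℝ)
    (hu : IsClassicalSolution c Ω G u₀ v₀ uS p F Z u)
    (t : ℝ) (ht : 0 ≤ t) :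
    IntegrableOn (fun x : Space N => energyDensity c Ω u (x, t)) Ω ∧
    IntegrableOn (fun x : Space N => energyDensity c Ω u (x, 0)) Ω ∧
    IntegrableOn (fun q : SpaceTime N => G q * velocity Ω u q) (Ω ×ˢ Ioc (0 : ℝ) t) ∧
    Integrable (fun q : SpaceTime N => deriv (uS q.1) q.2 * p q.1 q.2)
      (((Measure.euclideanHausdorffMeasure (N - 1)).restrict (frontier Ω)).prod
        (volume.restrict (Ioc (0 : ℝ) t))) ∧
    ∫ x in Ω, (energyDensity c Ω u (x, t) - energyDensity c Ω u (x, 0)) =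
      -(∫ s in (0 : ℝ)..t, ∫ x in Ω, G (x, s) * velocity Ω u (x, s))
        + ∫ s in (0 : ℝ)..t, ∫ x in frontier Ω, deriv (uS x) s * p x s
            ∂(Measure.euclideanHausdorffMeasure (N - 1)) := by
  have hEt := hu.integrableOn_energyDensity hΩ.isOpen hΩ.isBounded ht
  have hE0 := hu.integrableOn_energyDensity hΩ.isOpen hΩ.isBounded le_rfl
  have hGu := hu.integrableOn_mul_velocity hc hΩ.isOpen (hG t)
  have hb := hu.integrable_boundary_flux hN hΩ t
  refine ⟨hEt, hE0, hGu, hb, ?_⟩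
  -- The cut-off argument needs a nondegenerate time interval; for `t = 0` all terms vanish.
  rcases ht.eq_or_lt with rfl | ht0
  · simp
  have hfin := hΩ.isFiniteMeasure_restrict_frontier
  have key := hu.energy_balance hN hΩ hc ht0 (hG t)
  have e1 : ∫ q in Ω ×ˢ Ioo (0 : ℝ) t, G q * velocity Ω u q =
      ∫ s in (0 : ℝ)..t, ∫ x in Ω, G (x, s) * velocity Ω u (x, s) := by
    have h1 : (Ω ×ˢ Ioo (0 : ℝ) t : Set (SpaceTime N)) =ᵐ[volume] Ω ×ˢ Ioc (0 : ℝ) t :=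
      Measure.set_prod_ae_eq Filter.EventuallyEq.rfl Ioo_ae_eq_Ioc
    rw [setIntegral_congr_set h1, intervalIntegral.integral_of_le ht, Measure.volume_eq_prod,
      ← Measure.prod_restrict, integral_prod_symm]
    rw [Measure.prod_restrict]
    exact hGu
  have e2 : ∫ q, deriv (uS q.1) q.2 * p q.1 q.2 ∂boundaryMeasure Ω t =
      ∫ s in (0 : ℝ)..t, ∫ x in frontier Ω, deriv (uS x) s * p x s
            ∂(Measure.euclideanHausdorffMeasure (N - 1)) := by
    rw [intervalIntegral.integral_of_le ht]
    exact integral_prod_symm _ hb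
  rw [integral_sub hEt hE0, ← e1, ← e2]
  linarith
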